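/- **Model.** Let $\mathcal P,\mathcal Q$ be probability measures on a measurable space and let $0\le d\le n$. A perfect matching $M^*$ of the complete bipartite graph $K_{n,n}$ is drawn uniformly at random. A weighted bipartite graph $G$ is observed: all pairs in $M^*$ are connected, with independent weights of law $\mathcal P$; each other pair is connected independently with probability $d/n$, with independent weight of law $\mathcal Q$. An estimator $\hat M=\hat M(G)$ (possibly randomized) is an edge set of $K_{n,n}$, not necessarily a matching; its expected reconstruction error is $\mathbb E\,\ell(M^*,\hat M)$, where $\ell(M^*,\hat M)=\frac1n|M^*\triangle\hat M|$. Let $B(\mathcal P,\mathcal Q)=\int\sqrt{fg}\,d\mu$, where $f,g$ are the densities of $\mathcal P,\mathcal Q$ with respect to a common dominating measure $\mu$. **Theorem.** 1. (Sparse model.) For all probability measures $\mathcal P,\mathcal Q$ on a measurable space and all $\epsilon>0$ there is $c=c(\epsilon,\mathcal P,\mathcal Q)>0$ such that for every constant $d$ with $\sqrt d\,B(\mathcal P,\mathcal Q)\ge 1+\epsilon$ and all sufficiently large $n$, every estimator satisfies $\mathbb E\,\ell(M^*,\hat M)\ge c$. 2. (Dense model.) Let $S=\mathbb R$ or $S=[0,\infty)$.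 Let $\mathcal P$ have density $p$ on $\mathbb R$, and let $\rho$ be a probability density on $\mathbb R$ that vanishes outside $S$, is continuous at $0$ as a function on $S$, and has $0<\rho(0)<\infty$. For every $\epsilon>0$ there is $c=c(\epsilon,\mathcal P,\rho)>0$ such that the following holds for every sequence $d=d(n)\to\infty$ with $d(n)\le n$ for all large $n$, where $\mathcal Q=\mathcal Q_n$ has density $q(x)=\frac1d\rho(\frac xd)$. Suppose that either (a) $\sqrt{\rho(0)}\int_S\sqrt{p(x)}\,dx\ge 1+\epsilon$ (the integral may be infinite), or (b) $\rho$ is bounded and $\sqrt{d}\,B(\mathcal P,\mathcal Q_n)\ge 1+\epsilon$ for all large $n$. Then for all sufficiently large $n$, every estimator satisfies $\mathbb E\,\ell(M^*,\hat M)\ge c$. 3. (Sharpness.) Let $\mathcal P$ be a probability measure on a measurable space. Let $d(n)$ be real numbers and $\mathcal Q_n$ measures on the same space such that, for all large $n$, $0\le d(n)\le n$ and $\mathcal Q_n$ is a probability measure. If $\limsup_{n}\sqrt{d(n)}\,B(\mathcal P,\mathcal Q_n)\le 1$ (in particular if $\sqrt{d(n)}\,B(\mathcal P,\mathcal Q_n)\le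 1$ for all large $n$), then there are estimators with $\mathbb E\,\ell(M^*,\hat M)\to 0$ as $n\to\infty$. 4. (Exponential model.) Let $d=n$, $\mathcal P=\exp(\lambda)$ with $\lambda>0$ and $\mathcal Q=\exp(1/n)$ (exponential laws with rates $\lambda$ and $1/n$). If $\lambda<4$, there is $c>0$ such that for all sufficiently large $n$ every estimator satisfies $\mathbb E\,\ell(M^*,\hat M)\ge c$. If $\lambda\ge4$, there are estimators with $\mathbb E\,\ell(M^*,\hat M)\to0$. -/

import Mathlib

open MeasureTheory ProbabilityTheory Filter Topology
open scoped ENNReal symmDiff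

namespace PlantedMatching

/-- The Bhattacharyya coefficient `B(P, Q) = ∫ √(f g) dμ`, where `f`, `g` are the densities of
`P`, `Q` with respect to the common dominating measure `μ = P + Q`. -/
noncomputable def bhattacharyya {X : Type*} [MeasurableSpace X] (P Q : Measure X) : ℝ :=
  ∫ x, √((P.rnDeriv (P + Q) x).toReal * (Q.rnDeriv (P + Q) x).toReal) ∂(P + Q)

/-- A weighted bipartite graph on `[n] ∪ [n]'`: every node pair `(i, j)` carries either a weight
`Sum.inl x` (the pair is connected by an edge of weight `x`) or the symbol `Sum.inr ()` (the pair
is not connected). -/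
abbrev WeightedGraph (n : ℕ) (X : Type*) : Type _ := Fin n × Fin n → X ⊕ Unit

/-- The edge set `{(i, σ i)}` of a perfect matching of `K_{n,n}`; every perfect matching arises
from exactly one permutation `σ`. -/
def matching {n : ℕ} (σ : Equiv.Perm (Fin n)) : Finset (Fin n × Fin n) :=
  Finset.univ.filter fun e => σ e.1 = e.2

/-- The law of the label of a node pair outside the planted matching: connected with probability
`d / n`, and then with a weight drawn from `Q`. -/
noncomputable def nullLaw {X : Type*} [MeasurableSpace X] (n : ℕ) (d : ℝ) (Q : Measure X) :
    Measure (X ⊕ Unit) :=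
  ENNReal.ofReal (1 - d / n) • Measure.dirac (Sum.inr ()) +
    ENNReal.ofReal (d / n) • Q.map Sum.inl

/-- The conditional law of the observed weighted graph given that the planted matching is
`matching σ`: the labels are independent, planted pairs are connected with weights drawn from `P`,
the other pairs have law `nullLaw n d Q`. -/
noncomputable def graphLaw {X : Type*} [MeasurableSpace X] (n : ℕ) (d : ℝ) (P Q : Measure X)
    (σ : Equiv.Perm (Fin n)) : Measure (WeightedGraph n X) :=
  Measure.pi fun e => if e ∈ matching σ then P.map Sum.inl else nullLaw n d Q

/-- The fraction of misclassified edges `|M ∆ M'| / n`. -/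
noncomputable def loss {n : ℕ} (M M' : Finset (Fin n × Fin n)) : ℝ :=
  ((M ∆ M').card : ℝ) / n

/-- A (possibly randomized) estimator: given the observed graph it returns a random set of edges
of `K_{n,n}`, which need not be a matching. -/
abbrev Estimator (n : ℕ) (X : Type*) [MeasurableSpace X] : Type _ :=
  Kernel (WeightedGraph n X) (Finset (Fin n × Fin n))

/-- The expected reconstruction error `𝔼[ℓ(M*, M̂)]`, where `M*` is uniform over the perfect
matchings of `K_{n,n}`, the graph is drawn given `M*`, and `M̂` is drawn given the graph. -/
noncomputable def risk {X : Type*} [MeasurableSpace X] (n : ℕ) (d : ℝ) (P Q : Measure X)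
    (κ : Estimator n X) : ℝ :=
  (∑ σ : Equiv.Perm (Fin n), ∫ W, ∫ M, loss (matching σ) M ∂(κ W) ∂(graphLaw n d P Q σ)) /
    (Nat.factorial n : ℝ)

/-- For all large `n`, every estimator has expected reconstruction error at least `c`. -/
def ErrorAtLeast {X : Type*} [MeasurableSpace X] (c : ℝ) (d : ℕ → ℝ) (P : Measure X)
    (Q : ℕ → Measure X) : Prop :=
  ∀ᶠ n in atTop, ∀ κ : Estimator n X, IsMarkovKernel κ → c ≤ risk n (d n) P (Q n) κ

/-- Some sequence of (deterministic) estimators achieves almost perfect recovery. -/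
def AlmostPerfectRecovery {X : Type*} [MeasurableSpace X] (d : ℕ → ℝ) (P : Measure X)
    (Q : ℕ → Measure X) : Prop :=
  ∃ (M : ∀ n, WeightedGraph n X → Finset (Fin n × Fin n)) (hM : ∀ n, Measurable (M n)),
    Tendsto (fun n => risk n (d n) P (Q n) (Kernel.deterministic (M n) (hM n))) atTop (𝓝 0)

/-- The probability measure on `ℝ` with Lebesgue density `q x = ρ (x / d) / d`. -/
noncomputable def scaledNull (ρ : ℝ → ℝ≥0∞) (d : ℝ) : Measure ℝ :=
  volume.withDensity fun x => ENNReal.ofReal (1 / d) * ρ (x / d)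

end PlantedMatching

/-! Consider competitors that differ from the planted matching along one alternating cycle with `k`
planted pairs. There are about `n ^ k` of them, and each of the `2k` changed pairs contributes a
factor `√(d / n) * B` to the probability that the competitor is at least as likely. The count is
governed by `(√d * B) ^ (2k)`, hence the threshold `√d * B = 1`.

Above the threshold it suffices to find many competitors that are exactly as likely. With finitely
many labels, cut a long cycle into blocks of a fixed length `l + 1` and require that in each block
the labels of the planted pairs are a rearrangement of the labels of the arcs. By the method of
types this costs only a polynomial factor per block (`le_balancedWeight`), so a block has weight `Λ
> 1` for suitable `l`. Flipping the matching along such a cycle keeps the likelihood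
(`AdmissibleCycle.prod_flip`), and the reversed cycle is admissible afterwards: the flip is a
weight-preserving involution on pairs of a matching and a cycle. No edge set is correct in the root
row at both ends of a flip. Hence, if the number `N` of admissible cycles through a vertex satisfies
`𝔼 N² ≤ C (𝔼 N)²`, the Bayes risk is at least `1 / (16 C)` (`bayes_risk_ge_of_second_moment`).

With about `log n / log Λ` blocks, `Λ ^ (b + 1) ≥ n` keeps `𝔼 N` bounded below. For the second
moment, fix one cycle and view a second one as a walk of blocks. A transfer operator with a Lyapunov
function (`iterate_blockKernel_le`) separates walks that follow the first cycle throughout, of total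
weight at most `1`, from walks that jump, of total weight of order `Λ ^ (b + 1) / n`. Both are `O(𝔼
N)`.

A general weight space reduces to finitely many labels by cutting it along levels of the likelihood
ratio (`exists_partition_of_density`): the graph is generated from the labels by a channel that
ignores the matching (`risk_eq_of_mixture`). Only a lower bound for the measure `d • Q` enters,
which makes the constant uniform in `d`. In the dense model `d • Q` has density `ρ (x / d)`, which
tends to `ρ 0` on `S`.

Below or at the threshold, take the maximum likelihood estimator and a union bound
(`graphLaw_likelihood_le`). The matchings with `k` wrong rows number at most `n! / (n - k)! ≤ n ^ k
* exp (-k (k - 1) / (2n))`. For `k ≥ δ n` this exponential factor beats `(√d * B) ^ (2k)` even when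
`√d * B` slightly exceeds `1`, so the critical case is included. -/

namespace PlantedMatching

/-! ### Expectations over independent finite labels. -/

section FiniteExpectation

variable {E L : Type*} [Fintype E] [Fintype L] [DecidableEq E]

/-- The expectation of `F` over a random function `V : E → L` with independent values, `V e`
having the weights `law e`. -/
noncomputable def finExp (law : E → L → ℝ) (F : (E → L) → ℝ) : ℝ :=
  ∑ V : E → L, (∏ e, law e (V e)) * F V

variable {law : E → L → ℝ}

lemma finExp_prod_apply (φ : E → L → ℝ) :
    finExp law (fun V => ∏ e, φ e (V e)) = ∏ e, ∑ l, law e l * φ e l := by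
  rw [finExp, Finset.prod_univ_sum, Fintype.piFinset_univ]
  simp [Finset.prod_mul_distrib]

lemma finExp_one (h1 : ∀ e, ∑ l, law e l = 1) : finExp law (fun _ => 1) = 1 := by
  have := finExp_prod_apply (law := law) (fun _ _ => 1)
  simpa [h1] using this

lemma finExp_const_mul (c : ℝ) (F : (E → L) → ℝ) :
    finExp law (fun V => c * F V) = c * finExp law F := by
  simp only [finExp, Finset.mul_sum]
  exact Finset.sum_congr rfl fun V _ => by ring

lemma finExp_sum {J : Type*} (s : Finset J) (F : J → (E → L) → ℝ) :
    finExp law (fun V => ∑ j ∈ s, F j V) = ∑ j ∈ s, finExp law (F j) := by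
  simp only [finExp, Finset.mul_sum]
  exact Finset.sum_comm

lemma finExp_mono (h0 : ∀ e l, 0 ≤ law e l) {F G : (E → L) → ℝ} (h : ∀ V, F V ≤ G V) :
    finExp law F ≤ finExp law G :=
  Finset.sum_le_sum fun V _ =>
    mul_le_mul_of_nonneg_left (h V) (Finset.prod_nonneg fun e _ => h0 e _)

/-- Functions of disjoint sets of coordinates are independent. -/
lemma finExp_mul_of_dependsOn (h1 : ∀ e, ∑ l, law e l = 1) {F G : (E → L) → ℝ} {S T : Set E}
    (hF : DependsOn F S) (hG : DependsOn G T) (hST : Disjoint S T) :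
    finExp law (fun V => F V * G V) = finExp law F * finExp law G := by
  classical
  have key : finExp law F * finExp law G =
      finExp law (fun V => F V * G V) * finExp law (fun _ => 1) := by
    simp only [finExp, Finset.sum_mul_sum, ← Finset.sum_product']
    -- Two independent copies exchange their coordinates in `S`. This preserves the joint weight,
    -- and afterwards both `F` and `G` read the first copy.
    let φ : (E → L) × (E → L) → (E → L) × (E → L) := fun x =>
      (fun e => if e ∈ S then x.1 e else x.2 e, fun e => if e ∈ S then x.2 e else x.1 e)
    have hφ : ∀ x, φ (φ x) = x := by
      intro x
      ext e <;> by_cases he : e ∈ S <;> simp [φ, he]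
    refine Finset.sum_nbij' φ φ (by simp) (by simp) (fun x _ => hφ x) (fun x _ => hφ x) ?_
    rintro ⟨V, V'⟩ -
    have hw : (∏ e, law e (V e)) * (∏ e, law e (V' e)) =
        (∏ e, law e ((φ (V, V')).1 e)) * (∏ e, law e ((φ (V, V')).2 e)) := by
      rw [← Finset.prod_mul_distrib, ← Finset.prod_mul_distrib]
      refine Finset.prod_congr rfl fun e _ => ?_
      by_cases he : e ∈ S <;> simp [φ, he, mul_comm]
    have hF' : F V = F (φ (V, V')).1 := hF fun e he => by simp [φ, he]
    have hG' : G V' = G (φ (V, V')).1 := hG fun e he => by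
      simp [φ, Set.disjoint_right.1 hST he]
    calc (∏ e, law e (V e)) * F V * ((∏ e, law e (V' e)) * G V')
        = ((∏ e, law e (V e)) * (∏ e, law e (V' e))) * (F V * G V') := by ring
      _ = _ := by rw [hw, hF', hG']; ring
  rw [key, finExp_one h1, mul_one]

lemma finExp_prod_of_dependsOn (h1 : ∀ e, ∑ l, law e l = 1) {J : Type*} (s : Finset J)
    {F : J → (E → L) → ℝ} {S : J → Set E} (hF : ∀ j, DependsOn (F j) (S j))
    (hS : ∀ i j, i ≠ j → Disjoint (S i) (S j)) :
    finExp law (fun V => ∏ j ∈ s, F j V) = ∏ j ∈ s, finExp law (F j) := by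
  classical
  induction s using Finset.induction_on with
  | empty => simpa using finExp_one h1
  | insert a s ha ih =>
    simp only [Finset.prod_insert ha]
    rw [finExp_mul_of_dependsOn h1 (hF a) (T := ⋃ j ∈ s, S j), ih]
    · intro V V' h
      exact Finset.prod_congr rfl fun j hj => hF j fun e he =>
        h e (Set.mem_biUnion (Finset.mem_coe.2 hj) he)
    · refine Set.disjoint_iUnion₂_right.2 fun j hj => hS a j ?_
      rintro rfl
      exact ha hj

lemma finExp_apply (h1 : ∀ e, ∑ l, law e l = 1) (e₀ : E) (g : L → ℝ) :
    finExp law (fun V => g (V e₀)) = ∑ l, law e₀ l * g l := by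
  have := finExp_prod_apply (law := law) (fun e l => if e = e₀ then g l else 1)
  rw [Finset.prod_eq_single e₀] at this
  · simpa using this
  · intro e _ he
    simp [he, h1]
  · simp

/-- Distinct coordinates are independent. Expanding `f` into indicators of points reduces the claim
to products over single coordinates. -/
lemma finExp_comp_injective (h1 : ∀ e, ∑ l, law e l = 1) {I : Type*} [Fintype I]
    [DecidableEq I] {c : I → E} (hc : Function.Injective c) (f : (I → L) → ℝ) :
    finExp law (fun V => f fun i => V (c i)) = ∑ x : I → L, (∏ i, law (c i) (x i)) * f x := by
  classical
  have h : ∀ V : E → L, f (fun i => V (c i)) =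
      ∑ x : I → L, f x * ∏ i, (if V (c i) = x i then (1 : ℝ) else 0) := by
    intro V
    rw [Finset.sum_eq_single fun i => V (c i)]
    · simp
    · intro x _ hx
      obtain ⟨i, hi⟩ := Function.ne_iff.1 hx
      rw [Finset.prod_eq_zero (Finset.mem_univ i) (if_neg (Ne.symm hi)), mul_zero]
    · simp
  simp only [h]
  rw [finExp_sum]
  refine Finset.sum_congr rfl fun x _ => ?_
  rw [finExp_const_mul, mul_comm, finExp_prod_of_dependsOn h1
    (F := fun i V => if V (c i) = x i then (1 : ℝ) else 0) (S := fun i => {c i})]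
  · congr 1
    refine Finset.prod_congr rfl fun i _ => ?_
    rw [finExp_apply h1 (c i) (fun l => if l = x i then (1 : ℝ) else 0)]
    simp
  · intro i V V' hV
    simp [hV (c i) rfl]
  · intro i j hij
    simpa using fun h => hij (hc h)

end FiniteExpectation

end PlantedMatching

namespace PlantedMatching

/-! ### Positions on a cycle of blocks, in lexicographic order. -/

section CyclicIndex

variable {b l : ℕ}

/-- The predecessor of a position on a cycle of `b + 1` blocks of length `l + 1`. -/
def cyclePred (x : Fin (b + 1) × Fin (l + 1)) : Fin (b + 1) × Fin (l + 1) :=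
  Fin.cases (motive := fun _ => Fin (b + 1) × Fin (l + 1))
    (Fin.cases (motive := fun _ => Fin (b + 1) × Fin (l + 1)) (Fin.last b, Fin.last l)
      (fun m => (m.castSucc, Fin.last l)) x.1) (fun t => (x.1, t.castSucc)) x.2

@[simp] lemma cyclePred_succ (m : Fin (b + 1)) (t : Fin l) :
    cyclePred (m, t.succ) = (m, t.castSucc) := rfl

@[simp] lemma cyclePred_succ_zero (m : Fin b) :
    cyclePred (m.succ, (0 : Fin (l + 1))) = (m.castSucc, Fin.last l) := rfl

@[simp] lemma cyclePred_zero_zero :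
    cyclePred ((0 : Fin (b + 1)), (0 : Fin (l + 1))) = (Fin.last b, Fin.last l) := rfl

/-- The reversal of positions. -/
def cycleRev (x : Fin (b + 1) × Fin (l + 1)) : Fin (b + 1) × Fin (l + 1) := (x.1.rev, x.2.rev)

@[simp] lemma cycleRev_cycleRev (x : Fin (b + 1) × Fin (l + 1)) : cycleRev (cycleRev x) = x := by
  simp [cycleRev]

-- Reversal conjugates the predecessor to its inverse. This yields the successor without a separate
-- formula at block borders.
@[simp] lemma cyclePred_cycleRev_cyclePred (x : Fin (b + 1) × Fin (l + 1)) :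
    cyclePred (cycleRev (cyclePred x)) = cycleRev x := by
  obtain ⟨m, t⟩ := x
  induction t using Fin.cases with
  | zero =>
    induction m using Fin.cases with
    | zero => simp [cycleRev]
    | succ m => simp [cycleRev, Fin.rev_castSucc, Fin.rev_succ]
  | succ t => simp [cycleRev, Fin.rev_castSucc, Fin.rev_succ]

/-- The successor of a position, as a permutation with inverse `cyclePred`. -/
def cycleSucc : Equiv.Perm (Fin (b + 1) × Fin (l + 1)) where
  toFun x := cycleRev (cyclePred (cycleRev x))
  invFun := cyclePred
  left_inv x := by simp
  right_inv x := by simp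

@[simp] lemma cycleSucc_cyclePred (x : Fin (b + 1) × Fin (l + 1)) :
    cycleSucc (cyclePred x) = x := cycleSucc.right_inv x

lemma cyclePred_injective : Function.Injective (cyclePred (b := b) (l := l)) :=
  cycleSucc.symm.injective

lemma cyclePred_ne (hl : 0 < l) (x : Fin (b + 1) × Fin (l + 1)) : cyclePred x ≠ x := by
  obtain ⟨m, t⟩ := x
  induction t using Fin.cases with
  | zero =>
    induction m using Fin.cases with
    | zero => simp [Fin.ext_iff, hl.ne']
    | succ m => simp [Fin.ext_iff]
  | succ t => simp [Fin.ext_iff]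

end CyclicIndex

/-! ### Balanced label sequences. -/

section Balanced

variable {T : Type*} [Fintype T] {ι : Type*} [DecidableEq ι]

/-- Two label sequences without `none` which contain every label equally often. -/
def Balanced (y z : T → Option ι) : Prop :=
  (∀ t, y t ≠ none) ∧ ∀ o, (Finset.univ.filter fun t => y t = o).card =
    (Finset.univ.filter fun t => z t = o).card

instance [Fintype ι] (y z : T → Option ι) : Decidable (Balanced y z) :=
  inferInstanceAs (Decidable (_ ∧ _))

/-- The absence of `none` passes to `z` through the count at `o = none`. -/
lemma Balanced.symm {y z : T → Option ι} (h : Balanced y z) : Balanced z y := by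
  refine ⟨fun t ht => ?_, fun o => (h.2 o).symm⟩
  have h0 : (Finset.univ.filter fun t => y t = none).card = 0 := by
    simp [h.1]
  rw [h.2 none, Finset.card_eq_zero] at h0
  exact (Finset.ext_iff.1 h0 t).1 (by simp [ht]) |> Finset.notMem_empty t

lemma Balanced.comp_equiv {y z : T → Option ι} (h : Balanced y z) (e : T ≃ T) :
    Balanced (fun t => y (e t)) (fun t => z (e t)) := by
  refine ⟨fun t => h.1 _, fun o => ?_⟩
  have aux : ∀ y : T → Option ι, (Finset.univ.filter fun t => y (e t) = o).card =
      (Finset.univ.filter fun t => y t = o).card := fun y =>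
    Finset.card_bij (fun t _ => e t) (by simp) (by simp) fun t ht =>
      ⟨e.symm t, by simpa using ht, by simp⟩
  rw [aux, aux, h.2]

lemma Balanced.prod_eq [Fintype ι] {y z : T → Option ι} (h : Balanced y z) (f : Option ι → ℝ) :
    ∏ t, f (y t) = ∏ t, f (z t) := by
  rw [← Finset.prod_fiberwise' Finset.univ y f, ← Finset.prod_fiberwise' Finset.univ z f]
  simp [h.2]

end Balanced

/-! ### Flipping the matching along an admissible cycle preserves the likelihood. -/

section Flip

variable {b l : ℕ} {A : Type*}

/-- The cycle `w` traversed backwards. -/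
def reverseCycle (w : Fin (b + 1) × Fin (l + 1) → A) : Fin (b + 1) × Fin (l + 1) → A :=
  fun x => w (cyclePred (cycleRev x))

lemma reverseCycle_injective {w : Fin (b + 1) × Fin (l + 1) → A} (hw : Function.Injective w) :
    Function.Injective (reverseCycle w) :=
  hw.comp (cyclePred_injective.comp (Function.LeftInverse.injective cycleRev_cycleRev))

lemma reverseCycle_cyclePred (w : Fin (b + 1) × Fin (l + 1) → A) (x) :
    reverseCycle w (cyclePred x) = w (cycleRev x) := by
  simp [reverseCycle]

@[simp] lemma reverseCycle_reverseCycle (w : Fin (b + 1) × Fin (l + 1) → A) :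
    reverseCycle (reverseCycle w) = w := by
  funext x
  change reverseCycle w (cyclePred (cycleRev x)) = w x
  simp [reverseCycle_cyclePred]

lemma reverseCycle_root (w : Fin (b + 1) × Fin (l + 1) → A) :
    reverseCycle w (Fin.last b, Fin.last l) = w (Fin.last b, Fin.last l) := by
  simp [reverseCycle, cycleRev]

lemma range_reverseCycle (w : Fin (b + 1) × Fin (l + 1) → A) :
    Set.range (reverseCycle w) = Set.range w := by
  have : Function.Surjective fun x : Fin (b + 1) × Fin (l + 1) => cyclePred (cycleRev x) :=
    (cycleSucc.symm.surjective).comp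
      (Function.RightInverse.surjective cycleRev_cycleRev)
  exact this.range_comp w

variable [DecidableEq A]

/-- The permutation moving every vertex of the cycle `w` to the next one. -/
def cyclePerm (w : Fin (b + 1) × Fin (l + 1) → A) (hw : Function.Injective w) : Equiv.Perm A :=
  cycleSucc.viaFintypeEmbedding ⟨w, hw⟩

lemma cyclePerm_apply {w : Fin (b + 1) × Fin (l + 1) → A} (hw : Function.Injective w)
    (x : Fin (b + 1) × Fin (l + 1)) : cyclePerm w hw (w (cyclePred x)) = w x := by
  have := cycleSucc.viaFintypeEmbedding_apply_image ⟨w, hw⟩ (cyclePred x)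
  rw [cycleSucc_cyclePred] at this
  exact this

lemma cyclePerm_apply_of_notMem {w : Fin (b + 1) × Fin (l + 1) → A} (hw : Function.Injective w)
    {a : A} (ha : a ∉ Set.range w) : cyclePerm w hw a = a :=
  cycleSucc.viaFintypeEmbedding_apply_notMem_range ⟨w, hw⟩ ha

/-- The reversed cycle carries the inverse permutation; this makes the flip of a matching an
involution. -/
lemma cyclePerm_mul_reverseCycle {w : Fin (b + 1) × Fin (l + 1) → A}
    (hw : Function.Injective w) :
    cyclePerm w hw * cyclePerm (reverseCycle w) (reverseCycle_injective hw) = 1 := by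
  ext a
  by_cases ha : a ∈ Set.range w
  · obtain ⟨x, rfl⟩ := ha
    have h := cyclePerm_apply (reverseCycle_injective hw) (cycleRev x)
    rw [reverseCycle_cyclePred, cycleRev_cycleRev] at h
    rw [Equiv.Perm.mul_apply, h, reverseCycle, cycleRev_cycleRev, cyclePerm_apply hw]
    rfl
  · have ha' : a ∉ Set.range (reverseCycle w) := by rwa [range_reverseCycle]
    rw [Equiv.Perm.mul_apply, cyclePerm_apply_of_notMem _ ha', cyclePerm_apply_of_notMem hw ha]
    rfl

variable {ι : Type*} [DecidableEq ι]

/-- The cycle `w` is admissible for the labels `V`: on every block, the labels of the vertices and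
the labels of the arcs contain every label equally often. -/
def AdmissibleCycle (V : A × A → Option ι) (w : Fin (b + 1) × Fin (l + 1) → A) : Prop :=
  ∀ m, Balanced (fun t => V (w (m, t), w (m, t))) (fun t => V (w (cyclePred (m, t)), w (m, t)))

instance [Fintype ι] (V : A × A → Option ι) (w : Fin (b + 1) × Fin (l + 1) → A) :
    Decidable (AdmissibleCycle V w) :=
  inferInstanceAs (Decidable (∀ _, _))

/-- After the flip the old arc labels sit on the diagonal and the old diagonal labels on the arcs.
The shift by one position in `reverseCycle` matches the tails of the arcs of block `m.rev` with the
vertices of the new block `m`, so the two sequences of a block are merely interchanged. -/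
lemma AdmissibleCycle.flip {V : A × A → Option ι} {w : Fin (b + 1) × Fin (l + 1) → A}
    (hw : Function.Injective w) (h : AdmissibleCycle V w) :
    AdmissibleCycle (fun e => V (e.1, cyclePerm w hw e.2)) (reverseCycle w) := by
  intro m
  have := ((h m.rev).comp_equiv Fin.revPerm).symm
  convert this using 2 with t t
  · simp only [reverseCycle, cyclePerm_apply hw]
    rfl
  · simp only [reverseCycle_cyclePred]
    simp only [reverseCycle, cyclePerm_apply hw]
    rfl

/-- The weight of the labels `V` when the diagonal carries the law `p` and the remaining pairs
carry the law `q`. -/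
def diagLaw (p q : Option ι → ℝ) (e : A × A) : Option ι → ℝ := if e.1 = e.2 then p else q

/-- Only the entries `(a, a)` and `(a, τ a)` with `a` on the cycle exchange the laws `p` and `q`.
Balance makes the product of any function over the diagonal labels equal to that over the arc
labels, so the exchange has no effect. -/
lemma AdmissibleCycle.prod_flip [Fintype A] [Fintype ι] (hl : 0 < l) {V : A × A → Option ι}
    {w : Fin (b + 1) × Fin (l + 1) → A} (hw : Function.Injective w) (h : AdmissibleCycle V w)
    (p q : Option ι → ℝ) :
    ∏ e : A × A, diagLaw p q e (V (e.1, cyclePerm w hw e.2)) = ∏ e, diagLaw p q e (V e) := by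
  set τ := cyclePerm w hw with hτ
  have hbal : ∀ f : Option ι → ℝ, ∏ x, f (V (w x, w x)) = ∏ x, f (V (w (cyclePred x), w x)) := by
    intro f
    rw [Fintype.prod_prod_type, Fintype.prod_prod_type]
    exact Finset.prod_congr rfl fun m _ => (h m).prod_eq f
  have hsucc : ∀ f : Option ι → ℝ,
      ∏ x, f (V (w x, τ (w x))) = ∏ x, f (V (w (cyclePred x), w x)) := by
    intro f
    rw [← Equiv.prod_comp cycleSucc.symm]
    refine Finset.prod_congr rfl fun x _ => ?_
    change f (V (w (cyclePred x), τ (w (cyclePred x)))) = _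
    rw [hτ, cyclePerm_apply hw]
  -- In terms of the unflipped labels, row `a` carries `p` in column `τ a` instead of column `a`.
  have hrow : ∀ a, ∏ c, diagLaw p q (a, c) (V (a, τ c)) =
      ∏ c, (if c = τ a then p else q) (V (a, c)) := by
    intro a
    rw [← Equiv.prod_comp τ fun c => (if c = τ a then p else q) (V (a, c))]
    simp [diagLaw, τ.injective.eq_iff, eq_comm]
  have hne : ∀ x, τ (w x) ≠ w x := by
    intro x hx
    have h1 : w (cycleSucc x) = w x := by
      rw [← cyclePerm_apply hw (cycleSucc x)]
      have : cyclePred (cycleSucc x) = x := cycleSucc.left_inv x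
      rw [this, ← hτ, hx]
    refine cyclePred_ne hl (cycleSucc x) ?_
    have : cyclePred (cycleSucc x) = x := cycleSucc.left_inv x
    rw [this, hw h1]
  have hpair : ∀ a, τ a ≠ a → ∀ f : A → ℝ,
      ∏ c, f c = f a * f (τ a) * ∏ c ∈ {a, τ a}ᶜ, f c := by
    intro a ha f
    rw [← Finset.prod_mul_prod_compl {a, τ a} f, Finset.prod_pair ha.symm]
  rw [Fintype.prod_prod_type, Fintype.prod_prod_type, Finset.prod_congr rfl fun a _ => hrow a,
    ← Finset.prod_mul_prod_compl (Finset.univ.image w),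
    ← Finset.prod_mul_prod_compl (Finset.univ.image w) fun a => ∏ c, diagLaw p q (a, c) (V (a, c))]
  congr 1
  · rw [Finset.prod_image hw.injOn, Finset.prod_image hw.injOn]
    have h1 : ∀ x, ∏ c, (if c = τ (w x) then p else q) (V (w x, c)) =
        q (V (w x, w x)) * p (V (w x, τ (w x))) * ∏ c ∈ {w x, τ (w x)}ᶜ, q (V (w x, c)) := by
      intro x
      rw [hpair _ (hne x), if_neg (hne x).symm, if_pos rfl]
      congr 1
      refine Finset.prod_congr rfl fun c hc => ?_
      rw [if_neg]
      rintro rfl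
      simp at hc
    have h2 : ∀ x, ∏ c, diagLaw p q (w x, c) (V (w x, c)) =
        p (V (w x, w x)) * q (V (w x, τ (w x))) * ∏ c ∈ {w x, τ (w x)}ᶜ, q (V (w x, c)) := by
      intro x
      rw [hpair _ (hne x)]
      simp only [diagLaw, if_true, if_neg (hne x).symm]
      congr 1
      refine Finset.prod_congr rfl fun c hc => ?_
      rw [if_neg]
      rintro rfl
      simp at hc
    simp only [h1, h2, Finset.prod_mul_distrib, hsucc, hbal]
    ring
  · refine Finset.prod_congr rfl fun a ha => Finset.prod_congr rfl fun c _ => ?_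
    have ha' : a ∉ Set.range w := by simpa using ha
    rw [hτ, cyclePerm_apply_of_notMem hw ha']
    simp [diagLaw, eq_comm]

end Flip

end PlantedMatching

namespace PlantedMatching

/-! ### Errors counted by rows. -/

section RowErrors

variable {n : ℕ}

/-- The indicator that `M` and the matching of `σ` differ in the row `i`. -/
noncomputable def rowError (i : Fin n) (σ : Equiv.Perm (Fin n)) (M : Finset (Fin n × Fin n)) : ℝ :=
  if ∀ j, (i, j) ∈ M ↔ σ i = j then 0 else 1

lemma rowError_nonneg (i : Fin n) (σ : Equiv.Perm (Fin n)) (M : Finset (Fin n × Fin n)) :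
    0 ≤ rowError i σ M := by
  unfold rowError
  split_ifs <;> norm_num

/-- Row `i` of `M` can equal at most one of the two singletons `{σ i}` and `{σ' i}`. -/
lemma one_le_rowError_add {i : Fin n} {σ σ' : Equiv.Perm (Fin n)} (h : σ i ≠ σ' i)
    (M : Finset (Fin n × Fin n)) : 1 ≤ rowError i σ M + rowError i σ' M := by
  have h1 := rowError_nonneg i σ M
  have h2 := rowError_nonneg i σ' M
  by_cases hσ : ∀ j, (i, j) ∈ M ↔ σ i = j
  · have : ¬ ∀ j, (i, j) ∈ M ↔ σ' i = j := fun h' =>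
      h ((h' (σ i)).1 ((hσ (σ i)).2 rfl)).symm
    have h3 : rowError i σ' M = 1 := if_neg this
    linarith
  · have h3 : rowError i σ M = 1 := if_neg hσ
    linarith

/-- Every wrong row contains a misclassified pair, and different rows give different pairs. -/
lemma sum_rowError_le_loss (σ : Equiv.Perm (Fin n)) (M : Finset (Fin n × Fin n)) :
    (∑ i, rowError i σ M) / n ≤ loss (matching σ) M := by
  unfold loss
  gcongr
  have h1 : ∑ i, rowError i σ M =
      ((Finset.univ.filter fun i => ¬ ∀ j, (i, j) ∈ M ↔ σ i = j).card : ℝ) := by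
    rw [Finset.card_filter]
    push_cast
    refine Finset.sum_congr rfl fun i _ => ?_
    unfold rowError
    split_ifs <;> simp_all
  rw [h1, Nat.cast_le]
  refine (Finset.card_le_card fun i hi => ?_).trans
    (Finset.card_image_le (s := matching σ ∆ M) (f := Prod.fst))
  simp only [Finset.mem_filter, Finset.mem_univ, true_and, not_forall] at hi
  obtain ⟨j, hj⟩ := hi
  refine Finset.mem_image.2 ⟨(i, j), ?_, rfl⟩
  rw [Finset.mem_symmDiff]
  simp only [matching, Finset.mem_filter, Finset.mem_univ, true_and]
  tauto

end RowErrors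

/-! ### From a second moment bound to a lower bound for the Bayes risk. -/

section FlipBound

variable {n : ℕ} {ι : Type*} [Fintype ι] [DecidableEq ι]

/-- The law of the labels when the matching of `σ` is planted. -/
def labelLaw (p q : Option ι → ℝ) (σ : Equiv.Perm (Fin n)) (e : Fin n × Fin n) : Option ι → ℝ :=
  if e ∈ matching σ then p else q

/-- The labels in which the matching of `σ` becomes the diagonal. -/
def relabel (σ : Equiv.Perm (Fin n)) (W : Fin n × Fin n → Option ι) : Fin n × Fin n → Option ι :=
  fun e => W (e.1, σ e.2)

omit [Fintype ι] [DecidableEq ι] in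
lemma prod_labelLaw (p q : Option ι → ℝ) (σ : Equiv.Perm (Fin n))
    (W : Fin n × Fin n → Option ι) :
    ∏ e, labelLaw p q σ e (W e) = ∏ e, diagLaw p q e (relabel σ W e) := by
  rw [← Equiv.prod_comp ((Equiv.refl (Fin n)).prodCongr σ)]
  refine Finset.prod_congr rfl fun e _ => ?_
  obtain ⟨a, c⟩ := e
  have h : (Equiv.refl (Fin n)).prodCongr σ (a, c) = (a, σ c) := rfl
  have hm : (a, σ c) ∈ matching σ ↔ a = c := by simp [matching]
  rw [h, labelLaw, diagLaw, relabel]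
  by_cases hac : a = c
  · rw [if_pos (hm.2 hac), if_pos hac]
  · rw [if_neg (fun h => hac (hm.1 h)), if_neg hac]

-- By relabelling columns, all planted matchings may be treated as the diagonal.
omit [DecidableEq ι] in
lemma finExp_labelLaw (p q : Option ι → ℝ) (σ : Equiv.Perm (Fin n))
    (F : (Fin n × Fin n → Option ι) → ℝ) :
    finExp (labelLaw p q σ) (fun W => F (relabel σ W)) = finExp (diagLaw p q) F := by
  unfold finExp
  simp only [prod_labelLaw]
  exact Equiv.sum_comp (((Equiv.refl (Fin n)).prodCongr σ).arrowCongr (Equiv.refl _)).symm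
    fun V => (∏ e, diagLaw p q e (V e)) * F V

/-- The admissible cycles through the root `i`. -/
def rootedCycles (b l : ℕ) (i : Fin n) (V : Fin n × Fin n → Option ι) :
    Finset (Fin (b + 1) × Fin (l + 1) → Fin n) :=
  Finset.univ.filter fun w => Function.Injective w ∧ w (Fin.last b, Fin.last l) = i ∧
    AdmissibleCycle V w

variable {b l : ℕ}

lemma mem_rootedCycles {i : Fin n} {V : Fin n × Fin n → Option ι}
    {w : Fin (b + 1) × Fin (l + 1) → Fin n} : w ∈ rootedCycles b l i V ↔
      Function.Injective w ∧ w (Fin.last b, Fin.last l) = i ∧ AdmissibleCycle V w := by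
  simp [rootedCycles]

/-- Flip the matching along an injective cycle and reverse the cycle. -/
noncomputable def flipPair (x : Equiv.Perm (Fin n) × (Fin (b + 1) × Fin (l + 1) → Fin n)) :
    Equiv.Perm (Fin n) × (Fin (b + 1) × Fin (l + 1) → Fin n) :=
  open Classical in
  if h : Function.Injective x.2 then (x.1 * cyclePerm x.2 h, reverseCycle x.2) else x

lemma flipPair_flipPair (x : Equiv.Perm (Fin n) × (Fin (b + 1) × Fin (l + 1) → Fin n)) :
    flipPair (flipPair x) = x := by
  by_cases h : Function.Injective x.2
  · have h1 : flipPair x = (x.1 * cyclePerm x.2 h, reverseCycle x.2) := by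
      simp [flipPair, h]
    rw [h1, flipPair, dif_pos (reverseCycle_injective h)]
    simp [mul_assoc, cyclePerm_mul_reverseCycle]
  · have h1 : flipPair x = x := by simp [flipPair, h]
    rw [h1, h1]

lemma flipPair_mem {i : Fin n} {W : Fin n × Fin n → Option ι}
    {x : Equiv.Perm (Fin n) × (Fin (b + 1) × Fin (l + 1) → Fin n)}
    (h : x.2 ∈ rootedCycles b l i (relabel x.1 W)) :
    (flipPair x).2 ∈ rootedCycles b l i (relabel (flipPair x).1 W) := by
  obtain ⟨h1, h2, h3⟩ := mem_rootedCycles.1 h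
  rw [flipPair, dif_pos h1]
  exact mem_rootedCycles.2 ⟨reverseCycle_injective h1, (reverseCycle_root _).trans h2, h3.flip h1⟩

lemma prod_labelLaw_flipPair (hl : 0 < l) (p q : Option ι → ℝ) {i : Fin n}
    {W : Fin n × Fin n → Option ι}
    {x : Equiv.Perm (Fin n) × (Fin (b + 1) × Fin (l + 1) → Fin n)}
    (h : x.2 ∈ rootedCycles b l i (relabel x.1 W)) :
    ∏ e, labelLaw p q (flipPair x).1 e (W e) = ∏ e, labelLaw p q x.1 e (W e) := by
  obtain ⟨h1, h2, h3⟩ := mem_rootedCycles.1 h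
  rw [flipPair, dif_pos h1, prod_labelLaw, prod_labelLaw]
  exact h3.prod_flip hl h1 p q

/-- The root lies on the cycle and is moved by the cyclic permutation. -/
lemma flipPair_apply_ne (hl : 0 < l) {i : Fin n} {W : Fin n × Fin n → Option ι}
    {x : Equiv.Perm (Fin n) × (Fin (b + 1) × Fin (l + 1) → Fin n)}
    (h : x.2 ∈ rootedCycles b l i (relabel x.1 W)) : x.1 i ≠ (flipPair x).1 i := by
  obtain ⟨h1, h2, h3⟩ := mem_rootedCycles.1 h
  rw [flipPair, dif_pos h1]
  intro h4
  have h5 := x.1.injective h4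
  have h6 := cyclePerm_apply h1 (cycleSucc (Fin.last b, Fin.last l))
  have h7 : cyclePred (cycleSucc (Fin.last b, Fin.last l)) = (Fin.last b, Fin.last l) :=
    cycleSucc.left_inv _
  rw [h7, h2, ← h5, ← h2] at h6
  have h8 := h1 h6
  rw [← h8] at h7
  exact cyclePred_ne hl _ h7

/-- Double counting over pairs of a matching `σ` and an admissible cycle through `i`. The flip
preserves the weight and changes row `i`, so `M` errs at one end at least. As `σ` occurs once per
cycle, only pairs with at most `Z` cycles at both ends are kept; the discarded ones are controlled
by the square of the number of cycles. -/
lemma sum_rowError_ge (hl : 0 < l) {p q : Option ι → ℝ} (hp : ∀ o, 0 ≤ p o) (hq : ∀ o, 0 ≤ q o)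
    (i : Fin n) (W : Fin n × Fin n → Option ι) (M : Finset (Fin n × Fin n)) {Z : ℝ} (hZ : 0 < Z) :
    (∑ σ, (∏ e, labelLaw p q σ e (W e)) *
      (((rootedCycles b l i (relabel σ W)).card : ℝ) -
        2 / Z * ((rootedCycles b l i (relabel σ W)).card : ℝ) ^ 2)) / (2 * Z) ≤
    ∑ σ, (∏ e, labelLaw p q σ e (W e)) * rowError i σ M := by
  classical
  set wt : Equiv.Perm (Fin n) → ℝ := fun σ => ∏ e, labelLaw p q σ e (W e) with hwt
  set N : Equiv.Perm (Fin n) → ℝ := fun σ => ((rootedCycles b l i (relabel σ W)).card : ℝ) with hN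
  have hwt0 : ∀ σ, 0 ≤ wt σ := fun σ => Finset.prod_nonneg fun e _ => by
    unfold labelLaw
    split_ifs <;> simp [hp, hq]
  have hN0 : ∀ σ, 0 ≤ N σ := fun σ => Nat.cast_nonneg _
  let F : Finset (Equiv.Perm (Fin n) × (Fin (b + 1) × Fin (l + 1) → Fin n)) :=
    Finset.univ.filter fun x => x.2 ∈ rootedCycles b l i (relabel x.1 W)
  have hF : ∀ x, x ∈ F ↔ x.2 ∈ rootedCycles b l i (relabel x.1 W) := by simp [F]
  have hsum : ∀ f : Equiv.Perm (Fin n) → ℝ, ∑ x ∈ F, f x.1 = ∑ σ, N σ * f σ := by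
    intro f
    rw [Finset.sum_filter, Fintype.sum_prod_type]
    refine Finset.sum_congr rfl fun σ _ => ?_
    rw [← Finset.sum_filter]
    change ∑ _w ∈ Finset.univ.filter (fun w => w ∈ rootedCycles b l i (relabel σ W)), f σ = _
    rw [Finset.sum_const, nsmul_eq_mul, Finset.filter_univ_mem]
  have hflip : ∀ f : Equiv.Perm (Fin n) → Equiv.Perm (Fin n) → ℝ,
      ∑ x ∈ F, f x.1 (flipPair x).1 = ∑ x ∈ F, f (flipPair x).1 x.1 := by
    intro f
    refine Finset.sum_nbij' flipPair flipPair (fun x hx => (hF _).2 (flipPair_mem ((hF _).1 hx)))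
      (fun x hx => (hF _).2 (flipPair_mem ((hF _).1 hx))) (fun x _ => flipPair_flipPair x)
      (fun x _ => flipPair_flipPair x) fun x _ => ?_
    rw [flipPair_flipPair]
  have hw' : ∀ x ∈ F, wt (flipPair x).1 = wt x.1 := fun x hx =>
    prod_labelLaw_flipPair hl p q ((hF _).1 hx)
  let good : Equiv.Perm (Fin n) → ℝ := fun σ => if N σ ≤ Z then 1 else 0
  have hgood0 : ∀ σ, 0 ≤ good σ := fun σ => by simp only [good]; split_ifs <;> norm_num
  have hgood1 : ∀ σ, good σ ≤ 1 := fun σ => by simp only [good]; split_ifs <;> norm_num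
  let g : Equiv.Perm (Fin n) × (Fin (b + 1) × Fin (l + 1) → Fin n) → ℝ :=
    fun x => wt x.1 * (good x.1 * good (flipPair x).1)
  have step1 : ∑ x ∈ F, g x * rowError i x.1 M ≤ Z * ∑ σ, wt σ * rowError i σ M := by
    calc ∑ x ∈ F, g x * rowError i x.1 M
        ≤ ∑ x ∈ F, wt x.1 * good x.1 * rowError i x.1 M := by
          refine Finset.sum_le_sum fun x _ => mul_le_mul_of_nonneg_right ?_ (rowError_nonneg _ _ _)
          exact mul_le_mul_of_nonneg_left (mul_le_of_le_one_right (hgood0 _) (hgood1 _)) (hwt0 _)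
      _ = ∑ σ, N σ * (wt σ * good σ * rowError i σ M) := hsum fun σ => wt σ * good σ *
          rowError i σ M
      _ ≤ ∑ σ, Z * (wt σ * rowError i σ M) := by
          refine Finset.sum_le_sum fun σ _ => ?_
          have h1 : N σ * good σ ≤ Z := by
            simp only [good]
            split_ifs with h
            · simpa using h
            · simpa using hZ.le
          have h2 := mul_le_mul_of_nonneg_right h1 (mul_nonneg (hwt0 σ) (rowError_nonneg i σ M))
          linarith
      _ = _ := by rw [Finset.mul_sum]
  have step2 : ∑ x ∈ F, g x * rowError i (flipPair x).1 M = ∑ x ∈ F, g x * rowError i x.1 M := by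
    have := hflip fun σ σ' => wt σ * (good σ * good σ') * rowError i σ' M
    simp only [g]
    rw [this]
    refine Finset.sum_congr rfl fun x hx => ?_
    rw [hw' x hx]
    ring
  -- The weight `g` is symmetric under the flip, so the errors at both ends have equal sums, and
  -- together they are at least `1` per pair.
  have step3 : ∑ x ∈ F, g x ≤ 2 * ∑ x ∈ F, g x * rowError i x.1 M := by
    rw [two_mul]
    nth_rewrite 2 [← step2]
    rw [← Finset.sum_add_distrib]
    refine Finset.sum_le_sum fun x hx => ?_
    rw [← mul_add]
    exact le_mul_of_one_le_right
      (mul_nonneg (hwt0 _) (mul_nonneg (hgood0 _) (hgood0 _)))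
      (one_le_rowError_add (flipPair_apply_ne hl ((hF _).1 hx)) M)
  -- A union bound: a pair is lost when either end exceeds `Z`, and the flip makes the two losses
  -- equal.
  have step4 : ∑ x ∈ F, (wt x.1 - 2 * (wt x.1 * (1 - good x.1))) ≤ ∑ x ∈ F, g x := by
    have h1 : ∑ x ∈ F, wt x.1 * (1 - good (flipPair x).1) = ∑ x ∈ F, wt x.1 * (1 - good x.1) := by
      rw [hflip fun σ σ' => wt σ * (1 - good σ')]
      exact Finset.sum_congr rfl fun x hx => by rw [hw' x hx]
    have h2 : ∑ x ∈ F, (wt x.1 - 2 * (wt x.1 * (1 - good x.1))) =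
        ∑ x ∈ F, (wt x.1 - wt x.1 * (1 - good x.1) - wt x.1 * (1 - good (flipPair x).1)) := by
      simp only [Finset.sum_sub_distrib, h1, ← Finset.mul_sum]
      ring
    rw [h2]
    refine Finset.sum_le_sum fun x _ => ?_
    have h3 := mul_nonneg (hwt0 x.1) (mul_nonneg (sub_nonneg.2 (hgood1 x.1))
      (sub_nonneg.2 (hgood1 (flipPair x).1)))
    simp only [g]
    linarith
  have step5 : ∑ σ, wt σ * (N σ - 2 / Z * N σ ^ 2) ≤
      ∑ x ∈ F, (wt x.1 - 2 * (wt x.1 * (1 - good x.1))) := by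
    rw [hsum fun σ => wt σ - 2 * (wt σ * (1 - good σ))]
    refine Finset.sum_le_sum fun σ _ => ?_
    have h1 : N σ * (1 - good σ) ≤ N σ ^ 2 / Z := by
      simp only [good]
      split_ifs with h
      · simpa using by positivity
      · rw [le_div_iff₀ hZ]
        nlinarith [hN0 σ]
    have h2 := mul_le_mul_of_nonneg_left h1 (hwt0 σ)
    have h3 : 2 / Z * N σ ^ 2 = 2 * (N σ ^ 2 / Z) := by ring
    rw [h3]
    linarith
  rw [div_le_iff₀ (by positivity)]
  linarith

/-- A second moment bound for the number of admissible cycles through every vertex gives a lower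
bound for the Bayes risk. -/
lemma bayes_risk_ge_of_second_moment (hn : 0 < n) (hl : 0 < l) {p q : Option ι → ℝ}
    (hp : ∀ o, 0 ≤ p o) (hq : ∀ o, 0 ≤ q o) {C : ℝ} (hC : 0 < C)
    (h1 : ∀ i : Fin n, 0 < finExp (diagLaw p q) fun V => ((rootedCycles b l i V).card : ℝ))
    (h2 : ∀ i : Fin n, finExp (diagLaw p q) (fun V => ((rootedCycles b l i V).card : ℝ) ^ 2) ≤
      C * (finExp (diagLaw p q) fun V => ((rootedCycles b l i V).card : ℝ)) ^ 2)
    (u : (Fin n × Fin n → Option ι) → Finset (Fin n × Fin n) → ℝ) (hu : ∀ W M, 0 ≤ u W M)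
    (hu1 : ∀ W, ∑ M, u W M = 1) :
    1 / (16 * C) ≤ (∑ σ, finExp (labelLaw p q σ) fun W => ∑ M, u W M * loss (matching σ) M) /
      (n.factorial : ℝ) := by
  have hlaw : ∀ σ e o, 0 ≤ labelLaw (n := n) p q σ e o := fun σ e o => by
    unfold labelLaw
    split_ifs <;> simp [hp, hq]
  have hrow : ∀ i : Fin n, (n.factorial : ℝ) / (16 * C) ≤
      ∑ σ, finExp (labelLaw p q σ) fun W => ∑ M, u W M * rowError i σ M := by
    intro i
    set m := finExp (diagLaw p q) fun V => ((rootedCycles b l i V).card : ℝ) with hm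
    have hm0 : 0 < m := h1 i
    -- This makes the second moment term at most `m / 2`; the remaining `m / 2` divided by `2 * Z`
    -- is `1 / (16 * C)`.
    set Z := 4 * C * m with hZ
    have hZ0 : 0 < Z := by positivity
    have e1 : ∑ σ, finExp (labelLaw p q σ) (fun W => ∑ M, u W M * rowError i σ M) =
        ∑ W : Fin n × Fin n → Option ι, ∑ M, u W M *
          ∑ σ, (∏ e, labelLaw p q σ e (W e)) * rowError i σ M := by
      simp only [finExp, Finset.mul_sum]
      rw [Finset.sum_comm]
      refine Finset.sum_congr rfl fun W _ => ?_
      rw [Finset.sum_comm]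
      exact Finset.sum_congr rfl fun M _ => Finset.sum_congr rfl fun σ _ => by ring
    have e2 : ∑ W : Fin n × Fin n → Option ι, ∑ M, u W M *
        ((∑ σ, (∏ e, labelLaw p q σ e (W e)) *
          (((rootedCycles b l i (relabel σ W)).card : ℝ) -
            2 / Z * ((rootedCycles b l i (relabel σ W)).card : ℝ) ^ 2)) / (2 * Z)) =
        (∑ σ : Equiv.Perm (Fin n), (m - 2 / Z * finExp (diagLaw p q)
          fun V => ((rootedCycles b l i V).card : ℝ) ^ 2)) / (2 * Z) := by
      simp only [← Finset.sum_mul, hu1, one_mul]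
      rw [← Finset.sum_div, Finset.sum_comm]
      congr 1
      refine Finset.sum_congr rfl fun σ _ => ?_
      rw [hm, ← finExp_labelLaw p q σ, ← finExp_labelLaw p q σ, ← finExp_const_mul]
      simp only [finExp, ← Finset.sum_sub_distrib, mul_sub]
    have e3 : (n.factorial : ℝ) / (16 * C) ≤
        (∑ σ : Equiv.Perm (Fin n), (m - 2 / Z * finExp (diagLaw p q)
          fun V => ((rootedCycles b l i V).card : ℝ) ^ 2)) / (2 * Z) := by
      rw [Finset.sum_const, Finset.card_univ, Fintype.card_perm, Fintype.card_fin, nsmul_eq_mul]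
      have h3 : 2 / Z * (finExp (diagLaw p q)
          fun V => ((rootedCycles b l i V).card : ℝ) ^ 2) ≤ m / 2 := by
        calc _ ≤ 2 / Z * (C * m ^ 2) := by gcongr; exact h2 i
          _ = m / 2 := by rw [hZ]; field_simp; norm_num
      calc (n.factorial : ℝ) / (16 * C) = n.factorial * (m - m / 2) / (2 * Z) := by
            rw [hZ]; field_simp; norm_num
        _ ≤ _ := by gcongr
    rw [e1]
    refine e3.trans (e2.symm.le.trans ?_)
    exact Finset.sum_le_sum fun W _ => Finset.sum_le_sum fun M _ =>
      mul_le_mul_of_nonneg_left (sum_rowError_ge hl hp hq i W M hZ0) (hu W M)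
  have hn' : (0 : ℝ) < n := Nat.cast_pos.2 hn
  rw [le_div_iff₀ (by positivity)]
  calc 1 / (16 * C) * n.factorial = (∑ i : Fin n, (n.factorial : ℝ) / (16 * C)) / n := by
        rw [Finset.sum_const, Finset.card_univ, Fintype.card_fin, nsmul_eq_mul]
        field_simp
    _ ≤ (∑ i : Fin n, ∑ σ, finExp (labelLaw p q σ) fun W => ∑ M, u W M * rowError i σ M) / n := by
        gcongr with i
        exact hrow i
    _ = ∑ σ, finExp (labelLaw p q σ) fun W => ∑ M, u W M * ((∑ i, rowError i σ M) / n) := by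
        rw [Finset.sum_comm, Finset.sum_div]
        refine Finset.sum_congr rfl fun σ _ => ?_
        rw [← finExp_sum, div_eq_inv_mul, ← finExp_const_mul]
        congr 1
        funext W
        rw [Finset.sum_comm, Finset.mul_sum]
        refine Finset.sum_congr rfl fun M _ => ?_
        rw [← Finset.mul_sum]
        ring
    _ ≤ _ := by
        refine Finset.sum_le_sum fun σ _ => finExp_mono (hlaw σ) fun W => ?_
        exact Finset.sum_le_sum fun M _ =>
          mul_le_mul_of_nonneg_left (sum_rowError_le_loss σ M) (hu W M)

end FlipBound

end PlantedMatching

namespace PlantedMatching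

/-! ### The weight of a balanced block, by the method of types. -/

section BlockWeight

variable {ι : Type*} [Fintype ι] [DecidableEq ι]

/-- The total weight of the pairs of balanced sequences of length `k`, the entries of the first
one weighted by `p` and those of the second one by `ν`. -/
noncomputable def balancedWeight (k : ℕ) (p ν : Option ι → ℝ) : ℝ :=
  ∑ y : Fin k → Option ι, ∑ z : Fin k → Option ι,
    if Balanced y z then (∏ t, p (y t)) * ∏ t, ν (z t) else 0

/-- How often each label occurs in a sequence. -/
def labelCount {k : ℕ} (y : Fin k → Option ι) (o : Option ι) : Fin (k + 1) :=
  ⟨(Finset.univ.filter fun t => y t = o).card,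
    Nat.lt_succ_of_le ((Finset.card_le_univ _).trans (Fintype.card_fin k).le)⟩

/-- Sort the sequences by their label counts. There are at most `(k + 1) ^ |Option ι|` classes, so
Cauchy–Schwarz over the classes loses only a polynomial factor, and pairs within a class are the
balanced pairs. -/
lemma le_balancedWeight (k : ℕ) {p ν : Option ι → ℝ} (hp : ∀ o, 0 ≤ p o) (hν : ∀ o, 0 ≤ ν o)
    (hp0 : p none = 0) :
    (∑ o, √(p o * ν o)) ^ (2 * k) ≤
      ((k + 1 : ℕ) : ℝ) ^ Fintype.card (Option ι) * balancedWeight k p ν := by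
  set φ : (Fin k → Option ι) → ℝ := fun y => ∏ t, √(p (y t) * ν (y t)) with hφ
  have hφ_sum : ∑ y, φ y = (∑ o, √(p o * ν o)) ^ k := by
    have := Finset.prod_univ_sum (fun _ : Fin k => (Finset.univ : Finset (Option ι)))
      fun _ o => √(p o * ν o)
    rw [Fintype.piFinset_univ] at this
    rw [hφ, ← this]
    simp
  -- The product `φ` depends only on the label counts, so `φ y * φ z = φ y ^ 2`. Sequences
  -- containing `none` have `φ y = 0`, because `p none = 0`.
  have hterm : ∀ y z : Fin k → Option ι, labelCount y = labelCount z →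
      φ y * φ z = if Balanced y z then (∏ t, p (y t)) * ∏ t, ν (z t) else 0 := by
    intro y z hyz
    by_cases hy : ∃ t, y t = none
    · obtain ⟨t, ht⟩ := hy
      have h1 : φ y = 0 := Finset.prod_eq_zero (Finset.mem_univ t) (by simp [ht, hp0])
      rw [h1, zero_mul, if_neg fun h => h.1 t ht]
    · have hb : Balanced y z :=
        ⟨fun t ht => hy ⟨t, ht⟩, fun o => congrArg Fin.val (congrFun hyz o)⟩
      rw [if_pos hb, ← hb.prod_eq ν]
      have h2 : φ z = φ y := (hb.prod_eq fun o => √(p o * ν o)).symm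
      rw [h2, hφ, ← Finset.prod_mul_distrib, ← Finset.prod_mul_distrib]
      exact Finset.prod_congr rfl fun t _ =>
        Real.mul_self_sqrt (mul_nonneg (hp _) (hν _))
  have hfib : ∑ c : Option ι → Fin (k + 1), (∑ y with labelCount y = c, φ y) ^ 2 ≤
      balancedWeight k p ν := by
    have h1 : ∀ c : Option ι → Fin (k + 1), (∑ y with labelCount y = c, φ y) ^ 2 =
        ∑ y with labelCount y = c, ∑ z with labelCount z = labelCount y, φ y * φ z := by
      intro c
      rw [sq, Finset.sum_mul_sum]
      refine Finset.sum_congr rfl fun y hy => ?_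
      rw [(Finset.mem_filter.1 hy).2]
    simp only [h1]
    rw [Finset.sum_fiberwise]
    refine Finset.sum_le_sum fun y _ => ?_
    rw [Finset.sum_filter]
    refine Finset.sum_le_sum fun z _ => ?_
    split_ifs with h2 h3 h3
    · rw [hterm y z h2.symm, if_pos h3]
    · rw [hterm y z h2.symm, if_neg h3]
    · exact mul_nonneg (Finset.prod_nonneg fun _ _ => hp _) (Finset.prod_nonneg fun _ _ => hν _)
    · rfl
  calc (∑ o, √(p o * ν o)) ^ (2 * k) = (∑ y, φ y) ^ 2 := by rw [hφ_sum, ← pow_mul, mul_comm]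
    _ = (∑ c : Option ι → Fin (k + 1), ∑ y with labelCount y = c, φ y) ^ 2 := by
        rw [Finset.sum_fiberwise]
    _ ≤ (Finset.univ : Finset (Option ι → Fin (k + 1))).card *
        ∑ c : Option ι → Fin (k + 1), (∑ y with labelCount y = c, φ y) ^ 2 :=
        sq_sum_le_card_mul_sum_sq
    _ ≤ _ := by
        rw [Finset.card_univ, Fintype.card_fun, Fintype.card_fin, Nat.cast_pow]
        gcongr

/-- Above the threshold, long blocks have total weight larger than `1`. -/
lemma exists_one_lt_balancedWeight {p ν : Option ι → ℝ} (hp : ∀ o, 0 ≤ p o) (hν : ∀ o, 0 ≤ ν o)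
    (hp0 : p none = 0) (h : 1 < ∑ o, √(p o * ν o)) :
    ∃ l : ℕ, 0 < l ∧ 1 < balancedWeight (l + 1) p ν := by
  set K := Fintype.card (Option ι)
  set θ := ∑ o, √(p o * ν o)
  have hθ : 1 < θ ^ 2 := by nlinarith
  have h1 := (tendsto_pow_const_div_const_pow_of_one_lt K hθ).comp (tendsto_add_atTop_nat 1)
  have h2 : Tendsto (fun n : ℕ => ((n + 1 : ℕ) : ℝ) ^ K / (θ ^ 2) ^ n) atTop (𝓝 0) := by
    have h3 := h1.mul_const (θ ^ 2)
    rw [zero_mul] at h3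
    refine h3.congr fun n => ?_
    simp only [Function.comp]
    rw [pow_succ]
    field_simp
  obtain ⟨k, hk, hk2⟩ := ((h2.eventually (gt_mem_nhds one_pos)).and (eventually_ge_atTop 2)).exists
  obtain ⟨l, rfl⟩ : ∃ l, k = l + 1 := ⟨k - 1, by omega⟩
  refine ⟨l, by omega, ?_⟩
  have h4 := le_balancedWeight (l + 1) hp hν hp0
  rw [pow_mul] at h4
  rw [div_lt_one (by positivity)] at hk
  by_contra h5
  have h6 := mul_le_mul_of_nonneg_left (not_lt.1 h5)
    (by positivity : (0 : ℝ) ≤ ((l + 1 + 1 : ℕ) : ℝ) ^ K)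
  linarith

end BlockWeight

/-! ### Probabilities that one cycle, or two cycles, are admissible. -/

section Expectation

variable {ι : Type*} [Fintype ι] [DecidableEq ι] {A : Type*} [Fintype A] [DecidableEq A]
  {p q ν : Option ι → ℝ} {N : ℝ}

omit [DecidableEq ι] [Fintype A] in
lemma sum_diagLaw (hp1 : ∑ o, p o = 1) (hq1 : ∑ o, q o = 1) (e : A × A) :
    ∑ o, diagLaw p q e o = 1 := by
  unfold diagLaw
  split_ifs <;> assumption

omit [Fintype ι] [DecidableEq ι] [Fintype A] in
lemma diagLaw_nonneg (hp : ∀ o, 0 ≤ p o) (hq : ∀ o, 0 ≤ q o) (e : A × A) (o : Option ι) :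
    0 ≤ diagLaw p q e o := by
  unfold diagLaw
  split_ifs
  exacts [hp o, hq o]

/-- The probability that a block with start points `x` and end points `u` is balanced. -/
lemma finExp_balanced (hp1 : ∑ o, p o = 1) (hq1 : ∑ o, q o = 1)
    (hqν : ∀ j, q (some j) = ν (some j) / N) {k : ℕ} {x u : Fin k → A}
    (hu : Function.Injective u) (hx : ∀ t, x t ≠ u t) :
    finExp (diagLaw p q) (fun V => if Balanced (fun t => V (u t, u t)) (fun t => V (x t, u t))
      then 1 else 0) = balancedWeight k p ν / N ^ k := by
  let c : Fin k ⊕ Fin k → A × A := Sum.elim (fun t => (u t, u t)) fun t => (x t, u t)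
  -- The heads `u` are distinct and no arc is diagonal, so the block reads different coordinates and
  -- its labels are independent.
  have hc : Function.Injective c := by
    rintro (s | s) (t | t) h
    · rw [hu (Prod.ext_iff.1 h).1]
    · have h1 := hu (Prod.ext_iff.1 h).2
      subst h1
      exact absurd (Prod.ext_iff.1 h).1.symm (hx s)
    · have h1 := hu (Prod.ext_iff.1 h).2
      subst h1
      exact absurd (Prod.ext_iff.1 h).1 (hx s)
    · rw [hu (Prod.ext_iff.1 h).2]
  have h1 := finExp_comp_injective (sum_diagLaw (A := A) hp1 hq1) hc
    fun v => if Balanced (fun t => v (Sum.inl t)) (fun t => v (Sum.inr t)) then (1 : ℝ) else 0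
  refine h1.trans ?_
  rw [← (Equiv.sumArrowEquivProdArrow (Fin k) (Fin k) (Option ι)).symm.sum_comp,
    Fintype.sum_prod_type, balancedWeight, Finset.sum_div]
  refine Finset.sum_congr rfl fun y _ => ?_
  rw [Finset.sum_div]
  refine Finset.sum_congr rfl fun z _ => ?_
  rw [Fintype.prod_sum_type]
  have hcp : ∀ t, diagLaw p q (c (Sum.inl t)) = p := fun t => if_pos rfl
  have hcq : ∀ t, diagLaw p q (c (Sum.inr t)) = q := fun t => if_neg (hx t)
  simp only [hcp, hcq, Equiv.sumArrowEquivProdArrow_symm_apply_inl,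
    Equiv.sumArrowEquivProdArrow_symm_apply_inr]
  change _ * (if Balanced y z then (1 : ℝ) else 0) = _
  by_cases hb : Balanced y z
  · rw [if_pos hb, if_pos hb, mul_one, mul_div_assoc]
    congr 1
    have h2 : ∀ t, q (z t) = ν (z t) / N := by
      intro t
      obtain ⟨j, hj⟩ := Option.ne_none_iff_exists'.1 (hb.symm.1 t)
      rw [hj, hqν]
    simp [h2, Finset.prod_div_distrib]
  · rw [if_neg hb, if_neg hb]
    simp

omit [Fintype A] [DecidableEq A] in
lemma dependsOn_balanced {k : ℕ} (x u : Fin k → A) {S : Set (A × A)}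
    (h1 : ∀ t, (u t, u t) ∈ S) (h2 : ∀ t, (x t, u t) ∈ S) :
    DependsOn (fun V : A × A → Option ι =>
      if Balanced (fun t => V (u t, u t)) (fun t => V (x t, u t)) then (1 : ℝ) else 0) S := by
  intro V V' h
  simp only [h _ (h1 _), h _ (h2 _)]

/-- An upper bound for the probability that a block with start points `x` and end points `u` is
balanced, given the labels along a cycle with vertex set `R` and successor map `τ`: a block which
avoids `R` is unaffected, and otherwise only the presence of the new arcs is used. -/
noncomputable def blockBound (R : Finset A) (τ : Equiv.Perm A) (Λ δ : ℝ) {k : ℕ}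
    (x u : Fin k → A) : ℝ :=
  if ∀ t, u t ∉ R then Λ else ∏ t, if u t ∈ R ∧ τ (x t) = u t then 1 else δ

variable {b l : ℕ}

omit [Fintype A] [DecidableEq A] in
lemma ite_admissibleCycle (V : A × A → Option ι) (w : Fin (b + 1) × Fin (l + 1) → A) :
    (if AdmissibleCycle V w then (1 : ℝ) else 0) =
      ∏ m, if Balanced (fun t => V (w (m, t), w (m, t)))
        (fun t => V (w (cyclePred (m, t)), w (m, t))) then 1 else 0 := by
  by_cases h : AdmissibleCycle V w
  · rw [if_pos h, Finset.prod_eq_one fun m _ => if_pos (h m)]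
  · rw [if_neg h]
    obtain ⟨m, hm⟩ := not_forall.1 h
    exact (Finset.prod_eq_zero (Finset.mem_univ m) (if_neg hm)).symm

/-- Different blocks read columns indexed by disjoint sets of vertices, hence are independent. -/
lemma finExp_admissibleCycle (hl : 0 < l) (hp1 : ∑ o, p o = 1) (hq1 : ∑ o, q o = 1)
    (hqν : ∀ j, q (some j) = ν (some j) / N) {w : Fin (b + 1) × Fin (l + 1) → A}
    (hw : Function.Injective w) :
    finExp (diagLaw p q) (fun V => if AdmissibleCycle V w then 1 else 0) =
      (balancedWeight (l + 1) p ν / N ^ (l + 1)) ^ (b + 1) := by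
  simp only [ite_admissibleCycle]
  rw [finExp_prod_of_dependsOn (sum_diagLaw hp1 hq1)
    (F := fun m V => if Balanced (fun t => V (w (m, t), w (m, t)))
        (fun t => V (w (cyclePred (m, t)), w (m, t))) then 1 else 0)
    (S := fun m => {e | ∃ t, e.2 = w (m, t)})]
  · rw [Finset.prod_congr rfl fun m _ => finExp_balanced hp1 hq1 hqν
      (fun s t h => (Prod.ext_iff.1 (hw h)).2) fun t h => cyclePred_ne hl _ (hw h)]
    rw [Finset.prod_const, Finset.card_univ, Fintype.card_fin]
  · exact fun m => dependsOn_balanced _ _ (fun t => ⟨t, rfl⟩) fun t => ⟨t, rfl⟩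
  · intro m m' hm
    rw [Set.disjoint_left]
    rintro e ⟨t, ht⟩ ⟨t', ht'⟩
    exact hm (Prod.ext_iff.1 (hw (ht.symm.trans ht'))).1

-- `P` marks the arcs shared with a given cycle, for which nothing can be gained. Each other arc
-- must merely be present.
omit [DecidableEq ι] in
lemma finExp_arcs (hp1 : ∑ o, p o = 1) (hq1 : ∑ o, q o = 1) (hqν : ∀ j, q (some j) = ν (some j) / N)
    {k : ℕ} {x u : Fin k → A} (hu : Function.Injective u) (hx : ∀ t, x t ≠ u t)
    (P : Fin k → Prop) [DecidablePred P] :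
    finExp (diagLaw p q) (fun V => ∏ t, if P t then 1 else if V (x t, u t) = none then 0 else 1) =
      ∏ t, if P t then 1 else (∑ j, ν (some j)) / N := by
  rw [finExp_prod_of_dependsOn (sum_diagLaw hp1 hq1)
    (F := fun t V => if P t then 1 else if V (x t, u t) = none then 0 else 1)
    (S := fun t => {(x t, u t)})]
  · refine Finset.prod_congr rfl fun t _ => ?_
    split_ifs with h
    · exact finExp_one (sum_diagLaw hp1 hq1)
    · rw [finExp_apply (sum_diagLaw hp1 hq1) (x t, u t) fun o => if o = none then 0 else 1,
        Fintype.sum_option]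
      simp [diagLaw, hx t, hqν, Finset.sum_div]
  · intro t V V' h
    simp [h _ rfl]
  · intro s t hst
    simp only [Set.disjoint_singleton, ne_eq, Prod.mk.injEq, not_and]
    exact fun _ h => hst (hu h)

/-- The joint probability that two cycles are admissible. -/
lemma finExp_admissibleCycle_mul_le (hl : 0 < l) (hp : ∀ o, 0 ≤ p o) (hq : ∀ o, 0 ≤ q o)
    (hp1 : ∑ o, p o = 1) (hq1 : ∑ o, q o = 1)
    (hqν : ∀ j, q (some j) = ν (some j) / N) {w₀ w : Fin (b + 1) × Fin (l + 1) → A}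
    (hw₀ : Function.Injective w₀) (hw : Function.Injective w) :
    finExp (diagLaw p q) (fun V => (if AdmissibleCycle V w₀ then 1 else 0) *
        if AdmissibleCycle V w then 1 else 0) ≤
      (balancedWeight (l + 1) p ν / N ^ (l + 1)) ^ (b + 1) *
        ∏ m, blockBound (Finset.univ.image w₀) (cyclePerm w₀ hw₀)
          (balancedWeight (l + 1) p ν / N ^ (l + 1)) ((∑ j, ν (some j)) / N)
          (fun t => w (cyclePred (m, t))) fun t => w (m, t) := by
  classical
  set R := Finset.univ.image w₀ with hR
  set τ := cyclePerm w₀ hw₀ with hτ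
  have hmR : ∀ x, w₀ x ∈ R := fun x => Finset.mem_image_of_mem _ (Finset.mem_univ _)
  let off : Fin (b + 1) → Prop := fun m => ∀ t, w (m, t) ∉ R
  let arc : Fin (b + 1) → Fin (l + 1) → Prop := fun m t =>
    w (m, t) ∈ R ∧ τ (w (cyclePred (m, t))) = w (m, t)
  -- A block of `w` that avoids `w₀` keeps its balance condition. In a block that meets `w₀` only
  -- the presence of the arcs not shared with `w₀` is kept. Thus the factors read no coordinate used
  -- by `w₀`.
  let G : Fin (b + 1) → (A × A → Option ι) → ℝ := fun m V =>
    if off m then if Balanced (fun t => V (w (m, t), w (m, t)))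
        (fun t => V (w (cyclePred (m, t)), w (m, t))) then 1 else 0
    else ∏ t, if arc m t then 1 else if V (w (cyclePred (m, t)), w (m, t)) = none then 0 else 1
  have hG0 : ∀ m V, 0 ≤ G m V := by
    intro m V
    simp only [G]
    split_ifs
    · exact zero_le_one
    · exact le_rfl
    · exact Finset.prod_nonneg fun t _ => by split_ifs <;> norm_num
  have hle : ∀ V, (if AdmissibleCycle V w then (1 : ℝ) else 0) ≤ ∏ m, G m V := by
    intro V
    by_cases h : AdmissibleCycle V w
    · rw [if_pos h]
      refine (Finset.prod_eq_one fun m _ => ?_).symm.le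
      simp only [G, if_pos (h m)]
      split_ifs
      · rfl
      · exact Finset.prod_eq_one fun t _ => by
          rw [if_neg ((h m).symm.1 t)]
          simp
    · rw [if_neg h]
      exact Finset.prod_nonneg fun m _ => hG0 m V
  -- The coordinates read by `w₀`: its diagonal entries and its arcs.
  let S₀ : Set (A × A) := {e | e.2 ∈ R ∧ (e.1 = e.2 ∨ τ e.1 = e.2)}
  let S : Fin (b + 1) → Set (A × A) := fun m => {e | ∃ t, e.2 = w (m, t) ∧
    (off m ∨ (e.1 = w (cyclePred (m, t)) ∧ ¬ arc m t))}
  have hGS : ∀ m, DependsOn (G m) (S m) := by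
    intro m
    by_cases h : off m
    · simp only [G, if_pos h]
      exact dependsOn_balanced _ _ (fun t => ⟨t, rfl, Or.inl h⟩) fun t => ⟨t, rfl, Or.inl h⟩
    · simp only [G, if_neg h]
      intro V V' hV
      refine Finset.prod_congr rfl fun t _ => ?_
      by_cases ht : arc m t
      · rw [if_pos ht, if_pos ht]
      · rw [if_neg ht, if_neg ht, hV _ ⟨t, rfl, Or.inr ⟨rfl, ht⟩⟩]
  have hSS : ∀ m m', m ≠ m' → Disjoint (S m) (S m') := by
    intro m m' hm
    rw [Set.disjoint_left]
    rintro e ⟨t, ht, -⟩ ⟨t', ht', -⟩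
    exact hm (Prod.ext_iff.1 (hw (ht.symm.trans ht'))).1
  have hS₀ : Disjoint S₀ (⋃ m, S m) := by
    rw [Set.disjoint_iUnion_right]
    intro m
    rw [Set.disjoint_left]
    rintro e ⟨h1, h2⟩ ⟨t, ht, h3 | ⟨h3, h4⟩⟩
    · exact h3 t (ht ▸ h1)
    · rcases h2 with h2 | h2
      · exact cyclePred_ne hl (m, t) (hw (h3.symm.trans (h2.trans ht)))
      · exact h4 ⟨ht ▸ h1, h3 ▸ ht ▸ h2⟩
  have hexp : ∀ m, finExp (diagLaw p q) (G m) =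
      blockBound R τ (balancedWeight (l + 1) p ν / N ^ (l + 1)) ((∑ j, ν (some j)) / N)
        (fun t => w (cyclePred (m, t))) fun t => w (m, t) := by
    intro m
    have hinj : Function.Injective fun t => w (m, t) := fun s t h => (Prod.ext_iff.1 (hw h)).2
    have hne : ∀ t, w (cyclePred (m, t)) ≠ w (m, t) := fun t h => cyclePred_ne hl _ (hw h)
    unfold blockBound
    by_cases h : off m
    · rw [if_pos h]
      simp only [G, if_pos h]
      exact finExp_balanced hp1 hq1 hqν hinj hne
    · rw [if_neg h]
      simp only [G, if_neg h]
      exact finExp_arcs hp1 hq1 hqν hinj hne _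
  calc _ ≤ finExp (diagLaw p q) (fun V => (if AdmissibleCycle V w₀ then 1 else 0) *
        ∏ m, G m V) :=
        finExp_mono (diagLaw_nonneg hp hq) fun V =>
          mul_le_mul_of_nonneg_left (hle V) (by split_ifs <;> norm_num)
    _ = _ := by
        rw [finExp_mul_of_dependsOn (sum_diagLaw hp1 hq1) (S := S₀) (T := ⋃ m, S m)
          (F := fun V => if AdmissibleCycle V w₀ then 1 else 0), finExp_admissibleCycle hl hp1 hq1
          hqν hw₀, finExp_prod_of_dependsOn (sum_diagLaw hp1 hq1) _ hGS hSS]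
        · simp only [hexp]
        · intro V V' hV
          have h1 : AdmissibleCycle V w₀ ↔ AdmissibleCycle V' w₀ := by
            unfold AdmissibleCycle
            have h2 : ∀ x, V (w₀ x, w₀ x) = V' (w₀ x, w₀ x) := fun x => hV _ ⟨hmR x, Or.inl rfl⟩
            have h3 : ∀ x, V (w₀ (cyclePred x), w₀ x) = V' (w₀ (cyclePred x), w₀ x) := fun x =>
              hV _ ⟨hmR x, Or.inr (cyclePerm_apply hw₀ x)⟩
            simp only [h2, h3]
          simp only [h1]
        · intro V V' hV
          exact Finset.prod_congr rfl fun m _ => hGS m fun e he =>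
            hV e (Set.mem_iUnion.2 ⟨m, he⟩)
        · exact hS₀

end Expectation

end PlantedMatching

namespace PlantedMatching

/-! ### Sums over weighted walks as iterates of an operator. -/

section WalkOperator

variable {A B : Type*} [Fintype B]

/-- The operator of one step of a weighted walk on `A`: the step `u : B` has weight `k x u` at `x`
and leads to `e u`. -/
noncomputable def stepOp (k : A → B → ℝ) (e : B → A) (g : A → ℝ) (x : A) : ℝ :=
  ∑ u, k x u * g (e u)

lemma sum_walk_eq_iterate (k : A → B → ℝ) (e : B → A) (g : A → ℝ) (b : ℕ) (x : A) :
    ∑ U : Fin b → B, (∏ m : Fin b, k ((Fin.cons x (e ∘ U) : Fin (b + 1) → A) m.castSucc) (U m)) *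
      g ((Fin.cons x (e ∘ U) : Fin (b + 1) → A) (Fin.last b)) = (stepOp k e)^[b] g x := by
  induction b generalizing x with
  | zero => simp
  | succ b ih =>
    rw [Function.iterate_succ_apply', stepOp, ← (Fin.consEquiv fun _ => B).sum_comp,
      Fintype.sum_prod_type]
    refine Finset.sum_congr rfl fun u _ => ?_
    rw [← ih, Finset.mul_sum]
    refine Finset.sum_congr rfl fun U _ => ?_
    rw [Fin.prod_univ_succ, ← mul_assoc]
    change (k x u * ∏ m : Fin b, k ((Fin.cons x (e ∘ Fin.cons u U) : Fin (b + 2) → A)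
      m.castSucc.succ) (U m)) * g ((Fin.cons x (e ∘ Fin.cons u U) : Fin (b + 2) → A)
      (Fin.last b).succ) = _
    simp only [Fin.cons_succ]
    have h : e ∘ (Fin.cons u U : Fin (b + 1) → B) = Fin.cons (e u) (e ∘ U) := by
      funext m
      induction m using Fin.cases <;> simp
    rw [h]

lemma stepOp_mono {k : A → B → ℝ} (hk : ∀ x u, 0 ≤ k x u) (e : B → A) {g h : A → ℝ}
    (hgh : ∀ x, g x ≤ h x) (x : A) : stepOp k e g x ≤ stepOp k e h x :=
  Finset.sum_le_sum fun u _ => mul_le_mul_of_nonneg_left (hgh _) (hk x u)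

lemma stepOp_add_mul (k : A → B → ℝ) (e : B → A) (g h : A → ℝ) (c : ℝ) (x : A) :
    stepOp k e (fun y => g y + c * h y) x = stepOp k e g x + c * stepOp k e h x := by
  simp only [stepOp, Finset.mul_sum, ← Finset.sum_add_distrib]
  exact Finset.sum_congr rfl fun u _ => by ring

end WalkOperator

/-! ### Walks of arcs and of blocks in the presence of a fixed cycle. -/

section BlockOperator

variable {A : Type*} [Fintype A] [DecidableEq A] {R : Finset A} {τ : Equiv.Perm A} {δ Λ : ℝ}

/-- An upper bound for the conditional probability of an arc, given the labels along a cycle. -/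
noncomputable def arcBound (R : Finset A) (τ : Equiv.Perm A) (δ : ℝ) (x y : A) : ℝ :=
  (if y ∈ R ∧ τ x = y then 1 else 0) + δ

omit [Fintype A] in
lemma arcBound_nonneg (hδ : 0 ≤ δ) (x y : A) : 0 ≤ arcBound R τ δ x y := by
  unfold arcBound
  split_ifs <;> linarith

/-- The indicator function of a finite set. -/
noncomputable def finInd (Q : Finset A) (x : A) : ℝ := if x ∈ Q then 1 else 0

omit [Fintype A] in
lemma finInd_nonneg (Q : Finset A) (x : A) : 0 ≤ finInd Q x := by
  unfold finInd
  split_ifs <;> norm_num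

omit [Fintype A] in
lemma finInd_mono {Q Q' : Finset A} (h : Q ⊆ Q') (x : A) : finInd Q x ≤ finInd Q' x := by
  unfold finInd
  split_ifs with h1 h2
  · rfl
  · exact absurd (h h1) h2
  · norm_num
  · rfl

lemma sum_arcBound_mul (x : A) (g : A → ℝ) : ∑ y, arcBound R τ δ x y * g y =
    (if τ x ∈ R then g (τ x) else 0) + δ * ∑ y, g y := by
  simp only [arcBound, add_mul, Finset.sum_add_distrib, ← Finset.mul_sum]
  congr 1
  rw [Finset.sum_eq_single (τ x)]
  · simp
  · intro y _ hy
    rw [if_neg fun h => hy h.2.symm, zero_mul]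
  · simp

lemma stepOp_arcBound_one_le (x : A) :
    stepOp (arcBound R τ δ) id (fun _ => 1) x ≤ 1 + Fintype.card A * δ := by
  simp only [stepOp]
  rw [sum_arcBound_mul x fun _ => 1]
  simp only [Finset.sum_const, Finset.card_univ, nsmul_eq_mul, mul_one, mul_comm δ]
  gcongr
  split_ifs <;> norm_num

/-- A step into `Q` either follows `τ`, which pulls `Q` back to a set of the same size inside `R`,
or jumps, at cost `δ` per point of `Q`. -/
lemma stepOp_arcBound_finInd (hR : ∀ x, τ x ∈ R ↔ x ∈ R) {Q : Finset A} (hQ : Q ⊆ R) :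
    ∃ Q' ⊆ R, Q'.card = Q.card ∧ ∀ x,
      stepOp (arcBound R τ δ) id (finInd Q) x = finInd Q' x + δ * Q.card := by
  refine ⟨Q.map τ.symm.toEmbedding, fun x hx => ?_, Finset.card_map _, fun x => ?_⟩
  · obtain ⟨y, hy, rfl⟩ := Finset.mem_map.1 hx
    exact (hR _).1 (by simpa using hQ hy)
  · simp only [stepOp, id]
    rw [sum_arcBound_mul x (finInd Q)]
    congr 1
    · have h1 : x ∈ Q.map τ.symm.toEmbedding ↔ τ x ∈ Q := by
        rw [Finset.mem_map_equiv, Equiv.symm_symm]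
      unfold finInd
      by_cases h2 : τ x ∈ Q
      · rw [if_pos (hQ h2), if_pos h2, if_pos (h1.2 h2)]
      · rw [if_neg h2, if_neg fun h => h2 (h1.1 h), ite_self]
    · simp [finInd]

/-- Walks that follow `τ` throughout start in a translate `Q'` of `Q`; the error term pays for a
jump. -/
lemma iterate_arcBound_finInd_le (hδ : 0 ≤ δ) (hR : ∀ x, τ x ∈ R ↔ x ∈ R) {Q : Finset A}
    (hQ : Q ⊆ R) (k : ℕ) : ∃ Q' ⊆ R, Q'.card = Q.card ∧ ∀ x,
      (stepOp (arcBound R τ δ) id)^[k] (finInd Q) x ≤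
        finInd Q' x + k * (1 + Fintype.card A * δ) ^ k * (Q.card * δ) := by
  induction k with
  | zero => exact ⟨Q, hQ, rfl, fun x => by simp⟩
  | succ k ih =>
    obtain ⟨Q₁, hQ₁, hc₁, h₁⟩ := ih
    obtain ⟨Q₂, hQ₂, hc₂, h₂⟩ := stepOp_arcBound_finInd (δ := δ) hR hQ₁
    refine ⟨Q₂, hQ₂, hc₂.trans hc₁, fun x => ?_⟩
    rw [Function.iterate_succ_apply']
    set D := 1 + Fintype.card A * δ with hD
    have hD1 : 1 ≤ D := by rw [hD]; linarith [mul_nonneg (Nat.cast_nonneg' (Fintype.card A)) hδ]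
    have h3 := stepOp_mono (arcBound_nonneg (R := R) (τ := τ) hδ) id
      (h := fun y => finInd Q₁ y + k * D ^ k * (Q.card * δ) * 1) (fun y => by simpa using h₁ y) x
    rw [stepOp_add_mul, h₂, hc₁] at h3
    have h4 := mul_le_mul_of_nonneg_left (stepOp_arcBound_one_le (R := R) (τ := τ) (δ := δ) x)
      (by positivity : (0 : ℝ) ≤ k * D ^ k * (Q.card * δ))
    rw [← hD] at h4
    have h5 : (Q.card : ℝ) * δ ≤ D ^ (k + 1) * (Q.card * δ) :=
      le_mul_of_one_le_left (by positivity) (one_le_pow₀ hD1)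
    calc _ ≤ finInd Q₂ x + (δ * Q.card + k * D ^ k * (Q.card * δ) * D) := by linarith
      _ ≤ finInd Q₂ x + (D ^ (k + 1) * (Q.card * δ) + k * D ^ k * (Q.card * δ) * D) := by linarith
      _ = _ := by push_cast; ring

/-- The weight of the walks of length `k` which meet `R`. -/
lemma sum_walk_meets_le (hδ : 0 ≤ δ) (hR : ∀ x, τ x ∈ R ↔ x ∈ R) (k : ℕ) (x : A) :
    ∑ u : Fin k → A, (if ∀ t, u t ∉ R then 0 else
      ∏ t : Fin k, arcBound R τ δ ((Fin.cons x u : Fin (k + 1) → A) t.castSucc) (u t)) ≤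
      (1 + Fintype.card A * δ) ^ k * (finInd R x + k * (R.card * δ)) := by
  set D := 1 + Fintype.card A * δ with hD
  have hD1 : 1 ≤ D := by rw [hD]; linarith [mul_nonneg (Nat.cast_nonneg' (Fintype.card A)) hδ]
  have hall : ∀ (k : ℕ) (x : A), ∑ u : Fin k → A,
      ∏ t : Fin k, arcBound R τ δ ((Fin.cons x u : Fin (k + 1) → A) t.castSucc) (u t) ≤ D ^ k := by
    intro k
    have h1 := fun x => sum_walk_eq_iterate (arcBound R τ δ) id (fun _ => 1) k x
    simp only [mul_one, Function.id_comp] at h1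
    intro x
    rw [h1]
    clear h1
    induction k generalizing x with
    | zero => simp
    | succ k ih =>
      rw [Function.iterate_succ_apply']
      have h3 := stepOp_mono (arcBound_nonneg (R := R) (τ := τ) hδ) id
        (h := fun y => 0 + D ^ k * 1) (fun y => by simpa using ih y) x
      rw [stepOp_add_mul (arcBound R τ δ) id (fun _ => 0) (fun _ => 1)] at h3
      have h4 := mul_le_mul_of_nonneg_left (stepOp_arcBound_one_le (R := R) (τ := τ) (δ := δ) x)
        (by positivity : (0 : ℝ) ≤ D ^ k)
      have h5 : stepOp (arcBound R τ δ) id (fun _ => 0) x = 0 := by simp [stepOp]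
      rw [h5, zero_add] at h3
      rw [pow_succ]
      exact h3.trans h4
  induction k generalizing x with
  | zero => simpa using finInd_nonneg R x
  | succ k ih =>
    rw [← (Fin.consEquiv fun _ => A).sum_comp, Fintype.sum_prod_type]
    have h1 : ∀ y, ∑ u : Fin k → A, (if ∀ t, (Fin.consEquiv fun _ => A) (y, u) t ∉ R then 0 else
        ∏ t : Fin (k + 1), arcBound R τ δ ((Fin.cons x ((Fin.consEquiv fun _ => A) (y, u)) :
          Fin (k + 2) → A) t.castSucc) ((Fin.consEquiv fun _ => A) (y, u) t)) ≤
        arcBound R τ δ x y * (if y ∈ R then D ^ k else D ^ k * (k * (R.card * δ))) := by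
      intro y
      have h2 : ∀ u : Fin k → A, (if ∀ t, (Fin.consEquiv fun _ => A) (y, u) t ∉ R then 0 else
        ∏ t : Fin (k + 1), arcBound R τ δ ((Fin.cons x ((Fin.consEquiv fun _ => A) (y, u)) :
          Fin (k + 2) → A) t.castSucc) ((Fin.consEquiv fun _ => A) (y, u) t)) =
          arcBound R τ δ x y * (if y ∉ R ∧ ∀ t, u t ∉ R then 0 else
            ∏ t : Fin k, arcBound R τ δ ((Fin.cons y u : Fin (k + 1) → A) t.castSucc) (u t)) := by
        intro u
        rw [Fin.prod_univ_succ, mul_ite, mul_zero]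
        exact if_congr (Fin.forall_fin_succ) rfl rfl
      simp only [h2, ← Finset.mul_sum]
      refine mul_le_mul_of_nonneg_left ?_ (arcBound_nonneg hδ x y)
      -- Once the walk is in `R`, its continuation is arbitrary and `hall` applies. Otherwise the
      -- continuation must still meet `R`.
      by_cases hy : y ∈ R
      · simp only [hy, not_true, false_and, if_false, if_true]
        exact hall k y
      · simp only [hy, not_false_eq_true, true_and, if_false]
        have h3 := ih y
        rw [finInd, if_neg hy, zero_add] at h3
        exact h3
    refine (Finset.sum_le_sum fun y _ => h1 y).trans ?_
    rw [sum_arcBound_mul]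
    have h2 : (if τ x ∈ R then (if τ x ∈ R then D ^ k else D ^ k * (k * (R.card * δ))) else 0) ≤
        D ^ (k + 1) * finInd R x := by
      by_cases hx : x ∈ R
      · rw [if_pos ((hR x).2 hx), if_pos ((hR x).2 hx), finInd, if_pos hx, mul_one]
        exact pow_le_pow_right₀ hD1 k.le_succ
      · rw [if_neg fun h => hx ((hR x).1 h), finInd, if_neg hx, mul_zero]
    have h3 : ∑ y, (if y ∈ R then D ^ k else D ^ k * (k * (R.card * δ))) ≤
        R.card * D ^ k + Fintype.card A * (D ^ k * (k * (R.card * δ))) := by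
      calc _ ≤ ∑ y, ((if y ∈ R then D ^ k else 0) + D ^ k * (k * (R.card * δ))) := by
            refine Finset.sum_le_sum fun y _ => ?_
            split_ifs
            · exact le_add_of_nonneg_right (by positivity)
            · simp
        _ = _ := by
            rw [Finset.sum_add_distrib, Finset.sum_ite_mem, Finset.univ_inter, Finset.sum_const,
              Finset.sum_const, Finset.card_univ, nsmul_eq_mul, nsmul_eq_mul]
    have h4 := mul_le_mul_of_nonneg_left h3 hδ
    have h5 : D ^ k * (R.card * δ) ≤ D ^ (k + 1) * (R.card * δ) := by
      gcongr
      exact k.le_succ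
    calc _ ≤ D ^ (k + 1) * finInd R x +
          δ * (R.card * D ^ k + Fintype.card A * (D ^ k * (k * (R.card * δ)))) := add_le_add h2 h4
      _ = D ^ (k + 1) * finInd R x + D ^ k * (R.card * δ) +
          (D - 1) * (D ^ k * (k * (R.card * δ))) := by rw [hD]; ring
      _ ≤ D ^ (k + 1) * finInd R x + D ^ (k + 1) * (R.card * δ) +
          D * (D ^ k * (k * (R.card * δ))) := by
          gcongr
          linarith
      _ = _ := by push_cast; ring

/-- The kernel of one block of a walk. -/
noncomputable def blockKernel (R : Finset A) (τ : Equiv.Perm A) (Λ δ : ℝ) (k : ℕ) (x : A)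
    (u : Fin (k + 1) → A) : ℝ :=
  blockBound R τ Λ δ (fun t => (Fin.cons x u : Fin (k + 2) → A) t.castSucc) u

omit [Fintype A] in
lemma blockKernel_nonneg (hΛ : 0 ≤ Λ) (hδ : 0 ≤ δ) (k : ℕ) (x : A) (u : Fin (k + 1) → A) :
    0 ≤ blockKernel R τ Λ δ k x u := by
  unfold blockKernel blockBound
  split_ifs
  · exact hΛ
  · exact Finset.prod_nonneg fun t _ => by split_ifs <;> simp [hδ]

omit [Fintype A] in
lemma blockKernel_le_prod (hδ : 0 ≤ δ) (k : ℕ) (x : A) {u : Fin (k + 1) → A}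
    (hu : ¬ ∀ t, u t ∉ R) : blockKernel R τ Λ δ k x u ≤
      ∏ t : Fin (k + 1), arcBound R τ δ ((Fin.cons x u : Fin (k + 2) → A) t.castSucc) (u t) := by
  unfold blockKernel blockBound
  rw [if_neg hu]
  refine Finset.prod_le_prod (fun t _ => by split_ifs <;> simp [hδ]) fun t _ => ?_
  unfold arcBound
  split_ifs <;> linarith

/-- A block that ends in `Q ⊆ R` meets `R`. Hence the weight `Λ` plays no role, and the bound for
walks of single arcs applies. -/
lemma stepOp_blockKernel_finInd_le (hδ : 0 ≤ δ) (hR : ∀ x, τ x ∈ R ↔ x ∈ R) {Q : Finset A}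
    (hQ : Q ⊆ R) (k : ℕ) : ∃ Q' ⊆ R, Q'.card = Q.card ∧ ∀ x,
      stepOp (blockKernel R τ Λ δ k) (fun u => u (Fin.last k)) (finInd Q) x ≤ finInd Q' x +
        (k + 1 : ℕ) * (1 + Fintype.card A * δ) ^ (k + 1) * (Q.card * δ) := by
  obtain ⟨Q', hQ', hc, h⟩ := iterate_arcBound_finInd_le hδ hR hQ (k + 1)
  refine ⟨Q', hQ', hc, fun x => le_trans ?_ (h x)⟩
  rw [← sum_walk_eq_iterate, stepOp]
  refine Finset.sum_le_sum fun u _ => ?_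
  change _ ≤ _ * finInd Q (u (Fin.last k))
  by_cases hu : ∀ t, u t ∉ R
  · have h0 : finInd Q (u (Fin.last k)) = 0 := if_neg fun h => hu _ (hQ h)
    rw [h0, mul_zero, mul_zero]
  · exact mul_le_mul_of_nonneg_right (blockKernel_le_prod hδ k x hu) (finInd_nonneg _ _)

/-- The first term counts the blocks avoiding `R`, at weight `Λ` each; the second bounds those that
meet `R`. -/
lemma stepOp_blockKernel_one_le (hΛ : 0 ≤ Λ) (hδ : 0 ≤ δ) (hR : ∀ x, τ x ∈ R ↔ x ∈ R) (k : ℕ)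
    (x : A) :
    stepOp (blockKernel R τ Λ δ k) (fun u => u (Fin.last k)) (fun _ => 1) x ≤
      (Fintype.card A : ℝ) ^ (k + 1) * Λ +
        (1 + Fintype.card A * δ) ^ (k + 1) * (finInd R x + (k + 1 : ℕ) * (R.card * δ)) := by
  refine le_trans ?_ (add_le_add_right (sum_walk_meets_le hδ hR (k + 1) x) _)
  have h1 : (Fintype.card A : ℝ) ^ (k + 1) * Λ = ∑ _u : Fin (k + 1) → A, Λ := by
    rw [Finset.sum_const, Finset.card_univ, Fintype.card_fun, Fintype.card_fin, nsmul_eq_mul,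
      Nat.cast_pow]
  rw [h1, ← Finset.sum_add_distrib, stepOp]
  refine Finset.sum_le_sum fun u _ => ?_
  rw [mul_one]
  by_cases hu : ∀ t, u t ∉ R
  · rw [if_pos hu, blockKernel, blockBound, if_pos hu, add_zero]
  · rw [if_neg hu]
    exact (blockKernel_le_prod hδ k x hu).trans (le_add_of_nonneg_left hΛ)

/-- The total weight of the block walks from anywhere to a fixed point of `R`. -/
lemma iterate_blockKernel_le (hδ : 0 ≤ δ) (hR : ∀ x, τ x ∈ R ↔ x ∈ R)
    {r : A} (hr : r ∈ R) (k : ℕ) {c a Λ₁ η : ℝ} (hΛ0 : 0 ≤ Λ)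
    (hΛ₁ : Λ₁ = (Fintype.card A : ℝ) ^ (k + 1) * Λ) (h1Λ : 1 < Λ₁)
    (hc : c = (k + 1 : ℕ) * (1 + Fintype.card A * δ) ^ (k + 1))
    (ha : a = c / (Λ₁ - 1)) (hη : η = (a + 1) * (c * (R.card * δ))) (b : ℕ) (x : A) :
    (stepOp (blockKernel R τ Λ δ k) fun u => u (Fin.last k))^[b] (finInd {r}) x ≤
      1 + c * δ * (a + 1) / (Λ₁ - 1) * (Λ₁ + η) ^ b := by
  have hΛ1 : 0 < Λ₁ - 1 := by linarith
  set D := 1 + Fintype.card A * δ with hD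
  have hD1 : 1 ≤ D := by rw [hD]; linarith [mul_nonneg (Nat.cast_nonneg' (Fintype.card A)) hδ]
  have hc0 : 0 ≤ c := by rw [hc]; positivity
  have ha0 : 0 ≤ a := by rw [ha]; positivity
  have hη0 : 0 ≤ η := by rw [hη]; positivity
  have haΛ : a * Λ₁ = a + c := by rw [ha]; field_simp; ring
  have hDc : D ^ (k + 1) ≤ c := by
    rw [hc]
    refine le_mul_of_one_le_left (by positivity) ?_
    exact_mod_cast Nat.succ_pos k
  set op := stepOp (blockKernel R τ Λ δ k) fun u => u (Fin.last k) with hop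
  have hk0 := blockKernel_nonneg (R := R) (τ := τ) hΛ0 hδ k
  -- A Lyapunov function. The surcharge `a` on `R` is chosen so that `a + c = a * Λ₁`, which absorbs
  -- the extra weight `c` of blocks near the cycle; what remains is `η`.
  let h : A → ℝ := fun y => 1 + a * finInd R y
  have hh1 : ∀ y, 1 ≤ h y := fun y =>
    le_add_of_nonneg_right (mul_nonneg ha0 (finInd_nonneg R y))
  have hh2 : ∀ y, h y ≤ a + 1 := by
    intro y
    have : finInd R y ≤ 1 := by unfold finInd; split_ifs <;> norm_num
    simp only [h]
    nlinarith
  have hoph : ∀ y, op h y ≤ (Λ₁ + η) * h y := by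
    intro y
    have e1 : op h y = op (fun _ => 1) y + a * op (finInd R) y := stepOp_add_mul _ _ _ _ _ _
    obtain ⟨Q', hQ', -, e2⟩ := stepOp_blockKernel_finInd_le (Λ := Λ) hδ hR (Finset.Subset.refl R) k
    have e3 := (e2 y).trans (add_le_add_left (finInd_mono hQ' y) _)
    have e4 := stepOp_blockKernel_one_le (Λ := Λ) hΛ0 hδ hR k y
    rw [← hΛ₁, ← hD] at e4
    rw [← hD, ← hc] at e3
    have e5 : D ^ (k + 1) * (finInd R y + (k + 1 : ℕ) * (R.card * δ)) ≤
        c * finInd R y + c * (R.card * δ) := by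
      rw [mul_add]
      refine add_le_add (mul_le_mul_of_nonneg_right hDc (finInd_nonneg _ _)) (le_of_eq ?_)
      rw [hc]
      ring
    have e6 := mul_le_mul_of_nonneg_left e3 ha0
    have e7 : η ≤ η * h y := le_mul_of_one_le_right hη0 (hh1 y)
    calc op h y ≤ Λ₁ + (c * finInd R y + c * (R.card * δ)) +
          a * (finInd R y + c * (R.card * δ)) := by
          rw [e1]; exact add_le_add (e4.trans (by linarith)) e6
      _ = Λ₁ * h y + η := by
          simp only [h]
          rw [hη]
          linear_combination (-finInd R y) * haΛ
      _ ≤ (Λ₁ + η) * h y := by linarith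
  -- The indicator of the one-point set `Q` accounts for the walk that never leaves the cycle. Each
  -- iteration adds a jump of weight `c * δ`, which then grows at rate `Λ₁ + η`. Dividing by `Λ₁ -
  -- 1` instead of `Λ₁ + η - 1` leaves the slack `η` dropped in `e7`.
  have main : ∀ b : ℕ, ∃ Q ⊆ R, Q.card = 1 ∧ ∀ y, op^[b] (finInd {r}) y ≤
      finInd Q y + c * δ * (((Λ₁ + η) ^ b - 1) / (Λ₁ - 1)) * h y := by
    intro b
    induction b with
    | zero => exact ⟨{r}, by simpa using hr, rfl, fun y => by simp⟩
    | succ b ih =>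
      obtain ⟨Q, hQ, hQ1, ih⟩ := ih
      obtain ⟨Q', hQ', hQ'1, e2⟩ := stepOp_blockKernel_finInd_le (Λ := Λ) hδ hR hQ k
      refine ⟨Q', hQ', hQ'1.trans hQ1, fun y => ?_⟩
      rw [Function.iterate_succ_apply']
      have e1 := stepOp_mono hk0 (fun u => u (Fin.last k)) ih y
      rw [stepOp_add_mul, ← hop] at e1
      have e3 := e2 y
      rw [← hD, ← hc, hQ1, Nat.cast_one, one_mul] at e3
      have hpow : 1 ≤ (Λ₁ + η) ^ b := one_le_pow₀ (by linarith)
      have hG : 0 ≤ c * δ * (((Λ₁ + η) ^ b - 1) / (Λ₁ - 1)) := by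
        have : 0 ≤ (Λ₁ + η) ^ b - 1 := by linarith
        positivity
      have e4 := mul_le_mul_of_nonneg_left (hoph y) hG
      have e5 : c * δ ≤ c * δ * h y := le_mul_of_one_le_right (by positivity) (hh1 y)
      have e6 : c * δ * h y + c * δ * (((Λ₁ + η) ^ b - 1) / (Λ₁ - 1)) * ((Λ₁ + η) * h y) =
          c * δ * (((Λ₁ + η) ^ (b + 1) - 1 - η) / (Λ₁ - 1)) * h y := by
        field_simp
        ring
      have e7 : c * δ * (((Λ₁ + η) ^ (b + 1) - 1 - η) / (Λ₁ - 1)) * h y ≤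
          c * δ * (((Λ₁ + η) ^ (b + 1) - 1) / (Λ₁ - 1)) * h y := by
        refine mul_le_mul_of_nonneg_right (mul_le_mul_of_nonneg_left ?_ (by positivity))
          (zero_le_one.trans (hh1 y))
        exact div_le_div_of_nonneg_right (by linarith) hΛ1.le
      calc _ ≤ op (finInd Q) y + c * δ * (((Λ₁ + η) ^ b - 1) / (Λ₁ - 1)) * op h y := e1
        _ ≤ finInd Q' y + (c * δ * h y +
            c * δ * (((Λ₁ + η) ^ b - 1) / (Λ₁ - 1)) * ((Λ₁ + η) * h y)) := by linarith
        _ ≤ _ := by rw [e6]; linarith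
  obtain ⟨Q, -, -, hQ⟩ := main b
  refine (hQ x).trans (add_le_add (by unfold finInd; split_ifs <;> norm_num) ?_)
  have hpow : 1 ≤ (Λ₁ + η) ^ b := one_le_pow₀ (by linarith)
  have e1 : c * δ * (((Λ₁ + η) ^ b - 1) / (Λ₁ - 1)) * h x ≤
      c * δ * ((Λ₁ + η) ^ b / (Λ₁ - 1)) * (a + 1) := by
    have := hh1 x
    gcongr
    · linarith
    · exact hh2 x
  refine e1.trans (le_of_eq ?_)
  ring

end BlockOperator

end PlantedMatching

namespace PlantedMatching

/-! ### The number of injective cycles through a vertex. -/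

section CycleCount

variable {n b l : ℕ}

/-- The injective cycles through the root `i`. -/
def injectiveCycles (b l : ℕ) (i : Fin n) : Finset (Fin (b + 1) × Fin (l + 1) → Fin n) :=
  Finset.univ.filter fun w => Function.Injective w ∧ w (Fin.last b, Fin.last l) = i

/-- Transpositions identify the cycles through any two roots, and the cycles through all roots are
all the injective maps. -/
lemma card_injectiveCycles (i : Fin n) :
    n * (injectiveCycles b l i).card = n.descFactorial ((b + 1) * (l + 1)) := by
  have h1 : ∀ j : Fin n, (injectiveCycles b l j).card = (injectiveCycles b l i).card := by
    intro j
    refine Finset.card_bij' (fun w _ => Equiv.swap i j ∘ w) (fun w _ => Equiv.swap i j ∘ w)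
      ?_ ?_ ?_ ?_
    · intro w hw
      obtain ⟨h2, h3⟩ := (Finset.mem_filter.1 hw).2
      exact Finset.mem_filter.2 ⟨Finset.mem_univ _, (Equiv.injective _).comp h2, by simp [h3]⟩
    · intro w hw
      obtain ⟨h2, h3⟩ := (Finset.mem_filter.1 hw).2
      exact Finset.mem_filter.2 ⟨Finset.mem_univ _, (Equiv.injective _).comp h2, by simp [h3]⟩
    · intro w _
      funext x
      simp
    · intro w _
      funext x
      simp
  have h2 : ∑ j : Fin n, (injectiveCycles b l j).card =
      (Finset.univ.filter fun w : Fin (b + 1) × Fin (l + 1) → Fin n =>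
        Function.Injective w).card := by
    rw [Finset.card_eq_sum_card_fiberwise (f := fun w => w (Fin.last b, Fin.last l))
      (t := Finset.univ) (by simp)]
    refine Finset.sum_congr rfl fun j _ => ?_
    rw [Finset.filter_filter, injectiveCycles]
  have h3 : (Finset.univ.filter fun w : Fin (b + 1) × Fin (l + 1) → Fin n =>
      Function.Injective w).card = n.descFactorial ((b + 1) * (l + 1)) := by
    rw [← Fintype.card_subtype,
      Fintype.card_congr (Equiv.subtypeInjectiveEquivEmbedding _ _), Fintype.card_embedding_eq]
    simp
  rw [← h3, ← h2, Finset.sum_congr rfl fun j _ => h1 j]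
  simp

/-- With `k = (b + 1) * (l + 1)`, the falling factorial is at least `(n - k) ^ k`, and Bernoulli's
inequality gives `(1 - k / n) ^ k ≥ 1 - k² / n ≥ 1 / 2`. -/
lemma le_card_injectiveCycles (i : Fin n) (h : 2 * ((b + 1) * (l + 1)) ^ 2 ≤ n) :
    (n : ℝ) ^ ((b + 1) * (l + 1)) / 2 ≤ n * ((injectiveCycles b l i).card : ℝ) := by
  set k := (b + 1) * (l + 1) with hk
  have hk0 : 0 < k := by positivity
  have hkn : k ≤ n := by nlinarith
  have hn : (0 : ℝ) < n := by exact_mod_cast hk0.trans_le hkn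
  have h1 : ((n : ℝ) + 1 - k) ^ k ≤ n * ((injectiveCycles b l i).card : ℝ) := by
    have h2 := Nat.pow_sub_le_descFactorial n k
    rw [← card_injectiveCycles (b := b) (l := l) i] at h2
    have h3 : ((n + 1 - k : ℕ) : ℝ) = n + 1 - k := by
      rw [Nat.cast_sub (by omega)]
      push_cast
      ring
    rw [← h3]
    exact_mod_cast h2
  refine le_trans ?_ h1
  have h4 : 1 + (k : ℝ) * (-(k / n)) ≤ (1 + -(k / n)) ^ k := by
    refine one_add_mul_le_pow ?_ k
    have : (k : ℝ) / n ≤ 1 := (div_le_one hn).2 (by exact_mod_cast hkn)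
    linarith
  have h5 : (k : ℝ) * (k / n) ≤ 1 / 2 := by
    have h6 : (2 : ℝ) * k ^ 2 ≤ n := by exact_mod_cast h
    rw [← mul_div_assoc, div_le_div_iff₀ hn two_pos]
    linarith
  calc (n : ℝ) ^ k / 2 ≤ n ^ k * (1 + -(k / n)) ^ k := by
        rw [div_eq_mul_inv]
        gcongr
        linarith
    _ = (n - k : ℝ) ^ k := by
        rw [← mul_pow]
        congr 1
        field_simp
        ring
    _ ≤ _ := by
        have : (k : ℝ) ≤ n := by exact_mod_cast hkn
        gcongr
        linarith

end CycleCount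

/-! ### First and second moments of the number of admissible cycles. -/

section SecondMoment

variable {ι : Type*} [Fintype ι] [DecidableEq ι] {n b l : ℕ} {p q ν : Option ι → ℝ}

lemma card_rootedCycles (i : Fin n) (V : Fin n × Fin n → Option ι) :
    ((rootedCycles b l i V).card : ℝ) =
      ∑ w ∈ injectiveCycles b l i, if AdmissibleCycle V w then 1 else 0 := by
  have h : rootedCycles b l i V =
      (injectiveCycles b l i).filter fun w => AdmissibleCycle V w := by
    rw [injectiveCycles, Finset.filter_filter, rootedCycles]
    simp only [and_assoc]
  rw [h, Finset.card_filter]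
  push_cast
  rfl

lemma finExp_card_rootedCycles (hl : 0 < l) (hp1 : ∑ o, p o = 1) (hq1 : ∑ o, q o = 1)
    (hqν : ∀ j, q (some j) = ν (some j) / n) (i : Fin n) :
    finExp (diagLaw p q) (fun V => ((rootedCycles b l i V).card : ℝ)) =
      (injectiveCycles b l i).card * (balancedWeight (l + 1) p ν / n ^ (l + 1)) ^ (b + 1) := by
  simp only [card_rootedCycles]
  rw [finExp_sum, Finset.sum_congr rfl fun w hw =>
    finExp_admissibleCycle hl hp1 hq1 hqν (Finset.mem_filter.1 hw).2.1]
  rw [Finset.sum_const, nsmul_eq_mul]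

/-- The root is the predecessor of position `(0, 0)`, so a cycle is a walk of `b + 1` blocks from
`i` to `i`. The terms are nonnegative, so injectivity may be dropped. -/
lemma sum_blockBound_le {R : Finset (Fin n)} {τ : Equiv.Perm (Fin n)} {Λ δ : ℝ} (hΛ : 0 ≤ Λ)
    (hδ : 0 ≤ δ) (i : Fin n) :
    ∑ w ∈ injectiveCycles b l i, ∏ m, blockBound R τ Λ δ (fun t => w (cyclePred (m, t)))
      (fun t => w (m, t)) ≤
    (stepOp (blockKernel R τ Λ δ l) fun u => u (Fin.last l))^[b + 1] (finInd {i}) i := by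
  rw [← sum_walk_eq_iterate]
  set F : (Fin (b + 1) → Fin (l + 1) → Fin n) → ℝ := fun U =>
    (∏ m : Fin (b + 1), blockKernel R τ Λ δ l ((Fin.cons i ((fun u => u (Fin.last l)) ∘ U) :
      Fin (b + 2) → Fin n) m.castSucc) (U m)) *
      finInd {i} ((Fin.cons i ((fun u => u (Fin.last l)) ∘ U) : Fin (b + 2) → Fin n)
        (Fin.last (b + 1))) with hF
  have hF0 : ∀ U, 0 ≤ F U := fun U => mul_nonneg
    (Finset.prod_nonneg fun m _ => blockKernel_nonneg hΛ hδ _ _ _) (finInd_nonneg _ _)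
  have h1 : ∀ w ∈ injectiveCycles b l i, ∏ m, blockBound R τ Λ δ (fun t => w (cyclePred (m, t)))
      (fun t => w (m, t)) = F (Function.curry w) := by
    intro w hw
    have hroot := (Finset.mem_filter.1 hw).2.2
    have h2 : finInd {i} ((Fin.cons i ((fun u => u (Fin.last l)) ∘ Function.curry w) :
        Fin (b + 2) → Fin n) (Fin.last (b + 1))) = 1 := by
      rw [← Fin.succ_last, Fin.cons_succ]
      exact if_pos (Finset.mem_singleton.2 hroot)
    rw [hF]
    dsimp only
    rw [h2, mul_one]
    refine Finset.prod_congr rfl fun m _ => ?_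
    unfold blockKernel
    have h3 : (fun t => w (cyclePred (m, t))) = fun t : Fin (l + 1) =>
        (Fin.cons ((Fin.cons i ((fun u => u (Fin.last l)) ∘ Function.curry w) :
          Fin (b + 2) → Fin n) m.castSucc) (Function.curry w m) : Fin (l + 2) → Fin n)
          t.castSucc := by
      funext t
      induction t using Fin.cases with
      | zero =>
        induction m using Fin.cases with
        | zero => simpa using hroot
        | succ m => rfl
      | succ t => rfl
    rw [h3]
    rfl
  rw [Finset.sum_congr rfl h1]
  refine (Finset.sum_le_sum_of_subset_of_nonneg (Finset.subset_univ _)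
    fun w _ _ => hF0 _).trans (le_of_eq ?_)
  exact (Equiv.curry (Fin (b + 1)) (Fin (l + 1)) (Fin n)).sum_comp F

/-- The second factor bounds the sum over the second cycle `w` for each fixed `w₀`; the sum over
`w₀` then restores the first moment. -/
lemma finExp_card_rootedCycles_sq_le (hl : 0 < l) (hp : ∀ o, 0 ≤ p o) (hq : ∀ o, 0 ≤ q o)
    (hν : ∀ o, 0 ≤ ν o) (hp1 : ∑ o, p o = 1) (hq1 : ∑ o, q o = 1)
    (hqν : ∀ j, q (some j) = ν (some j) / n) (i : Fin n) {c a d η : ℝ}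
    (hd : d = ∑ j, ν (some j))
    (h1Λ : 1 < balancedWeight (l + 1) p ν)
    (hc : c = (l + 1 : ℕ) * (1 + d) ^ (l + 1))
    (ha : a = c / (balancedWeight (l + 1) p ν - 1))
    (hη : η = (a + 1) * (c * (((b + 1) * (l + 1) : ℕ) * (d / n)))) :
    finExp (diagLaw p q) (fun V => ((rootedCycles b l i V).card : ℝ) ^ 2) ≤
      finExp (diagLaw p q) (fun V => ((rootedCycles b l i V).card : ℝ)) *
        (1 + c * (d / n) * (a + 1) / (balancedWeight (l + 1) p ν - 1) *
          (balancedWeight (l + 1) p ν + η) ^ (b + 1)) := by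
  have hn : (0 : ℝ) < n := by exact_mod_cast i.pos
  set Λ₁ := balancedWeight (l + 1) p ν with hΛ₁
  set Λ := Λ₁ / (n : ℝ) ^ (l + 1) with hΛ
  have hΛ0 : 0 ≤ Λ := by positivity
  have hd0 : 0 ≤ d := hd ▸ Finset.sum_nonneg fun j _ => hν _
  set K := 1 + c * (d / n) * (a + 1) / (Λ₁ - 1) * (Λ₁ + η) ^ (b + 1) with hK
  have hwalk : ∀ w₀ (hw₀ : Function.Injective w₀), w₀ (Fin.last b, Fin.last l) = i →
      ∑ w ∈ injectiveCycles b l i, ∏ m, blockBound (Finset.univ.image w₀) (cyclePerm w₀ hw₀) Λ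
        (d / n) (fun t => w (cyclePred (m, t))) (fun t => w (m, t)) ≤ K := by
    intro w₀ hw₀ hroot
    refine (sum_blockBound_le hΛ0 (by positivity) i).trans ?_
    refine iterate_blockKernel_le (by positivity) (fun x => ?_) ?_ l hΛ0 ?_ h1Λ ?_ ha ?_ (b + 1) i
    · by_cases hx : x ∈ Set.range w₀
      · obtain ⟨y, rfl⟩ := hx
        have h1 := cyclePerm_apply hw₀ (cycleSucc y)
        have h2 : cyclePred (cycleSucc y) = y := cycleSucc.left_inv y
        rw [h2] at h1
        simp [h1]
      · rw [cyclePerm_apply_of_notMem hw₀ hx]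
    · exact Finset.mem_image.2 ⟨_, Finset.mem_univ _, hroot⟩
    · rw [hΛ, Fintype.card_fin]
      field_simp
    · rw [hc, Fintype.card_fin]
      congr 3
      field_simp
    · rw [hη, Finset.card_image_of_injective _ hw₀, Finset.card_univ]
      simp
  calc finExp (diagLaw p q) (fun V => ((rootedCycles b l i V).card : ℝ) ^ 2)
      = ∑ w₀ ∈ injectiveCycles b l i, ∑ w ∈ injectiveCycles b l i, finExp (diagLaw p q)
        (fun V => (if AdmissibleCycle V w₀ then 1 else 0) *
          if AdmissibleCycle V w then 1 else 0) := by
        simp only [card_rootedCycles, sq, Finset.sum_mul_sum]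
        rw [finExp_sum]
        exact Finset.sum_congr rfl fun w₀ _ => finExp_sum _ _
    _ ≤ ∑ w₀ ∈ injectiveCycles b l i, Λ ^ (b + 1) * K := by
        refine Finset.sum_le_sum fun w₀ hw₀ => ?_
        obtain ⟨h1, h2⟩ := (Finset.mem_filter.1 hw₀).2
        refine le_trans ?_ (mul_le_mul_of_nonneg_left (hwalk w₀ h1 h2) (by positivity))
        rw [Finset.mul_sum]
        refine Finset.sum_le_sum fun w hw => ?_
        rw [hd]
        exact finExp_admissibleCycle_mul_le hl hp hq hp1 hq1 hqν h1 (Finset.mem_filter.1 hw).2.1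
    _ = _ := by
        rw [finExp_card_rootedCycles hl hp1 hq1 hqν, Finset.sum_const, nsmul_eq_mul, mul_assoc]

end SecondMoment

/-! ### The lower bound for finitely many labels. -/

/-- A length of cycles which is small compared with `√n` but large compared with `log n`. -/
lemma eventually_exists_length {Λ : ℝ} (hΛ : 1 < Λ) (C : ℝ) :
    ∀ᶠ n : ℕ in atTop, ∃ b : ℕ, (n : ℝ) ≤ Λ ^ (b + 1) ∧ C * (b + 1 : ℕ) ^ 2 ≤ n := by
  have hlog : 0 < Real.log Λ := Real.log_pos hΛ
  have h1 := (Real.isLittleO_pow_log_id_atTop (n := 2)).def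
    (by positivity : 0 < (Real.log Λ) ^ 2 / (4 * (|C| + 1)))
  have h2 := tendsto_natCast_atTop_atTop (R := ℝ) |>.eventually h1
  filter_upwards [h2, eventually_ge_atTop (⌈4 * (|C| + 1)⌉₊ + 1)] with n hn hn2
  have hn1 : (1 : ℝ) ≤ n := by exact_mod_cast (Nat.le_add_left 1 _).trans hn2
  have hn0 : (0 : ℝ) < n := by linarith
  have hlogn : 0 ≤ Real.log n := Real.log_nonneg hn1
  refine ⟨⌊Real.log n / Real.log Λ⌋₊, ?_, ?_⟩
  · rw [← Real.log_le_log_iff hn0 (by positivity), Real.log_pow]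
    have := Nat.lt_floor_add_one (Real.log n / Real.log Λ)
    rw [div_lt_iff₀ hlog] at this
    push_cast
    exact this.le
  · have h3 : ((⌊Real.log n / Real.log Λ⌋₊ + 1 : ℕ) : ℝ) ≤ Real.log n / Real.log Λ + 1 := by
      push_cast
      gcongr
      exact Nat.floor_le (by positivity)
    have h4 : (4 * (|C| + 1)) ≤ n := by
      have := (Nat.le_ceil (4 * (|C| + 1)))
      have h5 : ((⌈4 * (|C| + 1)⌉₊ + 1 : ℕ) : ℝ) ≤ n := by exact_mod_cast hn2
      push_cast at h5
      linarith
    have h6 : (Real.log n / Real.log Λ) ^ 2 ≤ n / (4 * (|C| + 1)) := by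
      simp only [id, Real.norm_eq_abs, abs_of_nonneg hn0.le, abs_pow, sq_abs] at hn
      rw [div_pow, div_le_iff₀ (by positivity)]
      refine hn.trans (le_of_eq ?_)
      ring
    calc C * ((⌊Real.log n / Real.log Λ⌋₊ + 1 : ℕ) : ℝ) ^ 2
        ≤ (|C| + 1) * (Real.log n / Real.log Λ + 1) ^ 2 := by
          gcongr
          linarith [le_abs_self C]
      _ ≤ (|C| + 1) * (2 * (Real.log n / Real.log Λ) ^ 2 + 2) := by
          gcongr
          nlinarith [sq_nonneg (Real.log n / Real.log Λ - 1)]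
      _ ≤ (|C| + 1) * (2 * (n / (4 * (|C| + 1))) + 2) := by gcongr
      _ = n / 2 + 2 * (|C| + 1) := by field_simp; ring
      _ ≤ n := by linarith

/-- The law of the planted labels. -/
def plantedLabel {ι : Type*} (p : ι → ℝ) (o : Option ι) : ℝ := o.elim 0 p

/-- The law of the null labels. -/
noncomputable def nullLabel {ι : Type*} [Fintype ι] (ν : ι → ℝ) (n : ℕ) (o : Option ι) : ℝ :=
  o.elim (1 - (∑ j, ν j) / n) fun j => ν j / n

/-- Above the threshold, the Bayes risk of the model with finitely many labels is bounded below. -/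
theorem finite_label_lower_bound {ι : Type*} [Fintype ι] (p ν : ι → ℝ)
    (hp : ∀ j, 0 ≤ p j) (hν : ∀ j, 0 ≤ ν j) (hp1 : ∑ j, p j = 1) (h : 1 < ∑ j, √(p j * ν j)) :
    ∃ c : ℝ, 0 < c ∧ ∀ᶠ n : ℕ in atTop,
      ∀ u : (Fin n × Fin n → Option ι) → Finset (Fin n × Fin n) → ℝ, (∀ W M, 0 ≤ u W M) →
        (∀ W, ∑ M, u W M = 1) →
        c ≤ (∑ σ, finExp (labelLaw (plantedLabel p) (nullLabel ν n) σ)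
          fun W => ∑ M, u W M * loss (matching σ) M) / (n.factorial : ℝ) := by
  classical
  let ν' : Option ι → ℝ := fun o => o.elim 0 ν
  have hp' : ∀ o, 0 ≤ plantedLabel p o := by
    rintro (_ | j)
    exacts [le_rfl, hp j]
  have hν' : ∀ o, 0 ≤ ν' o := by
    rintro (_ | j)
    exacts [le_rfl, hν j]
  have hp1' : ∑ o, plantedLabel p o = 1 := by
    rw [Fintype.sum_option]
    simpa [plantedLabel] using hp1
  have h' : 1 < ∑ o, √(plantedLabel p o * ν' o) := by
    rw [Fintype.sum_option]
    simpa [plantedLabel, ν'] using h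
  obtain ⟨l, hl, hΛ1⟩ := exists_one_lt_balancedWeight hp' hν' rfl h'
  set Λ := balancedWeight (l + 1) (plantedLabel p) ν' with hΛ
  set d := ∑ j, ν j with hd
  have hd0 : 0 ≤ d := Finset.sum_nonneg fun j _ => hν j
  set c := (l + 1 : ℕ) * (1 + d) ^ (l + 1) with hc
  have hc0 : 0 < c := by positivity
  have hΛ0 : 0 < Λ - 1 := by linarith
  set a := c / (Λ - 1) with ha
  have ha0 : 0 < a := by positivity
  set K := 1 + 3 * (c * d * (a + 1) / (Λ - 1)) with hK
  have hK0 : 0 < K := by positivity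
  refine ⟨1 / (16 * (2 * K)), by positivity, ?_⟩
  -- The two summands serve two purposes: the first gives `2 * k ^ 2 ≤ n` for the cycle length `k`,
  -- the second `(b + 1) * η ≤ 1`.
  filter_upwards [eventually_exists_length hΛ1 (2 * (l + 1 : ℕ) ^ 2 + (a + 1) * (c * ((l + 1 : ℕ) *
      d))),
    eventually_gt_atTop 0, eventually_ge_atTop ⌈d⌉₊] with n hb hn hnd u hu hu1
  obtain ⟨b, hb1, hb2⟩ := hb
  have hn' : (0 : ℝ) < n := by exact_mod_cast hn
  have hq : ∀ o, 0 ≤ nullLabel ν n o := by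
    rintro (_ | j)
    · change 0 ≤ 1 - (∑ j, ν j) / n
      rw [sub_nonneg, div_le_one hn']
      exact (Nat.le_ceil d).trans (by exact_mod_cast hnd)
    · exact div_nonneg (hν j) hn'.le
  have hq1 : ∑ o, nullLabel ν n o = 1 := by
    rw [Fintype.sum_option]
    change 1 - (∑ j, ν j) / n + ∑ j, ν j / n = 1
    rw [← Finset.sum_div]
    ring
  have hqν : ∀ j, nullLabel ν n (some j) = ν' (some j) / n := fun j => rfl
  have hb3 : (2 : ℝ) * (l + 1 : ℕ) ^ 2 * (b + 1 : ℕ) ^ 2 ≤ n := by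
    refine le_trans ?_ hb2
    have : 0 ≤ (a + 1) * (c * ((l + 1 : ℕ) * d)) := by positivity
    gcongr
    linarith
  have hb4 : (a + 1) * (c * ((l + 1 : ℕ) * d)) * (b + 1 : ℕ) ^ 2 ≤ n := by
    refine le_trans ?_ hb2
    gcongr
    have : (0 : ℝ) ≤ 2 * (l + 1 : ℕ) ^ 2 := by positivity
    linarith
  have hk : 2 * ((b + 1) * (l + 1)) ^ 2 ≤ n := by
    have : (2 : ℝ) * (((b + 1 : ℕ) : ℝ) * ((l + 1 : ℕ) : ℝ)) ^ 2 ≤ n := by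
      rw [mul_pow]
      linarith
    exact_mod_cast this
  set η := (a + 1) * (c * (((b + 1) * (l + 1) : ℕ) * (d / n))) with hη
  have hη0 : 0 ≤ η := by positivity
  have hηb : (b + 1 : ℕ) * η ≤ 1 := by
    have : (b + 1 : ℕ) * η = (a + 1) * (c * ((l + 1 : ℕ) * d)) * (b + 1 : ℕ) ^ 2 / n := by
      rw [hη]
      push_cast
      ring
    rw [this, div_le_one hn']
    exact hb4
  have hpow : (Λ + η) ^ (b + 1) ≤ 3 * Λ ^ (b + 1) := by
    calc (Λ + η) ^ (b + 1) ≤ (Λ * Real.exp η) ^ (b + 1) := by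
          gcongr
          nlinarith [Real.add_one_le_exp η]
      _ = Real.exp ((b + 1 : ℕ) * η) * Λ ^ (b + 1) := by
          rw [mul_pow, ← Real.exp_nat_mul, mul_comm]
      _ ≤ 3 * Λ ^ (b + 1) := by
          gcongr
          refine (Real.exp_le_exp.2 hηb).trans ?_
          linarith [Real.exp_one_lt_d9]
  have hfirst : ∀ i : Fin n, Λ ^ (b + 1) / (2 * n) ≤ finExp (diagLaw (plantedLabel p)
      (nullLabel ν n)) fun V => ((rootedCycles b l i V).card : ℝ) := by
    intro i
    rw [finExp_card_rootedCycles hl hp1' hq1 hqν, ← hΛ]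
    have h1 := le_card_injectiveCycles i hk
    calc Λ ^ (b + 1) / (2 * n) = (n : ℝ) ^ ((b + 1) * (l + 1)) / 2 / n *
          (Λ / n ^ (l + 1)) ^ (b + 1) := by
          rw [div_pow, ← pow_mul, mul_comm (l + 1)]
          field_simp
      _ ≤ _ := by
          gcongr
          rw [div_le_iff₀ hn']
          linarith
  refine bayes_risk_ge_of_second_moment hn hl hp' hq (by positivity)
    (fun i => lt_of_lt_of_le (by positivity) (hfirst i)) (fun i => ?_) u hu hu1
  refine (finExp_card_rootedCycles_sq_le hl hp' hq hν' hp1' hq1 hqν i hd hΛ1 hc ha hη).trans ?_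
  set m := finExp (diagLaw (plantedLabel p) (nullLabel ν n))
    fun V => ((rootedCycles b l i V).card : ℝ) with hm
  have hm0 : 0 ≤ m := le_trans (by positivity) (hfirst i)
  -- The term `1` of the walk that follows the first cycle is absorbed by `n ≤ Λ ^ (b + 1)`; this is
  -- why the cycles need logarithmic length.
  have h1 : 1 + c * (d / n) * (a + 1) / (Λ - 1) * (Λ + η) ^ (b + 1) ≤ 2 * K * m := by
    calc _ ≤ Λ ^ (b + 1) / n + c * (d / n) * (a + 1) / (Λ - 1) * (3 * Λ ^ (b + 1)) := by
          gcongr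
          rwa [le_div_iff₀ hn', one_mul]
      _ = 2 * K * (Λ ^ (b + 1) / (2 * n)) := by
          rw [hK]
          field_simp
      _ ≤ _ := by
          gcongr
          exact hfirst i
  calc m * _ ≤ m * (2 * K * m) := mul_le_mul_of_nonneg_left h1 hm0
    _ = _ := by ring

end PlantedMatching

namespace PlantedMatching

/-! ### Reduction of a general weight space to finitely many labels. -/

section Channel

/-- A product of mixtures is the mixture of the products. -/
lemma pi_mixture {E L Y : Type*} [Fintype E] [DecidableEq E] [Fintype L] [MeasurableSpace Y]
    (m : E → Measure Y) [∀ e, IsProbabilityMeasure (m e)] (k : L → Measure Y)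
    [∀ o, IsProbabilityMeasure (k o)] (w : E → L → ℝ≥0∞) (h : ∀ e, m e = ∑ o, w e o • k o) :
    Measure.pi m = ∑ W : E → L, (∏ e, w e (W e)) • Measure.pi fun e => k (W e) := by
  refine Measure.pi_eq fun s _ => ?_
  simp only [Measure.coe_finsetSum, Finset.sum_apply, Measure.smul_apply, Measure.pi_pi,
    smul_eq_mul, ← Finset.prod_mul_distrib]
  have h1 := Finset.prod_univ_sum (fun _ : E => (Finset.univ : Finset L))
    fun e o => w e o * k o (s e)
  rw [Fintype.piFinset_univ] at h1
  rw [← h1]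
  refine Finset.prod_congr rfl fun e _ => ?_
  rw [h e]
  simp

/-- On a null piece the coefficient is `0`, and `P` itself serves as a default. -/
lemma exists_conditional {X : Type*} [MeasurableSpace X] (P : Measure X) [IsProbabilityMeasure P]
    (E : Set X) : ∃ μ : Measure X, IsProbabilityMeasure μ ∧
      ENNReal.ofReal (P.real E) • μ = P.restrict E := by
  by_cases h : P E = 0
  · refine ⟨P, inferInstance, ?_⟩
    rw [Measure.restrict_eq_zero.2 h]
    simp [Measure.real, h]
  · refine ⟨P[|E], cond_isProbabilityMeasure h, ?_⟩
    rw [ofReal_measureReal, ProbabilityTheory.cond, smul_smul,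
      ENNReal.mul_inv_cancel h (measure_ne_top _ _), one_smul]

lemma isProbabilityMeasure_nullLaw {X : Type*} [MeasurableSpace X] {n : ℕ} (hn : 0 < n) {d : ℝ}
    (hd0 : 0 ≤ d) (hdn : d ≤ n) (Q : Measure X) [IsProbabilityMeasure Q] :
    IsProbabilityMeasure (nullLaw n d Q) := by
  have hn' : (0 : ℝ) < n := Nat.cast_pos.2 hn
  have : IsProbabilityMeasure (Q.map (Sum.inl : X → X ⊕ Unit)) :=
    Measure.isProbabilityMeasure_map measurable_inl.aemeasurable
  refine ⟨?_⟩
  simp only [nullLaw, Measure.add_apply, Measure.smul_apply, measure_univ, smul_eq_mul, mul_one]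
  rw [← ENNReal.ofReal_add (by rw [sub_nonneg, div_le_one hn']; exact hdn) (by positivity)]
  simp

lemma isProbabilityMeasure_entry {X : Type*} [MeasurableSpace X] {n : ℕ} (hn : 0 < n) {d : ℝ}
    (hd0 : 0 ≤ d) (hdn : d ≤ n) (P Q : Measure X) [IsProbabilityMeasure P]
    [IsProbabilityMeasure Q] (σ : Equiv.Perm (Fin n)) (e : Fin n × Fin n) :
    IsProbabilityMeasure (if e ∈ matching σ then P.map Sum.inl else nullLaw n d Q) := by
  split_ifs
  · exact Measure.isProbabilityMeasure_map measurable_inl.aemeasurable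
  · exact isProbabilityMeasure_nullLaw hn hd0 hdn Q

lemma integral_loss_eq {n : ℕ} {X : Type*} [MeasurableSpace X] (κ : Estimator n X)
    [IsMarkovKernel κ] (μ : Measure (WeightedGraph n X)) [IsProbabilityMeasure μ]
    (M₀ : Finset (Fin n × Fin n)) :
    Integrable (fun W => ∫ M, loss M₀ M ∂(κ W)) μ ∧
    ∫ W, ∫ M, loss M₀ M ∂(κ W) ∂μ = ∑ M, (∫ W, (κ W).real {M} ∂μ) * loss M₀ M := by
  have hint : ∀ M, Integrable (fun W => (κ W).real {M}) μ := by
    intro M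
    refine Integrable.of_bound (C := 1)
      (κ.measurable_coe (measurableSet_singleton M)).ennreal_toReal.aestronglyMeasurable
      (ae_of_all _ fun W => ?_)
    rw [Real.norm_of_nonneg measureReal_nonneg]
    exact measureReal_le_one
  have h1 : (fun W => ∫ M, loss M₀ M ∂(κ W)) = fun W => ∑ M, (κ W).real {M} * loss M₀ M := by
    funext W
    rw [integral_fintype Integrable.of_finite]
    rfl
  rw [h1]
  refine ⟨integrable_finsetSum _ fun M _ => (hint M).mul_const _, ?_⟩
  rw [integral_finsetSum _ fun M _ => (hint M).mul_const _]
  exact Finset.sum_congr rfl fun M _ => integral_mul_const _ _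

lemma sum_integral_singleton {n : ℕ} {X : Type*} [MeasurableSpace X] (κ : Estimator n X)
    [IsMarkovKernel κ] (μ : Measure (WeightedGraph n X)) [IsProbabilityMeasure μ] :
    ∑ M, ∫ W, (κ W).real {M} ∂μ = 1 := by
  have hint : ∀ M, Integrable (fun W => (κ W).real {M}) μ := by
    intro M
    refine Integrable.of_bound (C := 1)
      (κ.measurable_coe (measurableSet_singleton M)).ennreal_toReal.aestronglyMeasurable
      (ae_of_all _ fun W => ?_)
    rw [Real.norm_of_nonneg measureReal_nonneg]
    exact measureReal_le_one
  rw [← integral_finsetSum _ fun M _ => hint M]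
  have : ∀ W, ∑ M, (κ W).real {M} = 1 := by
    intro W
    rw [sum_measureReal_singleton]
    simp
  simp [this]

/-- A model which is obtained from a model with finitely many labels through a random relabelling
inherits its Bayes risk. -/
lemma risk_eq_of_mixture {n : ℕ} (hn : 0 < n) {X : Type*} [MeasurableSpace X] {d : ℝ}
    (hd0 : 0 ≤ d) (hdn : d ≤ n) (P Q : Measure X) [IsProbabilityMeasure P]
    [IsProbabilityMeasure Q] {ι : Type*} [Fintype ι] {p q : Option ι → ℝ} (hp : ∀ o, 0 ≤ p o)
    (hq : ∀ o, 0 ≤ q o) (k : Option ι → Measure (X ⊕ Unit)) [∀ o, IsProbabilityMeasure (k o)]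
    (hP : P.map Sum.inl = ∑ o, ENNReal.ofReal (p o) • k o)
    (hQ : nullLaw n d Q = ∑ o, ENNReal.ofReal (q o) • k o) (κ : Estimator n X)
    [IsMarkovKernel κ] :
    risk n d P Q κ = (∑ σ, finExp (labelLaw p q σ) fun W =>
      ∑ M, (∫ V, (κ V).real {M} ∂(Measure.pi fun e => k (W e))) * loss (matching σ) M) /
        (n.factorial : ℝ) := by
  unfold risk
  congr 1
  refine Finset.sum_congr rfl fun σ _ => ?_
  have hprob := isProbabilityMeasure_entry hn hd0 hdn P Q σ
  have h1 : graphLaw n d P Q σ = ∑ W : Fin n × Fin n → Option ι,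
      (∏ e, ENNReal.ofReal (labelLaw p q σ e (W e))) • Measure.pi fun e => k (W e) := by
    unfold graphLaw
    refine pi_mixture _ k (fun e o => ENNReal.ofReal (labelLaw p q σ e o)) fun e => ?_
    unfold labelLaw
    split_ifs
    · exact hP
    · exact hQ
  have hlaw : ∀ e o, 0 ≤ labelLaw p q σ e o := fun e o => by
    unfold labelLaw
    split_ifs <;> simp [hp, hq]
  rw [h1, integral_finsetSum_measure]
  · refine Finset.sum_congr rfl fun W _ => ?_
    rw [integral_smul_measure, (integral_loss_eq κ _ _).2, ← ENNReal.ofReal_prod_of_nonneg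
      fun e _ => hlaw e _, ENNReal.toReal_ofReal (Finset.prod_nonneg fun e _ => hlaw e _)]
    rfl
  · intro W _
    refine (integral_loss_eq κ _ _).1.smul_measure ?_
    exact ENNReal.prod_ne_top fun e _ => ENNReal.ofReal_ne_top

/-- If `d • Q` dominates a measure which is piecewise proportional to `P`, with the sum over the
pieces above the threshold, then the risk is bounded below. -/
theorem risk_lower_bound_of_partition {X : Type*} [MeasurableSpace X] (P : Measure X)
    [IsProbabilityMeasure P] {ι : Type*} [Fintype ι] (E : ι → Set X)
    (hE : ∀ j, MeasurableSet (E j)) (hdisj : Pairwise (Function.onFun Disjoint E))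
    (hcov : ⋃ j, E j = Set.univ) (a : ι → ℝ) (ha : ∀ j, 0 ≤ a j)
    (h : 1 < ∑ j, √(a j) * P.real (E j)) :
    ∃ c : ℝ, 0 < c ∧ ∀ᶠ n : ℕ in atTop, ∀ (d : ℝ) (Q : Measure X), IsProbabilityMeasure Q →
      0 ≤ d → d ≤ n → ∑ j, ENNReal.ofReal (a j) • P.restrict (E j) ≤ ENNReal.ofReal d • Q →
      ∀ κ : Estimator n X, IsMarkovKernel κ → c ≤ risk n d P Q κ := by
  classical
  set p : ι → ℝ := fun j => P.real (E j) with hp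
  have hp0 : ∀ j, 0 ≤ p j := fun j => measureReal_nonneg
  have hsum : P = ∑ j, P.restrict (E j) := by
    rw [← Measure.sum_fintype, ← Measure.restrict_iUnion hdisj hE, hcov, Measure.restrict_univ]
  have hp1 : ∑ j, p j = 1 := by
    rw [hp, ← measureReal_iUnion_fintype hdisj hE, hcov]
    simp
  -- Label `j` means a weight drawn from `P` conditioned on `E j`, for planted and null pairs alike,
  -- so the weight carries no information beyond its label.
  set ν : ι → ℝ := fun j => a j * p j with hν
  have hν0 : ∀ j, 0 ≤ ν j := fun j => mul_nonneg (ha j) (hp0 j)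
  have h' : 1 < ∑ j, √(p j * ν j) := by
    refine h.trans_le (le_of_eq (Finset.sum_congr rfl fun j _ => ?_))
    have : p j * ν j = a j * (p j) ^ 2 := by simp only [hν]; ring
    rw [this, Real.sqrt_mul (ha j), Real.sqrt_sq (hp0 j)]
  obtain ⟨c, hc, hev⟩ := finite_label_lower_bound p ν hp0 hν0 hp1 h'
  refine ⟨c, hc, ?_⟩
  choose μ hμ hμE using fun j => exists_conditional P (E j)
  filter_upwards [hev, eventually_gt_atTop 0, eventually_gt_atTop ⌈∑ j, ν j⌉₊]
    with n hn hn0 hns d Q hQ hd0 hdn hle κ hκ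
  have hn' : (0 : ℝ) < n := Nat.cast_pos.2 hn0
  set s := (∑ j, ν j) / n with hs
  have hs0 : 0 ≤ s := div_nonneg (Finset.sum_nonneg fun j _ => hν0 j) hn'.le
  have hs1 : s < 1 := by
    rw [hs, div_lt_one hn']
    exact (Nat.le_ceil _).trans_lt (by exact_mod_cast hns)
  set S := ∑ j, ENNReal.ofReal (a j) • P.restrict (E j) with hS
  have hSμ : S = ∑ j, ENNReal.ofReal (ν j) • μ j := by
    rw [hS]
    refine Finset.sum_congr rfl fun j _ => ?_
    rw [← hμE j, smul_smul, ← ENNReal.ofReal_mul (ha j)]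
  have hSuniv : S Set.univ = ENNReal.ofReal (∑ j, ν j) := by
    rw [hSμ, ENNReal.ofReal_sum_of_nonneg fun j _ => hν0 j]
    simp
  have hSfin : IsFiniteMeasure S := ⟨by rw [hSuniv]; exact ENNReal.ofReal_lt_top⟩
  -- The rest of the null law, which may include connected pairs, becomes the law behind the label
  -- `none`.
  set T := ENNReal.ofReal (1 - d / n) • Measure.dirac (Sum.inr () : X ⊕ Unit) +
    ENNReal.ofReal (1 / n) • (ENNReal.ofReal d • Q - S).map Sum.inl with hT
  have hnull : nullLaw n d Q = T + ENNReal.ofReal (1 / n) • S.map Sum.inl := by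
    rw [hT, add_assoc, ← smul_add, ← Measure.map_add _ _ measurable_inl,
      Measure.sub_add_cancel_of_le hle, Measure.map_smul, smul_smul,
      ← ENNReal.ofReal_mul (by positivity), nullLaw]
    congr 3
    ring
  have hTuniv : T Set.univ = ENNReal.ofReal (1 - s) := by
    have h1 := isProbabilityMeasure_nullLaw hn0 hd0 hdn Q
    have h2 : (nullLaw n d Q) Set.univ = 1 := measure_univ
    rw [hnull, Measure.add_apply, Measure.smul_apply, Measure.map_apply measurable_inl
      MeasurableSet.univ, Set.preimage_univ, hSuniv, smul_eq_mul,
      ← ENNReal.ofReal_mul (by positivity)] at h2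
    have h3 : 1 / (n : ℝ) * ∑ j, ν j = s := by rw [hs]; ring
    rw [h3] at h2
    rw [ENNReal.ofReal_sub _ hs0, ENNReal.ofReal_one, ← h2,
      ENNReal.add_sub_cancel_right ENNReal.ofReal_ne_top]
  have hs2 : ENNReal.ofReal (1 - s) ≠ 0 := by
    rw [Ne, ENNReal.ofReal_eq_zero, not_le]
    linarith
  let k : Option ι → Measure (X ⊕ Unit) := fun o =>
    o.elim ((ENNReal.ofReal (1 - s))⁻¹ • T) fun j => (μ j).map Sum.inl
  have hk : ∀ o, IsProbabilityMeasure (k o) := by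
    rintro (_ | j)
    · refine ⟨?_⟩
      change (ENNReal.ofReal (1 - s))⁻¹ * T Set.univ = 1
      rw [hTuniv, ENNReal.inv_mul_cancel hs2 ENNReal.ofReal_ne_top]
    · exact Measure.isProbabilityMeasure_map measurable_inl.aemeasurable
  have hmapsum : ∀ (m : ι → Measure X), (∑ j, m j).map (Sum.inl : X → X ⊕ Unit) =
      ∑ j, (m j).map Sum.inl := by
    intro m
    rw [← Measure.sum_fintype, Measure.map_sum measurable_inl.aemeasurable, Measure.sum_fintype]
  have hPk : P.map Sum.inl = ∑ o, ENNReal.ofReal (plantedLabel p o) • k o := by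
    rw [Fintype.sum_option]
    nth_rewrite 1 [hsum]
    rw [hmapsum]
    simp only [plantedLabel, Option.elim, ENNReal.ofReal_zero, zero_smul, zero_add, k]
    refine Finset.sum_congr rfl fun j _ => ?_
    rw [← hμE j, Measure.map_smul]
  have hQk : nullLaw n d Q = ∑ o, ENNReal.ofReal (nullLabel ν n o) • k o := by
    rw [Fintype.sum_option, hnull, hSμ, hmapsum]
    simp only [nullLabel, Option.elim, k]
    congr 1
    · rw [smul_smul, ENNReal.mul_inv_cancel hs2 ENNReal.ofReal_ne_top, one_smul]
    · rw [Finset.smul_sum]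
      refine Finset.sum_congr rfl fun j _ => ?_
      rw [Measure.map_smul, smul_smul, ← ENNReal.ofReal_mul (by positivity)]
      congr 2
      ring
  have hpl : ∀ o, 0 ≤ plantedLabel p o := by
    rintro (_ | j)
    exacts [le_rfl, hp0 j]
  have hql : ∀ o, 0 ≤ nullLabel ν n o := by
    rintro (_ | j)
    · exact sub_nonneg.2 hs1.le
    · exact div_nonneg (hν0 j) hn'.le
  rw [risk_eq_of_mixture hn0 hd0 hdn P Q hpl hql k hPk hQk κ]
  exact hn (fun W M => ∫ V, (κ V).real {M} ∂(Measure.pi fun e => k (W e)))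
    (fun W M => integral_nonneg fun V => measureReal_nonneg)
    fun W => sum_integral_singleton κ _

end Channel

end PlantedMatching

namespace PlantedMatching

/-! ### The Bhattacharyya coefficient through an arbitrary dominating measure. -/

section Bhattacharyya

variable {X : Type*} [MeasurableSpace X]

lemma ofReal_sqrt_mul_toReal {x y : ℝ≥0∞} (hx : x ≠ ∞) (hy : y ≠ ∞) :
    ENNReal.ofReal √(x.toReal * y.toReal) = (x * y) ^ (1 / 2 : ℝ) := by
  rw [← ENNReal.toReal_mul, Real.sqrt_eq_rpow, ← ENNReal.ofReal_rpow_of_nonneg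
    ENNReal.toReal_nonneg (by norm_num), ENNReal.ofReal_toReal (ENNReal.mul_ne_top hx hy)]

lemma absolutelyContinuous_add_left (P Q : Measure X) : P ≪ P + Q :=
  Measure.absolutelyContinuous_of_le (Measure.le_add_right le_rfl)

lemma absolutelyContinuous_add_right (P Q : Measure X) : Q ≪ P + Q :=
  Measure.absolutelyContinuous_of_le (Measure.le_add_left le_rfl)

lemma bhattacharyya_eq_lintegral (P Q : Measure X) [IsFiniteMeasure P] [IsFiniteMeasure Q] :
    bhattacharyya P Q =
      (∫⁻ x, (P.rnDeriv (P + Q) x * Q.rnDeriv (P + Q) x) ^ (1 / 2 : ℝ) ∂(P + Q)).toReal := by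
  rw [bhattacharyya, integral_eq_lintegral_of_nonneg_ae (ae_of_all _ fun x => Real.sqrt_nonneg _)
    (by fun_prop)]
  congr 1
  refine lintegral_congr_ae ?_
  filter_upwards [P.rnDeriv_lt_top (P + Q), Q.rnDeriv_lt_top (P + Q)] with x hx hy
  exact ofReal_sqrt_mul_toReal hx.ne hy.ne

/-- The affinity integral does not depend on the dominating measure. -/
lemma bhattacharyya_withDensity (μ : Measure X) {f g : X → ℝ≥0∞}
    (hf : Measurable f) (hg : Measurable g) (hf1 : ∫⁻ x, f x ∂μ ≠ ∞) (hg1 : ∫⁻ x, g x ∂μ ≠ ∞) :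
    bhattacharyya (μ.withDensity f) (μ.withDensity g) =
      (∫⁻ x, (f x * g x) ^ (1 / 2 : ℝ) ∂μ).toReal := by
  have hP : IsFiniteMeasure (μ.withDensity f) := isFiniteMeasure_withDensity hf1
  have hQ : IsFiniteMeasure (μ.withDensity g) := isFiniteMeasure_withDensity hg1
  rw [bhattacharyya_eq_lintegral]
  set P := μ.withDensity f with hPdef
  set Q := μ.withDensity g with hQdef
  have hsum : P + Q = μ.withDensity (f + g) := (withDensity_add_left hf g).symm
  have hfg : Measurable (f + g) := hf.add hg
  -- The chain rule: `P + Q` has density `f + g` with respect to `μ`.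
  have key : ∀ (R : Measure X) [IsFiniteMeasure R] {r : X → ℝ≥0∞}, Measurable r →
      R = μ.withDensity r → R ≪ P + Q → (f + g) * R.rnDeriv (P + Q) =ᵐ[μ] r := by
    intro R _ r hr hR hac
    have hm := Measure.measurable_rnDeriv R (P + Q)
    refine (withDensity_eq_iff (hfg.mul hm).aemeasurable hr.aemeasurable ?_).1 ?_
    · rw [← setLIntegral_univ, ← withDensity_apply _ MeasurableSet.univ,
        withDensity_mul μ hfg hm, ← hsum, Measure.withDensity_rnDeriv_eq _ _ hac]
      exact measure_ne_top _ _
    · rw [withDensity_mul μ hfg hm, ← hsum, Measure.withDensity_rnDeriv_eq _ _ hac, hR]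
  have hPm := Measure.measurable_rnDeriv P (P + Q)
  have hQm := Measure.measurable_rnDeriv Q (P + Q)
  have h1 : ∫⁻ x, (P.rnDeriv (P + Q) x * Q.rnDeriv (P + Q) x) ^ (1 / 2 : ℝ) ∂(P + Q) =
      ∫⁻ x, ((f + g) * fun x => (P.rnDeriv (P + Q) x * Q.rnDeriv (P + Q) x) ^ (1 / 2 : ℝ)) x ∂μ :=
          by
    have hm : Measurable fun x =>
        (P.rnDeriv (P + Q) x * Q.rnDeriv (P + Q) x) ^ (1 / 2 : ℝ) := (hPm.mul hQm).pow_const _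
    rw [← lintegral_withDensity_eq_lintegral_mul μ hfg hm, ← hsum]
  rw [h1]
  congr 1
  refine lintegral_congr_ae ?_
  filter_upwards [key P hf hPdef (absolutelyContinuous_add_left P Q),
    key Q hg hQdef (absolutelyContinuous_add_right P Q)] with x hx hy
  simp only [Pi.mul_apply] at hx hy ⊢
  rw [← hx, ← hy]
  have h2 : ∀ a b c : ℝ≥0∞, a * (b * c) ^ (1 / 2 : ℝ) = (a * b * (a * c)) ^ (1 / 2 : ℝ) := by
    intro a b c
    have : a * b * (a * c) = (a ^ (2 : ℝ)) * (b * c) := by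
      rw [ENNReal.rpow_two]
      ring
    rw [this, ENNReal.mul_rpow_of_nonneg (a ^ (2 : ℝ)) _ (by norm_num : (0 : ℝ) ≤ 1 / 2),
      ← ENNReal.rpow_mul]
    norm_num
  exact h2 _ _ _

end Bhattacharyya

/-! ### Discretization of the likelihood ratio. -/

section Levels

variable {X : Type*} [MeasurableSpace X]

/-- Discretization of the likelihood ratio `f / h` at a geometric scale. -/
lemma exists_partition_of_density (μ : Measure X) {f h : X → ℝ≥0∞} (hf : Measurable f)
    (hh : Measurable h) (hf1 : ∫⁻ x, f x ∂μ = 1) (hh1 : ∀ᵐ x ∂μ, h x ≠ ∞)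
    (h1 : 1 < ∫⁻ x, (f x * h x) ^ (1 / 2 : ℝ) ∂μ) :
    ∃ (s : Finset ℤ) (E : Option s → Set X) (a : Option s → ℝ), (∀ j, MeasurableSet (E j)) ∧
      Pairwise (Function.onFun Disjoint E) ∧ ⋃ j, E j = Set.univ ∧ (∀ j, 0 ≤ a j) ∧
      1 < ∑ j, √(a j) * (μ.withDensity f).real (E j) ∧
      ∑ j, ENNReal.ofReal (a j) • (μ.withDensity f).restrict (E j) ≤ μ.withDensity h := by
  have hPprob : IsProbabilityMeasure (μ.withDensity f) := ⟨by
    rw [withDensity_apply _ MeasurableSet.univ, setLIntegral_univ, hf1]⟩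
  set P := μ.withDensity f with hP
  -- The levels have ratio `t = r ^ 2`. Replacing `h` on a level by a multiple of `f` below it costs
  -- at most a factor `√t = r` in the affinity, which is affordable because `r` is below the
  -- integral.
  obtain ⟨r, hr1, hrI⟩ := ENNReal.lt_iff_exists_nnreal_btwn.1 h1
  have hr1' : (1 : ℝ) < r := by exact_mod_cast hr1
  have hr0 : (0 : ℝ) < r := by linarith
  set t : ℝ≥0∞ := ((r ^ 2 : NNReal) : ℝ≥0∞) with ht
  have ht1 : 1 < t := by
    rw [ht]
    have : (1 : NNReal) < r ^ 2 := one_lt_pow₀ (by exact_mod_cast hr1) two_ne_zero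
    exact_mod_cast this
  have htt : t ≠ ∞ := ENNReal.coe_ne_top
  have ht0 : t ≠ 0 := (zero_lt_one.trans ht1).ne'
  let F : ℤ → Set X := fun j => {x | f x / h x ∈ Set.Ico (t ^ j) (t ^ (j + 1))}
  have hFm : ∀ j, MeasurableSet (F j) := fun j => (hf.div hh) measurableSet_Ico
  have hFd : Pairwise (Function.onFun Disjoint F) := by
    intro i j hij
    refine Set.disjoint_left.2 fun x hi hj => hij ?_
    have h2 : (t : ℝ≥0∞) ^ i < t ^ (j + 1) := hi.1.trans_lt hj.2
    have h3 : (t : ℝ≥0∞) ^ j < t ^ (i + 1) := hj.1.trans_lt hi.2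
    have h4 : i < j + 1 := by
      by_contra h5
      exact absurd (ENNReal.zpow_le_of_le ht1.le (not_lt.1 h5)) (not_le.2 h2)
    have h5 : j < i + 1 := by
      by_contra h5
      exact absurd (ENNReal.zpow_le_of_le ht1.le (not_lt.1 h5)) (not_le.2 h3)
    omega
  -- On `F j` one has `f < t ^ (j + 1) * h`, so `α j = t ^ (-(j + 1))` satisfies `α j * f ≤ h`.
  let α : ℤ → ℝ := fun j => ((r : ℝ) ^ (-(j + 1))) ^ 2
  have hα0 : ∀ j, 0 ≤ α j := fun j => sq_nonneg _
  have hsqrt : ∀ j, √(α j) = (r : ℝ) ^ (-(j + 1)) := fun j => Real.sqrt_sq (zpow_pos hr0 _).le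
  have hαt : ∀ j, ENNReal.ofReal (α j) = t ^ (-(j + 1)) := by
    intro j
    have : α j = (((r ^ 2 : NNReal) ^ (-(j + 1)) : NNReal) : ℝ) := by
      simp only [α]
      push_cast
      rw [← zpow_natCast, ← zpow_natCast, ← zpow_mul, ← zpow_mul, mul_comm]
    rw [this, ENNReal.ofReal_coe_nnreal, ht, ENNReal.coe_zpow]
    exact pow_ne_zero _ (by exact_mod_cast hr0.ne')
  have hpoint : ∀ j, ∀ x ∈ F j, f x ≠ ∞ ∧ h x ≠ 0 ∧ h x ≠ ∞ := by
    rintro j x ⟨hx1, hx2⟩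
    have h2 : f x / h x ≠ 0 := (lt_of_lt_of_le (ENNReal.zpow_pos ht0 htt j) hx1).ne'
    have h3 : f x / h x ≠ ∞ := (hx2.trans_le le_top).ne
    have h4 := ENNReal.div_ne_zero.1 h2
    have h5 : h x ≠ 0 := fun h0 => h3 (by rw [h0, ENNReal.div_zero h4.1])
    exact ⟨fun h6 => h3 (by rw [h6, ENNReal.top_div_of_ne_top h4.2]), h5, h4.2⟩
  have hlower : ∀ j, ∀ x ∈ F j, ENNReal.ofReal (α j) * f x ≤ h x := by
    intro j x hx
    obtain ⟨h2, h3, h4⟩ := hpoint j x hx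
    have h5 : f x ≤ t ^ (j + 1) * h x := (ENNReal.div_le_iff h3 h4).1 hx.2.le
    rw [hαt]
    calc t ^ (-(j + 1)) * f x ≤ t ^ (-(j + 1)) * (t ^ (j + 1) * h x) := by gcongr
      _ = h x := by
        rw [← mul_assoc, ← ENNReal.zpow_add ht0 htt, neg_add_cancel, zpow_zero, one_mul]
  have hupper : ∀ j, ∀ x ∈ F j, (f x * h x) ^ (1 / 2 : ℝ) ≤
      r * (ENNReal.ofReal √(α j) * f x) := by
    intro j x hx
    obtain ⟨h2, h3, h4⟩ := hpoint j x hx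
    have h5 : t ^ j * h x ≤ f x := (ENNReal.le_div_iff_mul_le (Or.inl h3) (Or.inl h4)).1 hx.1
    have h6 : h x ≤ t ^ (-j) * f x := by
      calc h x = t ^ (-j) * (t ^ j * h x) := by
            rw [← mul_assoc, ← ENNReal.zpow_add ht0 htt, neg_add_cancel, zpow_zero, one_mul]
        _ ≤ _ := by gcongr
    have h7 : (r * (ENNReal.ofReal √(α j) * f x)) ^ (2 : ℝ) = f x * (t ^ (-j) * f x) := by
      rw [ENNReal.rpow_two, mul_pow, mul_pow, ← ENNReal.ofReal_pow (Real.sqrt_nonneg _),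
        Real.sq_sqrt (hα0 j), hαt]
      have h8 : (r : ℝ≥0∞) ^ 2 = t := by rw [ht]; push_cast; rfl
      have h9 : t * t ^ (-(j + 1)) = t ^ (-j) := by
        nth_rewrite 1 [← zpow_one t]
        rw [← ENNReal.zpow_add ht0 htt]
        congr 1
        ring
      rw [h8, ← mul_assoc, h9]
      ring
    calc (f x * h x) ^ (1 / 2 : ℝ) ≤ (f x * (t ^ (-j) * f x)) ^ (1 / 2 : ℝ) := by gcongr
      _ = _ := by
        rw [← h7, ← ENNReal.rpow_mul]
        norm_num
  have hout : ∀ᵐ x ∂μ, x ∉ ⋃ j, F j → (f x * h x) ^ (1 / 2 : ℝ) = 0 := by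
    have hfin : ∀ᵐ x ∂μ, f x < ∞ := ae_lt_top hf (by rw [hf1]; exact ENNReal.one_ne_top)
    filter_upwards [hfin, hh1] with x hx1 hx2 hx
    by_contra h2
    have h3 : f x * h x ≠ 0 := fun h0 => h2 (by rw [h0]; simp)
    obtain ⟨h4, h5⟩ := mul_ne_zero_iff.1 h3
    obtain ⟨j, hj⟩ := ENNReal.exists_mem_Ico_zpow (ENNReal.div_ne_zero.2 ⟨h4, hx2⟩)
      (ENNReal.div_ne_top hx1.ne h5) ht1 htt
    exact hx (Set.mem_iUnion.2 ⟨j, hj⟩)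
  have hFP : ∀ j, ENNReal.ofReal √(α j) * P (F j) = ENNReal.ofReal (√(α j) * P.real (F j)) := by
    intro j
    rw [ENNReal.ofReal_mul (Real.sqrt_nonneg _), ofReal_measureReal]
  have htsum : 1 < ∑' j, ENNReal.ofReal (√(α j) * P.real (F j)) := by
    have h2 : ∫⁻ x, (f x * h x) ^ (1 / 2 : ℝ) ∂μ ≤
        r * ∑' j, ENNReal.ofReal (√(α j) * P.real (F j)) := by
      calc ∫⁻ x, (f x * h x) ^ (1 / 2 : ℝ) ∂μ = ∫⁻ x in ⋃ j, F j, (f x * h x) ^ (1 / 2 : ℝ) ∂μ := by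
            rw [← lintegral_indicator (MeasurableSet.iUnion hFm)]
            refine lintegral_congr_ae ?_
            filter_upwards [hout] with x hx
            by_cases hxF : x ∈ ⋃ j, F j
            · rw [Set.indicator_of_mem hxF]
            · rw [Set.indicator_of_notMem hxF, hx hxF]
        _ = ∑' j, ∫⁻ x in F j, (f x * h x) ^ (1 / 2 : ℝ) ∂μ := lintegral_iUnion hFm hFd _
        _ ≤ ∑' j, r * ENNReal.ofReal (√(α j) * P.real (F j)) := by
            refine ENNReal.tsum_le_tsum fun j => ?_
            calc _ ≤ ∫⁻ x in F j, r * (ENNReal.ofReal √(α j) * f x) ∂μ :=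
                  setLIntegral_mono' (hFm j) (hupper j)
              _ = _ := by
                  rw [lintegral_const_mul _ (hf.const_mul _), lintegral_const_mul _ hf,
                    ← withDensity_apply _ (hFm j), ← hP, hFP]
        _ = _ := ENNReal.tsum_mul_left
    by_contra h3
    have h4 : (r : ℝ≥0∞) < r * 1 := hrI.trans_le (h2.trans (by gcongr; exact not_lt.1 h3))
    simp at h4
  rw [ENNReal.tsum_eq_iSup_sum] at htsum
  obtain ⟨s, hs⟩ := lt_iSup_iff.1 htsum
  have hs' : 1 < ∑ j ∈ s, √(α j) * P.real (F j) := by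
    rw [← ENNReal.ofReal_sum_of_nonneg fun j _ => mul_nonneg (Real.sqrt_nonneg _)
      measureReal_nonneg] at hs
    exact ENNReal.one_lt_ofReal.1 hs
  -- The piece `none` collects everything outside the finitely many chosen levels, with coefficient
  -- `0`.
  refine ⟨s, fun o => o.elim (⋃ j : s, F j)ᶜ fun j => F j, fun o => o.elim 0 fun j => α j,
    ?_, ?_, ?_, ?_, ?_, ?_⟩
  · rintro (_ | j)
    · exact (MeasurableSet.iUnion fun j => hFm _).compl
    · exact hFm j
  · rintro (_ | i) (_ | j) hij
    · exact absurd rfl hij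
    · exact Set.disjoint_left.2 fun x hx hj => hx (Set.mem_iUnion.2 ⟨j, hj⟩)
    · exact Set.disjoint_left.2 fun x hi hx => hx (Set.mem_iUnion.2 ⟨i, hi⟩)
    · exact hFd fun h => hij (by rw [Subtype.ext h])
  · refine Set.eq_univ_of_forall fun x => ?_
    by_cases hx : x ∈ ⋃ j : s, F j
    · obtain ⟨j, hj⟩ := Set.mem_iUnion.1 hx
      exact Set.mem_iUnion.2 ⟨some j, hj⟩
    · exact Set.mem_iUnion.2 ⟨none, hx⟩
  · rintro (_ | j)
    exacts [le_rfl, hα0 j]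
  · rw [Fintype.sum_option]
    simp only [Option.elim, Real.sqrt_zero, zero_mul, zero_add]
    rwa [Finset.sum_coe_sort s fun j => √(α j) * P.real (F j)]
  · rw [Fintype.sum_option]
    simp only [Option.elim, ENNReal.ofReal_zero, zero_smul, zero_add]
    rw [Finset.sum_coe_sort s fun j => ENNReal.ofReal (α j) • P.restrict (F j)]
    refine Measure.le_iff.2 fun B hB => ?_
    rw [Measure.finsetSum_apply]
    calc ∑ j ∈ s, (ENNReal.ofReal (α j) • P.restrict (F j)) B
        ≤ ∑ j ∈ s, μ.withDensity h (B ∩ F j) := by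
          refine Finset.sum_le_sum fun j _ => ?_
          rw [Measure.smul_apply, Measure.restrict_apply hB, smul_eq_mul, hP,
            withDensity_apply _ (hB.inter (hFm j)), withDensity_apply _ (hB.inter (hFm j)),
            ← lintegral_const_mul _ hf]
          exact setLIntegral_mono' (hB.inter (hFm j)) fun x hx => hlower j x hx.2
      _ = μ.withDensity h (⋃ j ∈ s, B ∩ F j) := by
          refine (measure_biUnion_finset (fun i _ j _ hij => ?_)
            fun j _ => hB.inter (hFm j)).symm
          exact (hFd hij).mono Set.inter_subset_right Set.inter_subset_right
      _ ≤ μ.withDensity h B :=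
          measure_mono (Set.iUnion₂_subset fun j _ => Set.inter_subset_left)

/-- If `d • Q` dominates a measure with density `h`, where `P` has density `f` and
`∫ √(f h) > 1`, then the risk is bounded below. -/
theorem risk_lower_bound_of_density (μ : Measure X) {f h : X → ℝ≥0∞} (hf : Measurable f)
    (hh : Measurable h) (hf1 : ∫⁻ x, f x ∂μ = 1) (hh1 : ∀ᵐ x ∂μ, h x ≠ ∞)
    (h1 : 1 < ∫⁻ x, (f x * h x) ^ (1 / 2 : ℝ) ∂μ) :
    ∃ c : ℝ, 0 < c ∧ ∀ᶠ n : ℕ in atTop, ∀ (d : ℝ) (Q : Measure X), IsProbabilityMeasure Q →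
      0 ≤ d → d ≤ n → μ.withDensity h ≤ ENNReal.ofReal d • Q →
      ∀ κ : Estimator n X, IsMarkovKernel κ → c ≤ risk n d (μ.withDensity f) Q κ := by
  obtain ⟨s, E, a, hE, hd, hcov, ha, hsum, hle⟩ :=
    exists_partition_of_density μ hf hh hf1 hh1 h1
  have : IsProbabilityMeasure (μ.withDensity f) := ⟨by
    rw [withDensity_apply _ MeasurableSet.univ, setLIntegral_univ, hf1]⟩
  obtain ⟨c, hc, hev⟩ := risk_lower_bound_of_partition _ E hE hd hcov a ha hsum
  refine ⟨c, hc, ?_⟩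
  filter_upwards [hev] with n hn d Q hQ hd0 hdn hle'
  exact hn d Q hQ hd0 hdn (hle.trans hle')

end Levels

/-! ### The sparse model. -/

section Sparse

/-- Impossibility in the sparse model. -/
theorem sparse_lower_bound {X : Type*} [MeasurableSpace X] (P Q : Measure X)
    [IsProbabilityMeasure P] [IsProbabilityMeasure Q] {ε : ℝ} (hε : 0 < ε) :
    ∃ c : ℝ, 0 < c ∧ ∀ d : ℝ, 1 + ε ≤ √d * bhattacharyya P Q →
      ErrorAtLeast c (fun _ => d) P (fun _ => Q) := by
  have hB0 : 0 ≤ bhattacharyya P Q := integral_nonneg fun x => Real.sqrt_nonneg _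
  rcases hB0.eq_or_lt with hB | hB
  · refine ⟨1, one_pos, fun d hd => ?_⟩
    rw [← hB, mul_zero] at hd
    linarith
  set B := bhattacharyya P Q with hBdef
  -- The least admissible `d`. For larger `d` the measure `d • Q` dominates `d₀ • Q`, so one
  -- constant serves for all `d`.
  set d₀ := ((1 + ε) / B) ^ 2 with hd₀
  set f := P.rnDeriv (P + Q) with hf
  set g := Q.rnDeriv (P + Q) with hg
  have hfm : Measurable f := Measure.measurable_rnDeriv _ _
  have hgm : Measurable g := Measure.measurable_rnDeriv _ _
  have hPf : (P + Q).withDensity f = P :=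
    Measure.withDensity_rnDeriv_eq _ _ (absolutelyContinuous_add_left P Q)
  have hQg : (P + Q).withDensity g = Q :=
    Measure.withDensity_rnDeriv_eq _ _ (absolutelyContinuous_add_right P Q)
  have hI : ENNReal.ofReal B = ∫⁻ x, (f x * g x) ^ (1 / 2 : ℝ) ∂(P + Q) := by
    rw [hBdef, bhattacharyya_eq_lintegral, ENNReal.ofReal_toReal]
    intro htop
    rw [hBdef, bhattacharyya_eq_lintegral, htop] at hB
    simp at hB
  have h1 : 1 < ∫⁻ x, (f x * (ENNReal.ofReal d₀ * g x)) ^ (1 / 2 : ℝ) ∂(P + Q) := by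
    have h2 : ∀ x, (f x * (ENNReal.ofReal d₀ * g x)) ^ (1 / 2 : ℝ) =
        ENNReal.ofReal ((1 + ε) / B) * (f x * g x) ^ (1 / 2 : ℝ) := by
      intro x
      have h3 : ENNReal.ofReal ((1 + ε) / B) = ENNReal.ofReal d₀ ^ (1 / 2 : ℝ) := by
        rw [ENNReal.ofReal_rpow_of_nonneg (sq_nonneg _) (by norm_num), ← Real.sqrt_eq_rpow,
          Real.sqrt_sq (by positivity)]
      rw [h3, ← ENNReal.mul_rpow_of_nonneg _ _ (by norm_num : (0 : ℝ) ≤ 1 / 2)]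
      congr 1
      ring
    simp only [h2]
    have hm : Measurable fun x => (f x * g x) ^ (1 / 2 : ℝ) := (hfm.mul hgm).pow_const _
    rw [lintegral_const_mul _ hm, ← hI,
      ← ENNReal.ofReal_mul (by positivity), div_mul_cancel₀ _ hB.ne']
    exact ENNReal.one_lt_ofReal.2 (by linarith)
  obtain ⟨c, hc, hev⟩ := risk_lower_bound_of_density (P + Q) hfm (hgm.const_mul _)
    (by rw [← setLIntegral_univ, ← withDensity_apply _ MeasurableSet.univ, hPf]; simp)
    (by
      filter_upwards [Q.rnDeriv_lt_top (P + Q)] with x hx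
      exact ENNReal.mul_ne_top ENNReal.ofReal_ne_top hx.ne) h1
  rw [hPf] at hev
  refine ⟨c, hc, fun d hd => ?_⟩
  have hdd : d₀ ≤ d := by
    have h2 : (1 + ε) / B ≤ √d := (div_le_iff₀ hB).2 hd
    have h3 : 0 < √d := lt_of_lt_of_le (by positivity) h2
    rw [hd₀, ← Real.sq_sqrt (Real.sqrt_pos.1 h3).le]
    gcongr
  filter_upwards [hev, eventually_ge_atTop ⌈d⌉₊] with n hn hdn κ hκ
  refine hn d Q inferInstance ((sq_nonneg _).trans hdd)
    ((Nat.le_ceil d).trans (by exact_mod_cast hdn)) ?_ κ hκ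
  have h4 : (P + Q).withDensity (fun x => ENNReal.ofReal d₀ * g x) = ENNReal.ofReal d₀ • Q := by
    nth_rewrite 2 [← hQg]
    exact withDensity_smul _ hgm
  rw [h4]
  refine Measure.le_iff.2 fun A _ => ?_
  rw [Measure.smul_apply, Measure.smul_apply, smul_eq_mul, smul_eq_mul]
  gcongr

end Sparse

end PlantedMatching

namespace PlantedMatching

/-! ### The dense model. -/

section Dense

variable {ρ : ℝ → ℝ≥0∞}

lemma lintegral_scaled (hρ : Measurable ρ) {d : ℝ} (hd : 0 < d) :
    ∫⁻ x, ENNReal.ofReal (1 / d) * ρ (x / d) = ∫⁻ x, ρ x := by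
  have h := Real.smul_map_volume_mul_left (a := 1 / d) (by positivity)
  rw [abs_of_pos (by positivity)] at h
  have hm : Measurable fun x : ℝ => 1 / d * x := measurable_const_mul _
  nth_rewrite 2 [← h]
  rw [lintegral_smul_measure, lintegral_map hρ hm, smul_eq_mul, lintegral_const_mul]
  · simp only [one_div_mul_eq_div]
  · exact hρ.comp (measurable_id.div_const d)

lemma isProbabilityMeasure_scaledNull (hρ : Measurable ρ) (hρ1 : ∫⁻ x, ρ x = 1) {d : ℝ}
    (hd : 0 < d) : IsProbabilityMeasure (scaledNull ρ d) := ⟨by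
  rw [scaledNull, withDensity_apply _ MeasurableSet.univ, setLIntegral_univ, lintegral_scaled hρ hd,
    hρ1]⟩

/-- The factor `1 / d` cancels, which leaves a density close to `ρ 0` on bounded parts of `S` when
`d` is large. -/
lemma smul_scaledNull (hρ : Measurable ρ) {d : ℝ} (hd : 0 < d) :
    ENNReal.ofReal d • scaledNull ρ d = volume.withDensity fun x => ρ (x / d) := by
  have hm : Measurable fun x : ℝ => ρ (x / d) := hρ.comp (measurable_id.div_const d)
  rw [scaledNull, ← withDensity_smul _ (hm.const_mul _)]
  congr 1
  funext x
  rw [Pi.smul_apply, smul_eq_mul, ← mul_assoc, ← ENNReal.ofReal_mul hd.le,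
    mul_one_div_cancel hd.ne', ENNReal.ofReal_one, one_mul]

/-- The limiting form of the threshold condition persists after a truncation of the weights and a
decrease of the constant. -/
lemma exists_truncation {p : ℝ → ℝ≥0∞} {S : Set ℝ} {r₀ : ℝ≥0∞} (h : 1 < r₀ ^ (1 / 2 : ℝ) *
    ∫⁻ x in S, p x ^ (1 / 2 : ℝ)) :
    ∃ (r : ℝ≥0∞) (N : ℕ), r < r₀ ∧
      1 < r ^ (1 / 2 : ℝ) * ∫⁻ x in S ∩ Set.Icc (-(N : ℝ)) N, p x ^ (1 / 2 : ℝ) := by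
  have hmono : Monotone fun N : ℕ => S ∩ Set.Icc (-(N : ℝ)) N := by
    intro M N hMN
    have : (M : ℝ) ≤ N := Nat.cast_le.2 hMN
    exact Set.inter_subset_inter_right _ (Set.Icc_subset_Icc (neg_le_neg this) this)
  have hU : ⋃ N : ℕ, S ∩ Set.Icc (-(N : ℝ)) N = S := by
    rw [← Set.inter_iUnion]
    refine Set.inter_eq_left.2 fun x _ => ?_
    obtain ⟨N, hN⟩ := exists_nat_ge |x|
    exact Set.mem_iUnion.2 ⟨N, abs_le.1 hN⟩
  rw [← hU, setLIntegral_iUnion_of_directed _ hmono.directed_le, ENNReal.mul_iSup] at h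
  obtain ⟨N, hN⟩ := lt_iSup_iff.1 h
  have h2 := (ENNReal.div_lt_iff (Or.inr one_ne_zero) (Or.inr ENNReal.one_ne_top)).2 hN
  obtain ⟨y, hy1, hy2⟩ := exists_between h2
  refine ⟨y ^ (2 : ℝ), N, ?_, ?_⟩
  · have := ENNReal.rpow_lt_rpow hy2 (by norm_num : (0 : ℝ) < 2)
    rwa [← ENNReal.rpow_mul, one_div_mul_cancel two_ne_zero, ENNReal.rpow_one] at this
  · rw [← ENNReal.rpow_mul, mul_one_div_cancel two_ne_zero, ENNReal.rpow_one]
    exact (ENNReal.div_lt_iff (Or.inr one_ne_zero) (Or.inr ENNReal.one_ne_top)).1 hy1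

/-- Impossibility in the dense model under the limiting form of the condition. -/
theorem dense_lower_bound {p : ℝ → ℝ≥0∞} {S : Set ℝ} (hp : Measurable p) (hp1 : ∫⁻ x, p x = 1)
    (hρ : Measurable ρ) (hρ1 : ∫⁻ x, ρ x = 1) (hS : S = Set.univ ∨ S = Set.Ici 0)
    (hcont : ContinuousWithinAt ρ S 0) (hρ0 : ρ 0 < ∞)
    (h : 1 < ρ 0 ^ (1 / 2 : ℝ) * ∫⁻ x in S, p x ^ (1 / 2 : ℝ)) :
    ∃ c : ℝ, 0 < c ∧ ∀ d : ℕ → ℝ, Tendsto d atTop atTop → (∀ᶠ n : ℕ in atTop, d n ≤ n) →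
      ErrorAtLeast c d (volume.withDensity p) (fun n => scaledNull ρ (d n)) := by
  have hSm : MeasurableSet S := by
    rcases hS with rfl | rfl
    exacts [MeasurableSet.univ, measurableSet_Ici]
  have hSdiv : ∀ x ∈ S, ∀ d : ℝ, 0 < d → x / d ∈ S := by
    rcases hS with rfl | rfl
    · exact fun x _ d _ => Set.mem_univ _
    · exact fun x hx d hd => div_nonneg hx hd.le
  obtain ⟨r, N, hr, hrN⟩ := exists_truncation h
  set A := S ∩ Set.Icc (-(N : ℝ)) N with hA
  have hAm : MeasurableSet A := hSm.inter measurableSet_Icc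
  have hrtop : r ≠ ∞ := (hr.trans hρ0).ne
  have h1 : 1 < ∫⁻ x, (p x * A.indicator (fun _ => r) x) ^ (1 / 2 : ℝ) := by
    refine hrN.trans_le (le_of_eq ?_)
    rw [← lintegral_const_mul _ (hp.pow_const _), ← lintegral_indicator hAm]
    refine lintegral_congr fun x => ?_
    by_cases hx : x ∈ A
    · rw [Set.indicator_of_mem hx, Set.indicator_of_mem hx,
        ENNReal.mul_rpow_of_nonneg _ _ (by norm_num), mul_comm]
    · rw [Set.indicator_of_notMem hx, Set.indicator_of_notMem hx, mul_zero,
        ENNReal.zero_rpow_of_pos (by norm_num)]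
  obtain ⟨c, hc, hev⟩ := risk_lower_bound_of_density volume hp
    (measurable_const.indicator hAm) hp1 (ae_of_all _ fun x => by
      by_cases hx : x ∈ A
      · rwa [Set.indicator_of_mem hx]
      · rw [Set.indicator_of_notMem hx]
        exact ENNReal.zero_ne_top) h1
  refine ⟨c, hc, fun d hd hdn => ?_⟩
  -- For `x ∈ A` and `d n > N / δ`, the point `x / d n` of `S` is within `δ` of `0`, so the density
  -- of `d n • Q` exceeds `r` on `A`.
  have hnear : ∀ᶠ y in 𝓝[S] (0 : ℝ), r < ρ y := hcont.eventually (lt_mem_nhds hr)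
  obtain ⟨δ, hδ, hδr⟩ := Metric.mem_nhdsWithin_iff.1 hnear
  filter_upwards [hev, hdn, hd.eventually_gt_atTop 0, hd.eventually_gt_atTop (N / δ)]
    with n hn hdn hd0 hdN κ hκ
  have hprob := isProbabilityMeasure_scaledNull hρ hρ1 hd0
  refine hn (d n) _ hprob hd0.le hdn ?_ κ hκ
  rw [smul_scaledNull hρ hd0]
  refine withDensity_mono (ae_of_all _ fun x => ?_)
  by_cases hx : x ∈ A
  · rw [Set.indicator_of_mem hx]
    refine (hδr ⟨?_, hSdiv x hx.1 _ hd0⟩).le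
    rw [Metric.mem_ball, dist_zero_right, Real.norm_eq_abs, abs_div, abs_of_pos hd0,
      div_lt_iff₀ hd0]
    rw [div_lt_iff₀ hδ] at hdN
    have := abs_le.2 hx.2
    linarith
  · rw [Set.indicator_of_notMem hx]
    exact zero_le

/-- For bounded `ρ`, the threshold condition implies its limiting form. -/
lemma limiting_condition_of_bounded {p : ℝ → ℝ≥0∞} {S : Set ℝ} (hp : Measurable p)
    (hp1 : ∫⁻ x, p x = 1) (hρ : Measurable ρ) (hρ1 : ∫⁻ x, ρ x = 1)
    (hS : S = Set.univ ∨ S = Set.Ici 0) (hρS : ∀ x ∉ S, ρ x = 0)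
    (hcont : ContinuousWithinAt ρ S 0) (hρ0 : 0 < ρ 0) {K : ℝ≥0∞} (hK : K < ∞)
    (hρK : ∀ x, ρ x ≤ K) {d : ℕ → ℝ} (hd : Tendsto d atTop atTop) {b : ℝ}
    (hb : ∀ᶠ n in atTop, b ≤ √(d n) *
      bhattacharyya (volume.withDensity p) (scaledNull ρ (d n))) :
    ENNReal.ofReal b ≤ ρ 0 ^ (1 / 2 : ℝ) * ∫⁻ x in S, p x ^ (1 / 2 : ℝ) := by
  have hSm : MeasurableSet S := by
    rcases hS with rfl | rfl
    exacts [MeasurableSet.univ, measurableSet_Ici]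
  have hSdiv : ∀ x, ∀ d : ℝ, 0 < d → (x / d ∈ S ↔ x ∈ S) := by
    rcases hS with rfl | rfl
    · simp
    · intro x d hd
      simp only [Set.mem_Ici]
      rw [le_div_iff₀ hd, zero_mul]
  -- An infinite integral makes the claim trivial. A finite one provides the integrable majorant `K
  -- ^ (1 / 2) * p ^ (1 / 2)` for dominated convergence.
  by_cases hJ : ∫⁻ x in S, p x ^ (1 / 2 : ℝ) = ∞
  · rw [hJ, ENNReal.mul_top (ENNReal.rpow_pos_of_nonneg hρ0 (by norm_num)).ne']
    exact le_top
  have hle : ∀ᶠ n in atTop, ENNReal.ofReal b ≤ ∫⁻ x, (p x * ρ (x / d n)) ^ (1 / 2 : ℝ) := by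
    filter_upwards [hb, hd.eventually_gt_atTop 0] with n hn hd0
    have hm : Measurable fun x => ρ (x / d n) := hρ.comp (measurable_id.div_const _)
    have hm2 : Measurable fun x => (p x * ρ (x / d n)) ^ (1 / 2 : ℝ) := (hp.mul hm).pow_const _
    refine (ENNReal.ofReal_le_ofReal hn).trans ?_
    rw [scaledNull, bhattacharyya_withDensity volume hp (hm.const_mul _)
      (by rw [hp1]; exact ENNReal.one_ne_top)
      (by rw [lintegral_scaled hρ hd0, hρ1]; exact ENNReal.one_ne_top),
      ENNReal.ofReal_mul (Real.sqrt_nonneg _)]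
    calc _ ≤ ENNReal.ofReal √(d n) *
          ∫⁻ x, (p x * (ENNReal.ofReal (1 / d n) * ρ (x / d n))) ^ (1 / 2 : ℝ) := by
          gcongr
          exact ENNReal.ofReal_toReal_le
      _ = ∫⁻ x, ENNReal.ofReal √(d n) *
          (p x * (ENNReal.ofReal (1 / d n) * ρ (x / d n))) ^ (1 / 2 : ℝ) := by
          rw [lintegral_const_mul]
          exact (hp.mul (hm.const_mul _)).pow_const _
      _ ≤ _ := by
          refine le_of_eq (lintegral_congr fun x => ?_)
          have h2 : ENNReal.ofReal √(d n) = ENNReal.ofReal (d n) ^ (1 / 2 : ℝ) := by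
            rw [ENNReal.ofReal_rpow_of_nonneg hd0.le (by norm_num), ← Real.sqrt_eq_rpow]
          rw [h2, ← ENNReal.mul_rpow_of_nonneg _ _ (by norm_num : (0 : ℝ) ≤ 1 / 2)]
          congr 1
          calc _ = (ENNReal.ofReal (d n) * ENNReal.ofReal (1 / d n)) * (p x * ρ (x / d n)) := by
                ring
            _ = _ := by
                rw [← ENNReal.ofReal_mul hd0.le, mul_one_div_cancel hd0.ne', ENNReal.ofReal_one,
                  one_mul]
  have hlim : Tendsto (fun n => ∫⁻ x, (p x * ρ (x / d n)) ^ (1 / 2 : ℝ)) atTop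
      (𝓝 (∫⁻ x, S.indicator (fun x => ρ 0 ^ (1 / 2 : ℝ) * p x ^ (1 / 2 : ℝ)) x)) := by
    refine tendsto_lintegral_filter_of_dominated_convergence
      (S.indicator fun x => K ^ (1 / 2 : ℝ) * p x ^ (1 / 2 : ℝ)) ?_ ?_ ?_ ?_
    · exact Eventually.of_forall fun n =>
        (hp.mul (hρ.comp (measurable_id.div_const _))).pow_const _
    · filter_upwards [hd.eventually_gt_atTop 0] with n hd0
      refine ae_of_all _ fun x => ?_
      by_cases hx : x ∈ S
      · rw [Set.indicator_of_mem hx, ← ENNReal.mul_rpow_of_nonneg _ _ (by norm_num), mul_comm]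
        gcongr
        exact hρK _
      · rw [hρS _ fun h => hx ((hSdiv x _ hd0).1 h), mul_zero,
          ENNReal.zero_rpow_of_pos (by norm_num)]
        exact zero_le
    · rw [lintegral_indicator hSm, lintegral_const_mul _ (hp.pow_const _)]
      exact ENNReal.mul_ne_top (ENNReal.rpow_ne_top_of_nonneg (by norm_num) hK.ne) hJ
    · refine (ae_lt_top hp (by rw [hp1]; exact ENNReal.one_ne_top)).mono fun x hpx => ?_
      by_cases hx : x ∈ S
      · rw [Set.indicator_of_mem hx, ← ENNReal.mul_rpow_of_nonneg _ _ (by norm_num),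
          mul_comm (ρ 0)]
        have h2 : Tendsto (fun n => x / d n) atTop (𝓝[S] 0) := by
          refine tendsto_nhdsWithin_iff.2 ⟨hd.const_div_atTop x, ?_⟩
          filter_upwards [hd.eventually_gt_atTop 0] with n hd0
          exact (hSdiv x _ hd0).2 hx
        have h3 : Tendsto (fun n => ρ (x / d n)) atTop (𝓝 (ρ 0)) := hcont.tendsto.comp h2
        exact (ENNReal.continuous_rpow_const.tendsto _).comp
          (ENNReal.Tendsto.const_mul h3 (Or.inr hpx.ne))
      · rw [Set.indicator_of_notMem hx]
        refine tendsto_const_nhds.congr' ?_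
        filter_upwards [hd.eventually_gt_atTop 0] with n hd0
        rw [hρS _ fun h => hx ((hSdiv x _ hd0).1 h), mul_zero,
          ENNReal.zero_rpow_of_pos (by norm_num)]
  rw [lintegral_indicator hSm, lintegral_const_mul _ (hp.pow_const _)] at hlim
  exact ge_of_tendsto hlim hle

end Dense

/-! ### The exponential model. -/

section Exponential

lemma expMeasure_eq_withDensity (r : ℝ) :
    expMeasure r = volume.withDensity (exponentialPDF r) := rfl

lemma measurable_exponentialPDF (r : ℝ) : Measurable (exponentialPDF r) :=
  (measurable_exponentialPDFReal r).ennreal_ofReal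

lemma scaledNull_exponentialPDF {n : ℕ} (hn : 0 < n) :
    scaledNull (exponentialPDF 1) n = expMeasure (1 / n) := by
  have hn' : (0 : ℝ) < n := Nat.cast_pos.2 hn
  rw [scaledNull, expMeasure_eq_withDensity]
  congr 1
  funext x
  rcases le_or_gt 0 x with hx | hx
  · rw [exponentialPDF_of_nonneg (by positivity), exponentialPDF_of_nonneg hx,
      ← ENNReal.ofReal_mul (by positivity)]
    congr 3
    · ring_nf
  · rw [exponentialPDF_of_neg hx, exponentialPDF_of_neg (div_neg_of_neg_of_pos hx hn'), mul_zero]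

/-- The geometric mean of the two densities is a multiple of the exponential density with the
average rate. -/
lemma lintegral_sqrt_exponentialPDF_mul {a b : ℝ} (ha : 0 < a) (hb : 0 < b) :
    ∫⁻ x, (exponentialPDF a x * exponentialPDF b x) ^ (1 / 2 : ℝ) =
      ENNReal.ofReal (2 * √(a * b) / (a + b)) := by
  have h1 : ∀ x, (exponentialPDF a x * exponentialPDF b x) ^ (1 / 2 : ℝ) =
      ENNReal.ofReal (2 * √(a * b) / (a + b)) * exponentialPDF ((a + b) / 2) x := by
    intro x
    rcases le_or_gt 0 x with hx | hx
    · rw [exponentialPDF_of_nonneg hx, exponentialPDF_of_nonneg hx, exponentialPDF_of_nonneg hx,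
        ← ENNReal.ofReal_mul (by positivity), ← ENNReal.ofReal_mul (by positivity),
        ENNReal.ofReal_rpow_of_nonneg (by positivity) (by norm_num), ← Real.sqrt_eq_rpow]
      congr 1
      have h2 : a * Real.exp (-(a * x)) * (b * Real.exp (-(b * x))) =
          a * b * (Real.exp (-((a + b) / 2 * x))) ^ 2 := by
        rw [← Real.exp_nat_mul]
        have : ((2 : ℕ) : ℝ) * (-((a + b) / 2 * x)) = -(a * x) + -(b * x) := by push_cast; ring
        rw [this, Real.exp_add]
        ring
      rw [h2, Real.sqrt_mul (by positivity), Real.sqrt_sq (Real.exp_pos _).le]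
      field_simp
    · rw [exponentialPDF_of_neg hx, exponentialPDF_of_neg hx, exponentialPDF_of_neg hx, zero_mul,
        mul_zero, ENNReal.zero_rpow_of_pos (by norm_num)]
  simp only [h1]
  rw [lintegral_const_mul _ (measurable_exponentialPDF _),
    lintegral_exponentialPDF_eq_one (by positivity), mul_one]

lemma sqrt_mul_bhattacharyya_expMeasure {a : ℝ} (ha : 0 < a) {n : ℕ} (hn : 0 < n) :
    √n * bhattacharyya (expMeasure a) (expMeasure (1 / n)) = 2 * √a / (a + 1 / n) := by
  have hn' : (0 : ℝ) < n := Nat.cast_pos.2 hn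
  rw [expMeasure_eq_withDensity, expMeasure_eq_withDensity, bhattacharyya_withDensity volume
    (measurable_exponentialPDF _) (measurable_exponentialPDF _)
    (by rw [lintegral_exponentialPDF_eq_one ha]; exact ENNReal.one_ne_top)
    (by rw [lintegral_exponentialPDF_eq_one (by positivity)]; exact ENNReal.one_ne_top),
    lintegral_sqrt_exponentialPDF_mul ha (by positivity), ENNReal.toReal_ofReal (by positivity)]
  have h1 : √(n : ℝ) * √(a * (1 / n)) = √a := by
    rw [← Real.sqrt_mul hn'.le]
    congr 1
    field_simp
  rw [← h1]
  ring

/-- Here `ρ` is the density with rate `1`, so `ρ 0 = 1`, and the integral of `√p` is `2 / √a`, which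
exceeds `1` exactly when `a < 4`. -/
theorem exponential_lower_bound {a : ℝ} (ha : 0 < a) (ha4 : a < 4) :
    ∃ c : ℝ, 0 < c ∧
      ErrorAtLeast c (fun n => n) (expMeasure a) (fun n => expMeasure (1 / n)) := by
  have h0 : exponentialPDF 1 0 = 1 := by rw [exponentialPDF_of_nonneg le_rfl]; simp
  have hcont : ContinuousWithinAt (exponentialPDF 1) (Set.Ici 0) 0 := by
    have h1 : Continuous fun x : ℝ => ENNReal.ofReal (1 * Real.exp (-(1 * x))) :=
      ENNReal.continuous_ofReal.comp (by fun_prop)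
    exact h1.continuousWithinAt.congr (fun x hx => exponentialPDF_of_nonneg hx)
      (exponentialPDF_of_nonneg le_rfl)
  have hint : 1 < exponentialPDF 1 0 ^ (1 / 2 : ℝ) *
      ∫⁻ x in Set.Ici 0, exponentialPDF a x ^ (1 / 2 : ℝ) := by
    rw [h0, ENNReal.one_rpow, one_mul, ← lintegral_indicator measurableSet_Ici]
    have h2 : ∀ x, (Set.Ici (0 : ℝ)).indicator (fun x => exponentialPDF a x ^ (1 / 2 : ℝ)) x =
        ENNReal.ofReal (2 / √a) * exponentialPDF (a / 2) x := by
      intro x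
      rcases le_or_gt 0 x with hx | hx
      · rw [Set.indicator_of_mem (Set.mem_Ici.2 hx), exponentialPDF_of_nonneg hx,
          exponentialPDF_of_nonneg hx, ← ENNReal.ofReal_mul (by positivity),
          ENNReal.ofReal_rpow_of_nonneg (by positivity) (by norm_num), ← Real.sqrt_eq_rpow]
        congr 1
        have h3 : Real.exp (-(a * x)) = Real.exp (-(a / 2 * x)) ^ 2 := by
          rw [← Real.exp_nat_mul]
          congr 1
          push_cast
          ring
        rw [h3, Real.sqrt_mul ha.le, Real.sqrt_sq (Real.exp_pos _).le]
        have h4 : √a * √a = a := Real.mul_self_sqrt ha.le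
        field_simp
        rw [sq, h4]
      · rw [Set.indicator_of_notMem (by simpa using hx), exponentialPDF_of_neg hx, mul_zero]
    simp only [h2]
    rw [lintegral_const_mul _ (measurable_exponentialPDF _),
      lintegral_exponentialPDF_eq_one (by positivity), mul_one, ENNReal.one_lt_ofReal,
      one_lt_div (Real.sqrt_pos.2 ha), Real.sqrt_lt' two_pos]
    linarith
  obtain ⟨c, hc, h⟩ := dense_lower_bound (measurable_exponentialPDF a)
    (lintegral_exponentialPDF_eq_one ha) (measurable_exponentialPDF 1)
    (lintegral_exponentialPDF_eq_one one_pos) (Or.inr rfl) hcont (by simp [h0]) hint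
  refine ⟨c, hc, ?_⟩
  have h1 := h (fun n => n) tendsto_natCast_atTop_atTop (Eventually.of_forall fun n => le_rfl)
  unfold ErrorAtLeast at h1 ⊢
  filter_upwards [h1, eventually_gt_atTop 0] with n hn hn0
  rwa [scaledNull_exponentialPDF hn0] at hn

end Exponential

end PlantedMatching

namespace PlantedMatching

/-! ### Densities of product measures. -/

section ProductDensity

variable {E Y : Type*} [Fintype E] [MeasurableSpace Y]

/-- Tonelli, one coordinate at a time. -/
lemma lintegral_pi_prod (μ : Measure Y) [SigmaFinite μ] {f : E → Y → ℝ≥0∞}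
    (hf : ∀ e, Measurable (f e)) :
    ∫⁻ W : E → Y, ∏ e, f e (W e) ∂(Measure.pi fun _ => μ) = ∏ e, ∫⁻ y, f e y ∂μ := by
  classical
  have hm : ∀ s : Finset E, Measurable fun W : E → Y => ∏ e ∈ s, f e (W e) := fun s =>
    Finset.measurable_prod _ fun e _ => (hf e).comp (measurable_pi_apply e)
  have key : ∀ s : Finset E, (∫⋯∫⁻_s, (fun W => ∏ e ∈ s, f e (W e)) ∂fun _ : E => μ) =
      fun _ => ∏ e ∈ s, ∫⁻ y, f e y ∂μ := by
    intro s
    induction s using Finset.induction_on with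
    | empty => funext W; simp
    | insert a s ha ih =>
      rw [lmarginal_insert' _ (hm _) ha]
      have h1 : (fun W : E → Y => ∫⁻ y, ∏ e ∈ insert a s, f e (Function.update W a y e) ∂μ) =
          fun W => (∫⁻ y, f a y ∂μ) * ∏ e ∈ s, f e (W e) := by
        funext W
        rw [← lintegral_mul_const _ (hf a)]
        refine lintegral_congr fun y => ?_
        rw [Finset.prod_insert ha, Function.update_self]
        congr 1
        refine Finset.prod_congr rfl fun e he => ?_
        rw [Function.update_of_ne]
        rintro rfl
        exact ha he
      rw [h1]
      funext W
      have h2 := congrFun ih W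
      rw [lmarginal] at h2 ⊢
      have hms : Measurable fun y => ∏ e ∈ s, f e (Function.updateFinset W s y e) :=
        (hm s).comp measurable_updateFinset
      rw [lintegral_const_mul _ hms, h2, Finset.prod_insert ha]
  have h := key Finset.univ
  rw [lmarginal_univ] at h
  by_cases hE : Nonempty (E → Y)
  · exact congrFun h hE.some
  -- Without a point at which to evaluate, `Y` is empty and `E` is not, so both sides vanish.
  · have hY : IsEmpty (E → Y) := not_nonempty_iff.1 hE
    have hE' : Nonempty E := by
      by_contra hE'
      have : IsEmpty E := not_nonempty_iff.1 hE'
      exact hE ⟨fun e => isEmptyElim e⟩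
    have hY' : IsEmpty Y := by
      by_contra h3
      exact hE ⟨fun _ => (not_isEmpty_iff.1 h3).some⟩
    rw [Measure.eq_zero_of_isEmpty (Measure.pi fun _ : E => μ), lintegral_zero_measure,
      Finset.prod_eq_zero (Finset.mem_univ hE'.some)]
    rw [Measure.eq_zero_of_isEmpty μ, lintegral_zero_measure]

lemma pi_withDensity (μ : Measure Y) [SigmaFinite μ] {f : E → Y → ℝ≥0∞}
    (hf : ∀ e, Measurable (f e)) [∀ e, SigmaFinite (μ.withDensity (f e))] :
    Measure.pi (fun e => μ.withDensity (f e)) =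
      (Measure.pi fun _ : E => μ).withDensity fun W => ∏ e, f e (W e) := by
  refine Measure.pi_eq fun s hs => ?_
  rw [withDensity_apply _ (MeasurableSet.univ_pi hs),
    ← lintegral_indicator (MeasurableSet.univ_pi hs)]
  have h1 : (Set.univ.pi s).indicator (fun W : E → Y => ∏ e, f e (W e)) =
      fun W => ∏ e, (s e).indicator (f e) (W e) := by
    funext W
    by_cases hW : W ∈ Set.univ.pi s
    · rw [Set.indicator_of_mem hW]
      exact Finset.prod_congr rfl fun e _ =>
        (Set.indicator_of_mem (hW e (Set.mem_univ e)) _).symm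
    · rw [Set.indicator_of_notMem hW]
      simp only [Set.mem_univ_pi, not_forall] at hW
      obtain ⟨e, he⟩ := hW
      exact (Finset.prod_eq_zero (Finset.mem_univ e) (Set.indicator_of_notMem he _)).symm
  rw [h1, lintegral_pi_prod μ fun e => (hf e).indicator (hs e)]
  refine Finset.prod_congr rfl fun e _ => ?_
  rw [lintegral_indicator (hs e), withDensity_apply _ (hs e)]

end ProductDensity

/-! ### Likelihoods of matchings and pairwise comparison. -/

section Likelihood

variable {X : Type*} [MeasurableSpace X]

/-- A measure on the labels which dominates the laws of planted and of null labels. -/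
noncomputable def labelMeasure (P Q : Measure X) : Measure (X ⊕ Unit) :=
  (P + Q).map Sum.inl + Measure.dirac (Sum.inr ())

/-- The density of the labels of planted pairs. -/
noncomputable def plantedDensity (P Q : Measure X) : X ⊕ Unit → ℝ≥0∞ :=
  Sum.elim (P.rnDeriv (P + Q)) fun _ => 0

/-- The density of the labels of null pairs. -/
noncomputable def nullDensity (n : ℕ) (d : ℝ) (P Q : Measure X) : X ⊕ Unit → ℝ≥0∞ :=
  Sum.elim (fun x => ENNReal.ofReal (d / n) * Q.rnDeriv (P + Q) x)
    fun _ => ENNReal.ofReal (1 - d / n)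

/-- The likelihood of the matching of `σ`. -/
noncomputable def likelihood (n : ℕ) (d : ℝ) (P Q : Measure X) (σ : Equiv.Perm (Fin n))
    (W : WeightedGraph n X) : ℝ≥0∞ :=
  ∏ e, (if e ∈ matching σ then plantedDensity P Q else nullDensity n d P Q) (W e)

lemma measurable_plantedDensity (P Q : Measure X) : Measurable (plantedDensity P Q) :=
  Measurable.sumElim (Measure.measurable_rnDeriv _ _) measurable_const

lemma measurable_nullDensity (n : ℕ) (d : ℝ) (P Q : Measure X) :
    Measurable (nullDensity n d P Q) :=
  Measurable.sumElim ((Measure.measurable_rnDeriv _ _).const_mul _) measurable_const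

lemma measurable_entryDensity (n : ℕ) (d : ℝ) (P Q : Measure X) (σ : Equiv.Perm (Fin n))
    (e : Fin n × Fin n) :
    Measurable (if e ∈ matching σ then plantedDensity P Q else nullDensity n d P Q) := by
  split_ifs
  exacts [measurable_plantedDensity P Q, measurable_nullDensity n d P Q]

lemma measurable_likelihood (n : ℕ) (d : ℝ) (P Q : Measure X) (σ : Equiv.Perm (Fin n)) :
    Measurable (likelihood n d P Q σ) :=
  Finset.measurable_prod _ fun e _ =>
    (measurable_entryDensity n d P Q σ e).comp (measurable_pi_apply e)

lemma lintegral_labelMeasure (P Q : Measure X) {F : X ⊕ Unit → ℝ≥0∞} (hF : Measurable F) :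
    ∫⁻ y, F y ∂(labelMeasure P Q) = ∫⁻ x, F (Sum.inl x) ∂(P + Q) + F (Sum.inr ()) := by
  rw [labelMeasure, lintegral_add_measure, lintegral_map hF measurable_inl, lintegral_dirac' _ hF]

variable (P Q : Measure X) [IsProbabilityMeasure P] [IsProbabilityMeasure Q]

lemma withDensity_plantedDensity :
    (labelMeasure P Q).withDensity (plantedDensity P Q) = P.map Sum.inl := by
  have hm := measurable_plantedDensity P Q
  ext A hA
  have hA' : MeasurableSet (Sum.inl ⁻¹' A : Set X) := measurable_inl hA
  rw [withDensity_apply _ hA, ← lintegral_indicator hA,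
    lintegral_labelMeasure P Q (hm.indicator hA), Measure.map_apply measurable_inl hA]
  have h1 : A.indicator (plantedDensity P Q) (Sum.inr ()) = 0 := by
    by_cases h : Sum.inr () ∈ A <;> simp [h, plantedDensity]
  have h2 : ∀ x, A.indicator (plantedDensity P Q) (Sum.inl x) =
      (Sum.inl ⁻¹' A : Set X).indicator (P.rnDeriv (P + Q)) x := fun x => rfl
  simp only [h1, h2, add_zero]
  rw [lintegral_indicator hA', ← withDensity_apply _ hA',
    Measure.withDensity_rnDeriv_eq _ _ (absolutelyContinuous_add_left P Q)]

lemma withDensity_nullDensity (n : ℕ) (d : ℝ) :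
    (labelMeasure P Q).withDensity (nullDensity n d P Q) = nullLaw n d Q := by
  have hm := measurable_nullDensity n d P Q
  ext A hA
  have hA' : MeasurableSet (Sum.inl ⁻¹' A : Set X) := measurable_inl hA
  rw [withDensity_apply _ hA, ← lintegral_indicator hA,
    lintegral_labelMeasure P Q (hm.indicator hA), nullLaw, Measure.add_apply, Measure.smul_apply,
    Measure.smul_apply, Measure.map_apply measurable_inl hA, Measure.dirac_apply' _ hA, add_comm]
  congr 1
  · by_cases h : Sum.inr () ∈ A <;> simp [h, nullDensity]
  · have h2 : ∀ x, A.indicator (nullDensity n d P Q) (Sum.inl x) =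
        (Sum.inl ⁻¹' A : Set X).indicator
          (fun x => ENNReal.ofReal (d / n) * Q.rnDeriv (P + Q) x) x := fun x => rfl
    simp only [h2]
    rw [lintegral_indicator hA', lintegral_const_mul _ (Measure.measurable_rnDeriv _ _),
      ← withDensity_apply _ hA',
      Measure.withDensity_rnDeriv_eq _ _ (absolutelyContinuous_add_right P Q)]
    rfl

instance : IsFiniteMeasure (labelMeasure P Q) := by
  have : IsFiniteMeasure ((P + Q).map (Sum.inl : X → X ⊕ Unit)) := inferInstance
  unfold labelMeasure
  infer_instance

lemma withDensity_entryDensity {n : ℕ} (d : ℝ) (σ : Equiv.Perm (Fin n)) (e : Fin n × Fin n) :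
    (labelMeasure P Q).withDensity
      (if e ∈ matching σ then plantedDensity P Q else nullDensity n d P Q) =
      if e ∈ matching σ then P.map Sum.inl else nullLaw n d Q := by
  split_ifs
  exacts [withDensity_plantedDensity P Q, withDensity_nullDensity P Q n d]

lemma graphLaw_eq_withDensity {n : ℕ} (hn : 0 < n) {d : ℝ} (hd0 : 0 ≤ d) (hdn : d ≤ n)
    (σ : Equiv.Perm (Fin n)) : graphLaw n d P Q σ =
      (Measure.pi fun _ => labelMeasure P Q).withDensity (likelihood n d P Q σ) := by
  have h1 : ∀ e, SigmaFinite ((labelMeasure P Q).withDensity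
      (if e ∈ matching σ then plantedDensity P Q else nullDensity n d P Q)) := by
    intro e
    rw [withDensity_entryDensity]
    have := isProbabilityMeasure_entry hn hd0 hdn P Q σ e
    infer_instance
  have h2 := pi_withDensity (labelMeasure P Q) (measurable_entryDensity n d P Q σ)
  simp only [withDensity_entryDensity] at h2
  exact h2

lemma lintegral_sqrt_rnDeriv : ∫⁻ x, (P.rnDeriv (P + Q) x * Q.rnDeriv (P + Q) x) ^ (1 / 2 : ℝ)
    ∂(P + Q) = ENNReal.ofReal (bhattacharyya P Q) := by
  rw [bhattacharyya_eq_lintegral, ENNReal.ofReal_toReal]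
  refine ne_top_of_le_ne_top (b := ∫⁻ x, P.rnDeriv (P + Q) x + Q.rnDeriv (P + Q) x ∂(P + Q)) ?_ ?_
  · rw [lintegral_add_left (Measure.measurable_rnDeriv _ _)]
    exact ENNReal.add_ne_top.2 ⟨(Measure.lintegral_rnDeriv_lt_top P (P + Q)).ne,
      (Measure.lintegral_rnDeriv_lt_top Q (P + Q)).ne⟩
  · refine lintegral_mono fun x => ?_
    set a := P.rnDeriv (P + Q) x
    set b := Q.rnDeriv (P + Q) x
    calc (a * b) ^ (1 / 2 : ℝ) ≤ ((a + b) ^ (2 : ℝ)) ^ (1 / 2 : ℝ) := by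
          rw [ENNReal.rpow_two, sq]
          gcongr
          · exact le_self_add
          · exact le_add_self
      _ = a + b := by
          rw [← ENNReal.rpow_mul]
          norm_num

/-- The symbol of a missing pair contributes nothing, because the planted density vanishes there. -/
lemma lintegral_sqrt_densities {n : ℕ} {d : ℝ} (hd0 : 0 ≤ d) :
    ∫⁻ y, (plantedDensity P Q y * nullDensity n d P Q y) ^ (1 / 2 : ℝ) ∂(labelMeasure P Q) =
      ENNReal.ofReal (√(d / n) * bhattacharyya P Q) := by
  have hm : Measurable fun x =>
      (P.rnDeriv (P + Q) x * Q.rnDeriv (P + Q) x) ^ (1 / 2 : ℝ) :=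
    ((Measure.measurable_rnDeriv _ _).mul (Measure.measurable_rnDeriv _ _)).pow_const _
  have hm2 : Measurable fun y => (plantedDensity P Q y * nullDensity n d P Q y) ^ (1 / 2 : ℝ) :=
    ((measurable_plantedDensity P Q).mul (measurable_nullDensity n d P Q)).pow_const _
  rw [lintegral_labelMeasure P Q hm2]
  simp only [plantedDensity, nullDensity, Sum.elim_inl, Sum.elim_inr, zero_mul]
  rw [ENNReal.zero_rpow_of_pos (by norm_num), add_zero, ENNReal.ofReal_mul (Real.sqrt_nonneg _),
    ← lintegral_sqrt_rnDeriv, ← lintegral_const_mul _ hm]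
  refine lintegral_congr fun x => ?_
  have h2 : ENNReal.ofReal √(d / n) = ENNReal.ofReal (d / n) ^ (1 / 2 : ℝ) := by
    rw [ENNReal.ofReal_rpow_of_nonneg (by positivity) (by norm_num), ← Real.sqrt_eq_rpow]
  rw [h2, ← ENNReal.mul_rpow_of_nonneg _ _ (by norm_num : (0 : ℝ) ≤ 1 / 2)]
  congr 1
  ring

/-- The probability that the likelihood prefers the matching of `π` to the planted one. -/
lemma graphLaw_likelihood_le {n : ℕ} (hn : 0 < n) {d : ℝ} (hd0 : 0 ≤ d) (hdn : d ≤ n)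
    (σ π : Equiv.Perm (Fin n)) :
    graphLaw n d P Q σ {W | likelihood n d P Q σ W ≤ likelihood n d P Q π W} ≤
      ENNReal.ofReal (√(d / n) * bhattacharyya P Q) ^ (matching σ ∆ matching π).card := by
  have hσ := measurable_likelihood n d P Q σ
  have hπ := measurable_likelihood n d P Q π
  have hA : MeasurableSet {W | likelihood n d P Q σ W ≤ likelihood n d P Q π W} :=
    measurableSet_le hσ hπ
  have hsq : ∀ a : ℝ≥0∞, (a * a) ^ (1 / 2 : ℝ) = a := by
    intro a
    rw [← sq, ← ENNReal.rpow_two, ← ENNReal.rpow_mul]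
    norm_num
  rw [graphLaw_eq_withDensity P Q hn hd0 hdn, withDensity_apply _ hA]
  -- On this event the likelihood of `σ` is at most the geometric mean of the two likelihoods, whose
  -- integral factorizes over the pairs.
  calc _ ≤ ∫⁻ W in {W | likelihood n d P Q σ W ≤ likelihood n d P Q π W},
        (likelihood n d P Q σ W * likelihood n d P Q π W) ^ (1 / 2 : ℝ)
          ∂(Measure.pi fun _ => labelMeasure P Q) := by
        refine setLIntegral_mono' hA fun W hW => ?_
        calc likelihood n d P Q σ W
            = (likelihood n d P Q σ W * likelihood n d P Q σ W) ^ (1 / 2 : ℝ) := (hsq _).symm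
          _ ≤ _ := by gcongr; exact hW
    _ ≤ ∫⁻ W, (likelihood n d P Q σ W * likelihood n d P Q π W) ^ (1 / 2 : ℝ)
          ∂(Measure.pi fun _ => labelMeasure P Q) := setLIntegral_le_lintegral _ _
    _ = ∏ e, ∫⁻ y, ((if e ∈ matching σ then plantedDensity P Q else nullDensity n d P Q) y *
          (if e ∈ matching π then plantedDensity P Q else nullDensity n d P Q) y) ^ (1 / 2 : ℝ)
          ∂(labelMeasure P Q) := by
        have hme : ∀ e, Measurable fun y =>
            ((if e ∈ matching σ then plantedDensity P Q else nullDensity n d P Q) y *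
              (if e ∈ matching π then plantedDensity P Q else nullDensity n d P Q) y) ^
                (1 / 2 : ℝ) := fun e =>
          ((measurable_entryDensity n d P Q σ e).mul
            (measurable_entryDensity n d P Q π e)).pow_const _
        rw [← lintegral_pi_prod (labelMeasure P Q) hme]
        refine lintegral_congr fun W => ?_
        rw [likelihood, likelihood, ← Finset.prod_mul_distrib,
          ENNReal.prod_rpow_of_nonneg (by norm_num)]
    _ = ∏ e, if e ∈ matching σ ∆ matching π then
          ENNReal.ofReal (√(d / n) * bhattacharyya P Q) else 1 := by
        have hF : ∫⁻ y, plantedDensity P Q y ∂(labelMeasure P Q) = 1 := by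
          have := isProbabilityMeasure_nullLaw hn hd0 hdn Q
          rw [← setLIntegral_univ, ← withDensity_apply _ MeasurableSet.univ,
            withDensity_plantedDensity]
          have : IsProbabilityMeasure (P.map (Sum.inl : X → X ⊕ Unit)) :=
            Measure.isProbabilityMeasure_map measurable_inl.aemeasurable
          exact measure_univ
        have hG : ∫⁻ y, nullDensity n d P Q y ∂(labelMeasure P Q) = 1 := by
          have := isProbabilityMeasure_nullLaw hn hd0 hdn Q
          rw [← setLIntegral_univ, ← withDensity_apply _ MeasurableSet.univ,
            withDensity_nullDensity]
          exact measure_univ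
        -- A pair on which the matchings agree integrates a single probability density; a pair in
        -- the symmetric difference gives the affinity.
        refine Finset.prod_congr rfl fun e _ => ?_
        by_cases h1 : e ∈ matching σ <;> by_cases h2 : e ∈ matching π
        · simp only [h1, h2, if_true, hsq, hF, Finset.mem_symmDiff, not_true, and_false, or_self,
            if_false]
        · simp only [h1, h2, if_true, if_false, Finset.mem_symmDiff, not_false_eq_true, and_self,
            true_or, lintegral_sqrt_densities P Q hd0]
        · simp only [h1, h2, if_true, if_false, Finset.mem_symmDiff, not_false_eq_true, and_self,
            or_true, mul_comm (nullDensity n d P Q _), lintegral_sqrt_densities P Q hd0]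
        · simp only [h1, h2, if_false, hsq, hG, Finset.mem_symmDiff, false_and, or_self]
    _ = _ := by
        rw [Finset.prod_ite_mem, Finset.univ_inter, Finset.prod_const]

end Likelihood

/-! ### The maximum likelihood estimator and the count of competitors. -/

section MaximumLikelihood

variable {X : Type*} [MeasurableSpace X]

open Classical in
/-- The permutations of maximal likelihood. -/
noncomputable def likelihoodMaximizers (n : ℕ) (d : ℝ) (P Q : Measure X)
    (W : WeightedGraph n X) : Finset (Equiv.Perm (Fin n)) :=
  Finset.univ.filter fun σ => ∀ π, likelihood n d P Q π W ≤ likelihood n d P Q σ W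

open Classical in
/-- A choice of an element of a set of permutations. -/
noncomputable def chosenPerm {n : ℕ} (S : Finset (Equiv.Perm (Fin n))) : Equiv.Perm (Fin n) :=
  if h : S.Nonempty then h.choose else 1

/-- The maximum likelihood estimator. -/
noncomputable def maxLikelihood (n : ℕ) (d : ℝ) (P Q : Measure X) (W : WeightedGraph n X) :
    Finset (Fin n × Fin n) :=
  matching (chosenPerm (likelihoodMaximizers n d P Q W))

/-- The estimate depends on `W` only through the finite set of maximizers, and membership in it is a
comparison of measurable likelihoods. -/
lemma measurable_maxLikelihood (n : ℕ) (d : ℝ) (P Q : Measure X) :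
    Measurable (maxLikelihood n d P Q) := by
  classical
  refine measurable_to_countable' fun M => ?_
  have h1 : maxLikelihood n d P Q ⁻¹' {M} = ⋃ S : {S : Finset (Equiv.Perm (Fin n)) //
      matching (chosenPerm S) = M}, ⋂ σ, {W | σ ∈ likelihoodMaximizers n d P Q W ↔ σ ∈ S.1} := by
    ext W
    simp only [Set.mem_preimage, Set.mem_singleton_iff, Set.mem_iUnion, Set.mem_iInter,
      Set.mem_ofPred_eq]
    constructor
    · exact fun h => ⟨⟨_, h⟩, fun σ => Iff.rfl⟩
    · rintro ⟨⟨S, hS⟩, h⟩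
      have : likelihoodMaximizers n d P Q W = S := Finset.ext h
      rw [maxLikelihood, this, hS]
  rw [h1]
  refine MeasurableSet.iUnion fun S => MeasurableSet.iInter fun σ => ?_
  have h2 : MeasurableSet {W | σ ∈ likelihoodMaximizers n d P Q W} := by
    have : {W | σ ∈ likelihoodMaximizers n d P Q W} =
        ⋂ π, {W | likelihood n d P Q π W ≤ likelihood n d P Q σ W} := by
      ext W
      simp [likelihoodMaximizers]
    rw [this]
    exact MeasurableSet.iInter fun π =>
      measurableSet_le (measurable_likelihood n d P Q π) (measurable_likelihood n d P Q σ)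
  by_cases hσ : σ ∈ S.1
  · have : {W | σ ∈ likelihoodMaximizers n d P Q W ↔ σ ∈ S.1} =
        {W | σ ∈ likelihoodMaximizers n d P Q W} := by
      ext W
      simp [hσ]
    rw [this]
    exact h2
  · have : {W | σ ∈ likelihoodMaximizers n d P Q W ↔ σ ∈ S.1} =
        {W | σ ∈ likelihoodMaximizers n d P Q W}ᶜ := by
      ext W
      simp [hσ]
    rw [this]
    exact h2.compl

lemma maxLikelihood_spec (n : ℕ) (d : ℝ) (P Q : Measure X) (W : WeightedGraph n X) :
    ∃ π, maxLikelihood n d P Q W = matching π ∧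
      ∀ σ, likelihood n d P Q σ W ≤ likelihood n d P Q π W := by
  classical
  have h : (likelihoodMaximizers n d P Q W).Nonempty := by
    obtain ⟨σ, -, hσ⟩ := Finset.exists_max_image Finset.univ
      (fun σ => likelihood n d P Q σ W) Finset.univ_nonempty
    exact ⟨σ, by simpa [likelihoodMaximizers] using hσ⟩
  refine ⟨_, rfl, ?_⟩
  have h1 : chosenPerm (likelihoodMaximizers n d P Q W) ∈ likelihoodMaximizers n d P Q W := by
    rw [chosenPerm, dif_pos h]
    exact h.choose_spec
  simpa [likelihoodMaximizers] using h1

lemma card_symmDiff_matching {n : ℕ} (σ π : Equiv.Perm (Fin n)) :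
    (matching σ ∆ matching π).card = 2 * (Finset.univ.filter fun i => σ i ≠ π i).card := by
  have h1 : ∀ σ π : Equiv.Perm (Fin n), (matching σ \ matching π).card =
      (Finset.univ.filter fun i => σ i ≠ π i).card := by
    intro σ π
    refine Finset.card_nbij' (fun e => e.1) (fun i => (i, σ i)) ?_ ?_ ?_ ?_
    · rintro ⟨i, j⟩ h
      simp only [matching, Finset.coe_sdiff, Finset.coe_filter, Finset.mem_univ, true_and,
        Set.mem_sdiff, Set.mem_ofPred_eq] at h ⊢
      exact fun h2 => h.2 (h2.symm.trans h.1)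
    · intro i h
      simp only [matching, Finset.coe_sdiff, Finset.coe_filter, Finset.mem_univ, true_and,
        Set.mem_sdiff, Set.mem_ofPred_eq] at h ⊢
      exact fun h2 => h h2.symm
    · rintro ⟨i, j⟩ h
      simp only [matching, Finset.coe_sdiff, Finset.coe_filter, Finset.mem_univ, true_and,
        Set.mem_sdiff, Set.mem_ofPred_eq] at h ⊢
      rw [h.1]
    · intro i _
      rfl
  rw [symmDiff_def, Finset.sup_eq_union, Finset.card_union_of_disjoint disjoint_sdiff_sdiff, h1,
    h1, two_mul]
  simp only [ne_comm]

/-- Choose the `k` rows, then permute them: `n.choose k * k!` possibilities. -/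
lemma card_perm_ne_le {n : ℕ} (σ : Equiv.Perm (Fin n)) (k : ℕ) :
    (Finset.univ.filter fun π : Equiv.Perm (Fin n) =>
      (Finset.univ.filter fun i => σ i ≠ π i).card = k).card ≤ n.descFactorial k := by
  classical
  have h1 : ∀ S : Finset (Fin n), (Finset.univ.filter fun π : Equiv.Perm (Fin n) =>
      (Finset.univ.filter fun i => σ i ≠ π i) = S).card ≤ S.card.factorial := by
    intro S
    have h2 : S.card.factorial = Fintype.card (Equiv.Perm {a // a ∈ S}) := by
      rw [Fintype.card_perm, Fintype.card_coe]
    rw [h2, ← Fintype.card_congr (Equiv.Perm.subtypeEquivSubtypePerm fun a => a ∈ S).symm,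
      Fintype.card_subtype]
    refine Finset.card_le_card_of_injOn (fun π => σ⁻¹ * π) ?_ ?_
    · intro π hπ
      simp only [Finset.coe_filter, Finset.mem_univ, true_and, Set.mem_ofPred_eq] at hπ ⊢
      intro a ha
      have h3 : a ∉ Finset.univ.filter fun i => σ i ≠ π i := hπ ▸ ha
      simp only [Finset.mem_filter, Finset.mem_univ, true_and, not_not] at h3
      rw [Equiv.Perm.mul_apply, ← h3]
      simp
    · intro π _ π' _ h
      exact mul_left_cancel h
  calc _ ≤ (((Finset.univ : Finset (Fin n)).powersetCard k).biUnion fun S =>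
        Finset.univ.filter fun π : Equiv.Perm (Fin n) =>
          (Finset.univ.filter fun i => σ i ≠ π i) = S).card := by
        refine Finset.card_le_card fun π hπ => Finset.mem_biUnion.2
          ⟨_, Finset.mem_powersetCard.2 ⟨Finset.subset_univ _, (Finset.mem_filter.1 hπ).2⟩, ?_⟩
        simp
    _ ≤ ∑ S ∈ (Finset.univ : Finset (Fin n)).powersetCard k, S.card.factorial :=
        Finset.card_biUnion_le.trans (Finset.sum_le_sum fun S _ => h1 S)
    _ = ∑ _S ∈ (Finset.univ : Finset (Fin n)).powersetCard k, k.factorial :=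
        Finset.sum_congr rfl fun S hS => by rw [(Finset.mem_powersetCard.1 hS).2]
    _ = n.descFactorial k := by
        rw [Finset.sum_const, Finset.card_powersetCard, Finset.card_univ, Fintype.card_fin,
          smul_eq_mul, Nat.descFactorial_eq_factorial_mul_choose, mul_comm]

/-- From `1 - i / n ≤ exp (-i / n)`. The gain over `n ^ k` is what settles the critical case. -/
lemma descFactorial_le_exp {n : ℕ} (hn : 0 < n) (k : ℕ) (hk : k ≤ n) :
    (n.descFactorial k : ℝ) ≤ n ^ k * Real.exp (-(k * (k - 1) / (2 * n))) := by
  have hn' : (0 : ℝ) < n := Nat.cast_pos.2 hn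
  have h1 : ∑ i ∈ Finset.range k, (i : ℝ) = k * (k - 1) / 2 := by
    induction k with
    | zero => simp
    | succ k ih =>
      rw [Finset.sum_range_succ, ih (by omega)]
      push_cast
      ring
  rw [Nat.descFactorial_eq_prod_range]
  push_cast
  calc ∏ i ∈ Finset.range k, ((n - i : ℕ) : ℝ)
      ≤ ∏ i ∈ Finset.range k, ((n : ℝ) * Real.exp (-(i / n))) := by
        refine Finset.prod_le_prod (fun i _ => Nat.cast_nonneg _) fun i hi => ?_
        have hi' : i ≤ n := (Finset.mem_range.1 hi).le.trans hk
        rw [Nat.cast_sub hi']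
        calc (n : ℝ) - i = n * (-(i / n) + 1) := by field_simp; ring
          _ ≤ _ := by
            gcongr
            exact Real.add_one_le_exp _
    _ = _ := by
        rw [Finset.prod_mul_distrib, Finset.prod_const, Finset.card_range, ← Real.exp_sum,
          Finset.sum_neg_distrib, ← Finset.sum_div, h1]
        congr 3
        field_simp

end MaximumLikelihood

end PlantedMatching

namespace PlantedMatching

/-! ### Almost perfect recovery up to and including the threshold. -/

section Achievability

variable {X : Type*} [MeasurableSpace X]

lemma bhattacharyya_nonneg (P Q : Measure X) : 0 ≤ bhattacharyya P Q :=
  integral_nonneg fun _ => Real.sqrt_nonneg _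

lemma loss_nonneg {n : ℕ} (M M' : Finset (Fin n × Fin n)) : 0 ≤ loss M M' :=
  div_nonneg (Nat.cast_nonneg _) (Nat.cast_nonneg _)

lemma risk_nonneg (n : ℕ) (d : ℝ) (P Q : Measure X) (κ : Estimator n X) :
    0 ≤ risk n d P Q κ :=
  div_nonneg (Finset.sum_nonneg fun _ _ => integral_nonneg fun _ => integral_nonneg fun _ =>
    loss_nonneg _ _) (Nat.cast_nonneg _)

/-- The loss of the maximum likelihood estimator exceeds `2 δ` only if the likelihood prefers some
matching far from the planted one. -/
lemma loss_maxLikelihood_le (P Q : Measure X) {n : ℕ} (hn : 0 < n) (d : ℝ) {δ : ℝ} (hδ : 0 ≤ δ)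
    (σ : Equiv.Perm (Fin n)) (W : WeightedGraph n X) :
    loss (matching σ) (maxLikelihood n d P Q W) ≤ 2 * δ +
      ∑ π ∈ Finset.univ.filter fun π : Equiv.Perm (Fin n) =>
          δ * n ≤ (Finset.univ.filter fun i => σ i ≠ π i).card,
        {W | likelihood n d P Q σ W ≤ likelihood n d P Q π W}.indicator (fun _ => (2 : ℝ)) W := by
  have hn' : (0 : ℝ) < n := Nat.cast_pos.2 hn
  obtain ⟨π, hπ, hmax⟩ := maxLikelihood_spec n d P Q W
  have hnonneg : ∀ π : Equiv.Perm (Fin n), 0 ≤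
      {W | likelihood n d P Q σ W ≤ likelihood n d P Q π W}.indicator (fun _ => (2 : ℝ)) W :=
    fun π => Set.indicator_nonneg (fun _ _ => by norm_num) _
  rw [hπ, loss, card_symmDiff_matching]
  push_cast
  by_cases h : δ * n ≤ (Finset.univ.filter fun i => σ i ≠ π i).card
  · have h1 := Finset.single_le_sum (fun π _ => hnonneg π)
      ((Finset.mem_filter (p := fun π : Equiv.Perm (Fin n) =>
        δ * n ≤ (Finset.univ.filter fun i => σ i ≠ π i).card)).2 ⟨Finset.mem_univ π, h⟩)
    rw [Set.indicator_of_mem (show W ∈ {W | likelihood n d P Q σ W ≤ likelihood n d P Q π W}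
      from hmax σ)] at h1
    have h2 : ((Finset.univ.filter fun i => σ i ≠ π i).card : ℝ) ≤ n := by
      exact_mod_cast (Finset.card_le_univ _).trans (Fintype.card_fin n).le
    have h3 : 2 * ((Finset.univ.filter fun i => σ i ≠ π i).card : ℝ) / n ≤ 2 := by
      rw [div_le_iff₀ hn']
      linarith
    linarith
  · have h1 := Finset.sum_nonneg (s := Finset.univ.filter fun π : Equiv.Perm (Fin n) =>
      δ * n ≤ (Finset.univ.filter fun i => σ i ≠ π i).card) fun π _ => hnonneg π
    have h3 : 2 * ((Finset.univ.filter fun i => σ i ≠ π i).card : ℝ) / n ≤ 2 * δ := by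
      rw [div_le_iff₀ hn']
      linarith
    linarith

/-- A union bound over the matchings with at least `δ * n` wrong rows, grouped by the number `k` of
wrong rows; such a matching differs from the planted one in `2 * k` pairs. -/
lemma risk_maxLikelihood_le (P Q : Measure X) [IsProbabilityMeasure P] [IsProbabilityMeasure Q]
    {n : ℕ} (hn : 0 < n) {d : ℝ} (hd0 : 0 ≤ d) (hdn : d ≤ n) {δ : ℝ}
    (hδ : 0 ≤ δ) :
    risk n d P Q (Kernel.deterministic _ (measurable_maxLikelihood n d P Q)) ≤
      2 * δ + 2 * ∑ k ∈ (Finset.range (n + 1)).filter fun k : ℕ => δ * n ≤ k,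
        n.descFactorial k * (√(d / n) * bhattacharyya P Q) ^ (2 * k) := by
  set r := √(d / n) * bhattacharyya P Q with hr
  have hr0 : 0 ≤ r := mul_nonneg (Real.sqrt_nonneg _) (bhattacharyya_nonneg P Q)
  rw [risk, div_le_iff₀ (Nat.cast_pos.2 n.factorial_pos)]
  have hcard : (n.factorial : ℝ) = (Finset.univ : Finset (Equiv.Perm (Fin n))).card := by
    rw [Finset.card_univ, Fintype.card_perm, Fintype.card_fin]
  rw [hcard, mul_comm _ ((Finset.card _ : ℕ) : ℝ), ← nsmul_eq_mul]
  refine Finset.sum_le_card_nsmul _ _ _ fun σ _ => ?_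
  have hprob : IsProbabilityMeasure (graphLaw n d P Q σ) := by
    have := fun e => isProbabilityMeasure_entry hn hd0 hdn P Q σ e
    unfold graphLaw
    infer_instance
  have hA : ∀ π, MeasurableSet {W | likelihood n d P Q σ W ≤ likelihood n d P Q π W} := fun π =>
    measurableSet_le (measurable_likelihood n d P Q σ) (measurable_likelihood n d P Q π)
  have hint : ∀ π, Integrable ({W | likelihood n d P Q σ W ≤ likelihood n d P Q π W}.indicator
      fun _ => (2 : ℝ)) (graphLaw n d P Q σ) := fun π => (integrable_const _).indicator (hA π)
  set F := Finset.univ.filter fun π : Equiv.Perm (Fin n) =>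
    δ * n ≤ (Finset.univ.filter fun i => σ i ≠ π i).card
  have hinner : ∀ W, ∫ M, loss (matching σ) M
      ∂(Kernel.deterministic _ (measurable_maxLikelihood n d P Q) W) =
        loss (matching σ) (maxLikelihood n d P Q W) := fun W => by
    rw [Kernel.deterministic_apply, integral_dirac]
  calc _ = ∫ W, loss (matching σ) (maxLikelihood n d P Q W) ∂(graphLaw n d P Q σ) := by
        simp only [hinner]
    _ ≤ ∫ W, (2 * δ + ∑ π ∈ F,
          {W | likelihood n d P Q σ W ≤ likelihood n d P Q π W}.indicator (fun _ => (2 : ℝ)) W)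
          ∂(graphLaw n d P Q σ) := by
        refine integral_mono_of_nonneg (ae_of_all _ fun W => loss_nonneg _ _)
          ((integrable_const _).add (integrable_finsetSum _ fun π _ => hint π))
          (ae_of_all _ fun W => loss_maxLikelihood_le P Q hn d hδ σ W)
    _ = 2 * δ + ∑ π ∈ F, 2 * (graphLaw n d P Q σ).real
          {W | likelihood n d P Q σ W ≤ likelihood n d P Q π W} := by
        rw [integral_add (integrable_const _) (integrable_finsetSum _ fun π _ => hint π),
          integral_finsetSum _ fun π _ => hint π, integral_const]
        simp only [integral_indicator_const _ (hA _), probReal_univ, smul_eq_mul, one_mul]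
        congr 1
        exact Finset.sum_congr rfl fun π _ => mul_comm _ _
    _ ≤ 2 * δ + ∑ π ∈ F, 2 * r ^ (2 * (Finset.univ.filter fun i => σ i ≠ π i).card) := by
        gcongr with π _
        rw [measureReal_def]
        refine ENNReal.toReal_le_of_le_ofReal (by positivity) ?_
        rw [ENNReal.ofReal_pow hr0, ← card_symmDiff_matching]
        exact graphLaw_likelihood_le P Q hn hd0 hdn σ π
    _ = 2 * δ + 2 * ∑ k ∈ (Finset.range (n + 1)).filter fun k : ℕ => δ * n ≤ k,
          ∑ π ∈ F with (Finset.univ.filter fun i => σ i ≠ π i).card = k,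
            r ^ (2 * (Finset.univ.filter fun i => σ i ≠ π i).card) := by
        rw [Finset.sum_fiberwise_of_maps_to, Finset.mul_sum]
        intro π hπ
        refine Finset.mem_filter.2 ⟨Finset.mem_range.2 (Nat.lt_succ_of_le ?_),
          (Finset.mem_filter.1 hπ).2⟩
        exact (Finset.card_le_univ _).trans (Fintype.card_fin n).le
    _ ≤ _ := by
        gcongr with k _
        have h1 : ∀ π ∈ F.filter fun π => (Finset.univ.filter fun i => σ i ≠ π i).card = k,
            r ^ (2 * (Finset.univ.filter fun i => σ i ≠ π i).card) ≤ r ^ (2 * k) := fun π hπ => by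
          rw [(Finset.mem_filter.1 hπ).2]
        refine (Finset.sum_le_card_nsmul _ _ _ h1).trans ?_
        rw [nsmul_eq_mul]
        gcongr
        refine (Finset.card_le_card ?_).trans (card_perm_ne_le σ k)
        exact Finset.filter_subset_filter _ (Finset.subset_univ _)

/-- The growth `(1 + δ / 16) ^ (2 * k) ≤ exp (δ * k / 8)` loses against the gain `exp (-δ * k / 4)`
of the falling factorial over `n ^ k`. -/
lemma descFactorial_mul_pow_le {n k : ℕ} (hn : 0 < n) (hk : k ≤ n) {d B δ : ℝ} (hd0 : 0 ≤ d)
    (hB : 0 ≤ B) (hδ : 0 < δ) (hδn : 2 ≤ δ * n) (hkδ : δ * n ≤ k) (hdB : √d * B ≤ 1 + δ / 16) :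
    n.descFactorial k * (√(d / n) * B) ^ (2 * k) ≤ Real.exp (-(δ ^ 2 / 8 * n)) := by
  have hn' : (0 : ℝ) < n := Nat.cast_pos.2 hn
  have h1 : (n : ℝ) ^ k * (√(d / n) * B) ^ (2 * k) = (√d * B) ^ (2 * k) := by
    rw [pow_mul, pow_mul, ← mul_pow]
    congr 1
    rw [mul_pow, mul_pow, Real.sq_sqrt (by positivity), Real.sq_sqrt hd0]
    field_simp
  have h2 : (√d * B) ^ (2 * k) ≤ Real.exp (δ / 8 * k) := by
    calc (√d * B) ^ (2 * k) ≤ (Real.exp (δ / 16)) ^ (2 * k) := by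
          gcongr
          linarith [Real.add_one_le_exp (δ / 16)]
      _ = Real.exp (δ / 8 * k) := by
          rw [← Real.exp_nat_mul]
          congr 1
          push_cast
          ring
  calc n.descFactorial k * (√(d / n) * B) ^ (2 * k)
      ≤ n ^ k * Real.exp (-(k * (k - 1) / (2 * n))) * (√(d / n) * B) ^ (2 * k) := by
        gcongr
        exact descFactorial_le_exp hn k hk
    _ = (√d * B) ^ (2 * k) * Real.exp (-(k * (k - 1) / (2 * n))) := by
        rw [← h1]
        ring
    _ ≤ Real.exp (δ / 8 * k) * Real.exp (-(k * (k - 1) / (2 * n))) := by gcongr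
    _ ≤ Real.exp (-(δ ^ 2 / 8 * n)) := by
        rw [← Real.exp_add, Real.exp_le_exp]
        -- Since `δ * n ≥ 2`, one has `k - 1 ≥ δ * n - 1 ≥ δ * n / 2`.
        have h3 : δ / 4 ≤ ((k : ℝ) - 1) / (2 * n) := by
          rw [le_div_iff₀ (by positivity)]
          linarith
        have h4 : (k : ℝ) * (δ / 4) ≤ k * (k - 1) / (2 * n) := by
          rw [mul_div_assoc]
          gcongr
        nlinarith [mul_le_mul_of_nonneg_left hkδ hδ.le]

/-- Almost perfect recovery by maximum likelihood. -/
theorem almostPerfectRecovery_of_limsup_le (d : ℕ → ℝ)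
    (P : Measure X) (Q : ℕ → Measure X) [IsProbabilityMeasure P]
    (hQ : ∀ᶠ n in atTop, IsProbabilityMeasure (Q n))
    (hd : ∀ᶠ n : ℕ in atTop, 0 ≤ d n ∧ d n ≤ n)
    (hB : ∀ δ : ℝ, 0 < δ → ∀ᶠ n in atTop, √(d n) * bhattacharyya P (Q n) ≤ 1 + δ) :
    AlmostPerfectRecovery d P Q := by
  refine ⟨fun n => maxLikelihood n (d n) P (Q n),
    fun n => measurable_maxLikelihood n (d n) P (Q n), ?_⟩
  rw [Metric.tendsto_atTop']
  -- Small deviations contribute `2 * δ`, and the union bound less than `δ`.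
  suffices H : ∀ δ : ℝ, 0 < δ → ∀ᶠ n in atTop, risk n (d n) P (Q n)
      (Kernel.deterministic _ (measurable_maxLikelihood n (d n) P (Q n))) < 3 * δ by
    intro ε hε
    obtain ⟨N, hN⟩ := eventually_atTop.1 (H (ε / 3) (by positivity))
    refine ⟨N, fun n hn => ?_⟩
    rw [Real.dist_eq, sub_zero, abs_of_nonneg (risk_nonneg _ _ _ _ _)]
    linarith [hN n hn.le]
  intro δ hδ
  have hlim : Tendsto (fun n : ℕ => 2 * (((n : ℝ) + 1) * Real.exp (-(δ ^ 2 / 8 * n))))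
      atTop (𝓝 0) := by
    have hc : (0 : ℝ) < δ ^ 2 / 8 := by positivity
    have h1 : Tendsto (fun x : ℝ => x ^ (1 : ℝ) * Real.exp (-(δ ^ 2 / 8) * x)) atTop (𝓝 0) :=
      tendsto_rpow_mul_exp_neg_mul_atTop_nhds_zero 1 _ hc
    have h2 : Tendsto (fun x : ℝ => x ^ (0 : ℝ) * Real.exp (-(δ ^ 2 / 8) * x)) atTop (𝓝 0) :=
      tendsto_rpow_mul_exp_neg_mul_atTop_nhds_zero 0 _ hc
    have h3 := ((h1.add h2).const_mul 2).comp (tendsto_natCast_atTop_atTop (R := ℝ))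
    simp only [add_zero, mul_zero] at h3
    refine h3.congr fun n => ?_
    simp only [Function.comp, Real.rpow_one, Real.rpow_zero, neg_mul]
    ring
  filter_upwards [hQ, hd, hB (δ / 16) (by positivity), eventually_gt_atTop 0,
    hlim.eventually_lt_const hδ,
    (tendsto_natCast_atTop_atTop (R := ℝ)).eventually_ge_atTop (2 / δ)] with n hQn hdn hBn hn hsmall
    hlarge
  have hδn : 2 ≤ δ * n := by
    rw [div_le_iff₀ hδ] at hlarge
    linarith
  refine (risk_maxLikelihood_le P (Q n) hn hdn.1 hdn.2 hδ.le).trans_lt ?_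
  have hsum : ∑ k ∈ (Finset.range (n + 1)).filter fun k : ℕ => δ * n ≤ k,
      n.descFactorial k * (√(d n / n) * bhattacharyya P (Q n)) ^ (2 * k) ≤
        ((n : ℝ) + 1) * Real.exp (-(δ ^ 2 / 8 * n)) := by
    refine (Finset.sum_le_card_nsmul _ _ (Real.exp (-(δ ^ 2 / 8 * n))) fun k hk => ?_).trans ?_
    · obtain ⟨hk1, hk2⟩ := Finset.mem_filter.1 hk
      exact descFactorial_mul_pow_le hn (Nat.lt_succ_iff.1 (Finset.mem_range.1 hk1)) hdn.1
        (bhattacharyya_nonneg _ _) hδ hδn hk2 hBn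
    · rw [nsmul_eq_mul]
      gcongr
      have := Finset.card_filter_le (Finset.range (n + 1)) fun k : ℕ => δ * n ≤ k
      rw [Finset.card_range] at this
      exact_mod_cast this
  linarith

end Achievability

end PlantedMatching

/-! ### The main theorem. -/

open PlantedMatching in
theorem theorem2 :
    -- Sparse model: `d`, `P`, `Q` do not depend on `n`.
    (∀ {X : Type*} [MeasurableSpace X] (P Q : Measure X)
      [IsProbabilityMeasure P] [IsProbabilityMeasure Q] (ε : ℝ), 0 < ε →
      ∃ c : ℝ, 0 < c ∧ ∀ d : ℝ, 1 + ε ≤ √d * bhattacharyya P Q →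
        ErrorAtLeast c (fun _ => d) P (fun _ => Q)) ∧
    -- Dense model: `d n → ∞`, `P` has density `p`, and `Q` has density `ρ (x / d n) / d n`.
    -- `S` is the range of the weights, the real line or the half-line `[0, ∞)`.
    (∀ (p ρ : ℝ → ℝ≥0∞) (S : Set ℝ),
      Measurable p → ∫⁻ x, p x = 1 → Measurable ρ → ∫⁻ x, ρ x = 1 →
      (S = Set.univ ∨ S = Set.Ici 0) → (∀ x ∉ S, ρ x = 0) →
      ContinuousWithinAt ρ S 0 → 0 < ρ 0 → ρ 0 < ∞ → ∀ ε : ℝ, 0 < ε →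
      ∃ c : ℝ, 0 < c ∧ ∀ d : ℕ → ℝ, Tendsto d atTop atTop → (∀ᶠ n : ℕ in atTop, d n ≤ n) →
        -- the condition in its limiting form `√ρ(0) ∫ √p ≥ 1 + ε`
        (ENNReal.ofReal (1 + ε) ≤ ρ 0 ^ (1 / 2 : ℝ) * ∫⁻ x in S, p x ^ (1 / 2 : ℝ) →
          ErrorAtLeast c d (volume.withDensity p) (fun n => scaledNull ρ (d n))) ∧
        -- the condition in the form `√d B(P, Q) ≥ 1 + ε`, for bounded `ρ`
        ((∃ K : ℝ≥0∞, K < ∞ ∧ ∀ x, ρ x ≤ K) →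
          (∀ᶠ n in atTop,
            1 + ε ≤ √(d n) * bhattacharyya (volume.withDensity p) (scaledNull ρ (d n))) →
          ErrorAtLeast c d (volume.withDensity p) (fun n => scaledNull ρ (d n)))) ∧
    -- Sharpness of the threshold, for both models.
    (∀ {X : Type*} [MeasurableSpace X] (d : ℕ → ℝ) (P : Measure X) (Q : ℕ → Measure X)
      [IsProbabilityMeasure P], (∀ᶠ n in atTop, IsProbabilityMeasure (Q n)) →
      (∀ᶠ n : ℕ in atTop, 0 ≤ d n ∧ d n ≤ n) →
      (∀ δ : ℝ, 0 < δ → ∀ᶠ n in atTop, √(d n) * bhattacharyya P (Q n) ≤ 1 + δ) →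
      AlmostPerfectRecovery d P Q) ∧
    -- Exponential model: the threshold is `lam = 4`.
    (∀ lam : ℝ, 0 < lam →
      (lam < 4 → ∃ c : ℝ, 0 < c ∧
        ErrorAtLeast c (fun n => n) (expMeasure lam) (fun n => expMeasure (1 / n))) ∧
      (4 ≤ lam →
        AlmostPerfectRecovery (fun n => n) (expMeasure lam) (fun n => expMeasure (1 / n)))) := by
  refine ⟨fun P Q _ _ ε hε => sparse_lower_bound P Q hε, ?_,
    fun d P Q _ hQ hd hB => almostPerfectRecovery_of_limsup_le d P Q hQ hd hB,
    fun lam hlam => ⟨?_, ?_⟩⟩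
  · intro p ρ S hp hp1 hρ hρ1 hS hρS hcont hρ0 hρ0' ε hε
    -- The limiting condition involves neither `d` nor `n`. If it holds, it provides the constant
    -- for both forms; if it fails, the second form cannot hold either and any constant will do.
    by_cases h : ENNReal.ofReal (1 + ε) ≤ ρ 0 ^ (1 / 2 : ℝ) * ∫⁻ x in S, p x ^ (1 / 2 : ℝ)
    · have h1 : 1 < ρ 0 ^ (1 / 2 : ℝ) * ∫⁻ x in S, p x ^ (1 / 2 : ℝ) :=
        (ENNReal.one_lt_ofReal.2 (by linarith)).trans_le h
      obtain ⟨c, hc, H⟩ := dense_lower_bound hp hp1 hρ hρ1 hS hcont hρ0' h1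
      exact ⟨c, hc, fun d hd hdn => ⟨fun _ => H d hd hdn, fun _ _ => H d hd hdn⟩⟩
    · refine ⟨1, one_pos, fun d hd _ => ⟨fun h' => absurd h' h, fun ⟨K, hK, hρK⟩ hb => ?_⟩⟩
      exact absurd (limiting_condition_of_bounded hp hp1 hρ hρ1 hS hρS hcont hρ0 hK hρK hd hb) h
  · exact fun h4 => exponential_lower_bound hlam h4
  · intro h4
    have := isProbabilityMeasure_expMeasure hlam
    refine almostPerfectRecovery_of_limsup_le _ _ _ ?_ ?_ ?_
    · filter_upwards [eventually_gt_atTop 0] with n hn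
      exact isProbabilityMeasure_expMeasure (by positivity)
    · exact Eventually.of_forall fun n => ⟨Nat.cast_nonneg n, le_rfl⟩
    · intro δ hδ
      filter_upwards [eventually_gt_atTop 0] with n hn
      rw [sqrt_mul_bhattacharyya_expMeasure hlam hn]
      -- From `√lam ≥ 2` follows `2 * √lam ≤ lam`, so `√n * B = 2 * √lam / (lam + 1 / n)` is below
      -- `1` even at `lam = 4`.
      have h2 : 2 ≤ √lam := Real.le_sqrt_of_sq_le (by linarith)
      have h3 : √lam * √lam = lam := Real.mul_self_sqrt hlam.le
      have hn' : (0 : ℝ) < 1 / n := by positivity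
      refine le_trans ?_ (le_add_of_nonneg_right hδ.le)
      rw [div_le_one (by positivity)]
      nlinarith
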